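/- All graphs are simple and finite. The cube (third power) $P_3(T)$ of a graph $T$ is the graph on the vertex set of $T$ in which two distinct vertices are adjacent if and only if their distance in $T$ is at most $3$. The deck of a graph $G$ is the multiset of the isomorphism classes of its vertex-deleted subgraphs $G-v$, one for each vertex $v$ of $G$. Let $\mathbb{C}$ be the class of all graphs that are isomorphic to $P_3(T)$ for some tree $T$. Lemma 4.1. The class $\mathbb{C}$ is weakly reconstructible, that is, no two non-isomorphic members of $\mathbb{C}$ have the same deck: if $G,H\in\mathbb{C}$ have the same deck, then $G\cong H$. -/

import Mathlib

universe u

namespace SimpleGraph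

/-- The `k`-th power of a graph `G`: it has the same vertices, and two distinct vertices are
adjacent if and only if their distance in `G` is at most `k` (the extended distance is used, so
that vertices in different components are at distance `⊤`). -/
def kthPower {V : Type u} (G : SimpleGraph V) (k : ℕ) : SimpleGraph V where
  Adj x y := x ≠ y ∧ G.edist x y ≤ (k : ℕ∞)
  symm := ⟨fun x y h => ⟨h.1.symm, by rw [edist_comm]; exact h.2⟩⟩
  loopless := ⟨fun _ h => h.1 rfl⟩

/-- `G` is isomorphic to the third power (cube) of some tree. -/
def IsTreeCube {V : Type u} (G : SimpleGraph V) : Prop :=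
  ∃ (U : Type u) (T : SimpleGraph U), T.IsTree ∧ Nonempty (G ≃g T.kthPower 3)

/-- Graph isomorphism, as an equivalence relation on all graphs. -/
def isoSetoid : Setoid (Σ V : Type u, SimpleGraph V) where
  r A B := Nonempty (A.2 ≃g B.2)
  iseqv :=
    ⟨fun _ => ⟨RelIso.refl _⟩, fun ⟨e⟩ => ⟨e.symm⟩, fun ⟨e⟩ ⟨f⟩ => ⟨e.trans f⟩⟩

/-- An unlabelled graph is an isomorphism class of graphs. -/
def Unlabelled : Type (u + 1) := Quotient isoSetoid.{u}

/-- The unlabelled graph underlying a graph. -/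
def unlabel {V : Type u} (G : SimpleGraph V) : Unlabelled.{u} :=
  Quotient.mk isoSetoid ⟨V, G⟩

/-- The card of `G` at `v`: the unlabelled graph obtained from `G` by deleting the vertex `v`
together with its incident edges. -/
def card {V : Type u} (G : SimpleGraph V) (v : V) : Unlabelled.{u} :=
  unlabel (G.induce ({v}ᶜ : Set V))

/-- The deck of a finite graph: the multiset of its cards, one for each vertex. -/
def deck {V : Type u} [Fintype V] (G : SimpleGraph V) : Multiset Unlabelled.{u} :=
  (Finset.univ : Finset V).val.map G.card

/-- A class `C` of graphs is weakly reconstructible if no two non-isomorphic finite members of `C`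
have the same deck. -/
def IsWeaklyReconstructible (C : ∀ V : Type u, SimpleGraph V → Prop) : Prop :=
  ∀ (V W : Type u) [Fintype V] [Fintype W] (G : SimpleGraph V) (H : SimpleGraph W),
    C V G → C W H → G.deck = H.deck → Nonempty (G ≃g H)

end SimpleGraph

/-! The cube of a tree of diameter at most three is complete. If the diameter of `T` is larger, then
the simplicial vertices of the cube of `T` are the deep leaves of `T`, those attached to a vertex
with at most one neighbour that is not a leaf; Kelly's counting of the cliques with two and three
vertices recognises them in the deck. Deleting a leaf commutes with taking the cube, and a tree is
determined by its cube unless the cube is complete: the closed neighbourhood of a vertex with two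
neighbours that are not leaves is the intersection of two closed neighbourhoods in the cube, and the
deep leaves with a given neighbour form a class of twins. Hence, if two cubes have the same deck and
no complete card, the deletions of the deep leaves of the two trees `T` and `S` are matched by
isomorphisms. If some card is complete, the degree of the missing vertex determines the graph.

Identify one deletion of `T` with the matching one of `S`. Then `S` arises from `T` by moving a leaf
from one end of a path to the other. Summed over the deletions of all deep leaves, the numbers of
branches (the rooted components left by the removal of an edge) of each isomorphism type agree for
`T` and `S`, and the contributions of the edges off the path cancel. What remains shows that the
smaller of the branches at the two ends of the path have the same deck of leaf deletions, and a
rooted tree is determined by its size and this deck. Proceeding inwards along the path, the branches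
of `S` and of `T` seen from opposite ends are isomorphic, so that reflecting the path is an
isomorphism from `T` to `S`. -/

/-! ### Codes of rooted trees -/

/-- A code for a finite unordered rooted tree. The tree is coded by the multiset of the codes of
the branches at its root, through Mathlib's bijection between finite multisets of natural numbers
and natural numbers; this avoids quotients of trees by isomorphism. -/
abbrev TreeCode : Type := ℕ

namespace TreeCode

open Multiset (replicate)

/-- The code of the rooted tree whose root has the branches `M`. -/
def node : Multiset TreeCode ≃ TreeCode := Denumerable.eqv (Multiset ℕ)

/-- The multiset of codes of the branches at the root. -/
def kids (c : TreeCode) : Multiset TreeCode := node.symm c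

@[simp] theorem kids_node (M : Multiset TreeCode) : kids (node M) = M := node.symm_apply_apply M

@[simp] theorem node_kids (c : TreeCode) : node (kids c) = c := node.apply_symm_apply c

theorem lt_add_encode_of_mem_raise {a : ℕ} :
    ∀ (l : List ℕ) (n : ℕ), a ∈ Denumerable.raise l n → a < n + Encodable.encode l
  | [], n, h => by simp [Denumerable.raise] at h
  | m :: l, n, h => by
    have hpair := Nat.add_le_pair m (Encodable.encode l)
    simp only [Denumerable.raise, List.mem_cons, Encodable.encode_list_cons, Encodable.encode_nat,
      Nat.succ_eq_add_one] at h ⊢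
    rcases h with rfl | h
    · omega
    · have := lt_add_encode_of_mem_raise l (m + n) h
      omega

theorem lt_of_mem_kids {a c : TreeCode} (h : a ∈ kids c) : a < c := by
  have h' : a ∈ Multiset.map (Denumerable.ofNat ℕ)
      (Denumerable.raise (Denumerable.ofNat (List ℕ) c) 0 : List ℕ) := h
  simp only [Multiset.map_coe, Multiset.mem_coe, List.mem_map, Denumerable.ofNat_nat,
    exists_eq_right] at h'
  simpa using lt_add_encode_of_mem_raise _ _ h'

theorem lt_node_of_mem {a : TreeCode} {M : Multiset TreeCode} (h : a ∈ M) : a < node M :=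
  lt_of_mem_kids (by rwa [kids_node])

/-- The number of vertices of the rooted tree with code `c`. -/
def size (c : TreeCode) : ℕ := 1 + ((kids c).attach.map fun a => size a.1).sum
termination_by c
decreasing_by exact lt_of_mem_kids a.2

theorem size_node (M : Multiset TreeCode) : size (node M) = 1 + (M.map size).sum := by
  rw [size, Multiset.attach_map_val' _ size, kids_node]

theorem one_le_size (c : TreeCode) : 1 ≤ size c := by rw [size]; omega

theorem size_node_eq_add_erase {a : TreeCode} {M : Multiset TreeCode} (h : a ∈ M) :
    size (node M) = size a + size (node (M.erase a)) := by
  rw [size_node, size_node, ← Multiset.sum_map_erase h]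
  omega

theorem size_lt_size_node_of_mem {a : TreeCode} {M : Multiset TreeCode} (h : a ∈ M) :
    size a < size (node M) := by
  rw [size_node_eq_add_erase h]
  exact Nat.lt_add_of_pos_right (one_le_size _)

theorem card_le_sum_size (M : Multiset TreeCode) : M.card ≤ (M.map size).sum := by
  simpa using Multiset.card_nsmul_le_sum (s := M.map size) (a := 1) fun x hx => by
    obtain ⟨a, -, rfl⟩ := Multiset.mem_map.1 hx
    exact one_le_size a

/-- The code of the one-vertex tree. -/
def pt : TreeCode := node 0

/-- The code of the rooted tree with two vertices. -/
def edge : TreeCode := node {pt}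

@[simp] theorem size_pt : size pt = 1 := by simp [pt, size_node]

@[simp] theorem size_edge : size edge = 2 := by simp [edge, size_node]

theorem size_eq_one_iff {c : TreeCode} : size c = 1 ↔ c = pt := by
  refine ⟨fun h => ?_, by rintro rfl; exact size_pt⟩
  rw [← node_kids c, size_node] at h
  have hcard := card_le_sum_size (kids c)
  have hkids : kids c = 0 := by rw [← Multiset.card_eq_zero]; omega
  rw [← node_kids c, hkids, pt]

theorem size_eq_two_iff {c : TreeCode} : size c = 2 ↔ c = edge := by
  refine ⟨fun h => ?_, by rintro rfl; exact size_edge⟩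
  rw [← node_kids c, size_node] at h
  have hcard := card_le_sum_size (kids c)
  have hkids : kids c ≠ 0 := fun h0 => by simp [h0] at h
  have hone : (kids c).card = 1 := by have := Multiset.card_pos.2 hkids; omega
  obtain ⟨a, ha⟩ := Multiset.card_eq_one.1 hone
  rw [ha, Multiset.map_singleton, Multiset.sum_singleton] at h
  rw [← node_kids c, ha, size_eq_one_iff.1 (by omega : size a = 1), edge]

/-- The codes of the rooted trees obtained by deleting a leaf all of whose siblings are leaves; the
label tells whether the leaf was an only child. -/
def leafDeck (c : TreeCode) : Multiset (TreeCode × Bool) :=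
  if ∀ a ∈ kids c, a = pt then
    (kids c).map fun a => (node ((kids c).erase a), decide ((kids c).card = 1))
  else
    (kids c).attach.bind fun a =>
      (leafDeck a.1).map fun p => (node (p.1 ::ₘ (kids c).erase a.1), p.2)
termination_by c
decreasing_by exact lt_of_mem_kids a.2

/-- The deck of a forest `M` of branches: one of the branches is replaced by a member of its
`leafDeck`. -/
def branchDeck (M : Multiset TreeCode) : Multiset (Multiset TreeCode × Bool) :=
  M.bind fun a => (leafDeck a).map fun p => (p.1 ::ₘ M.erase a, p.2)

section BranchDeck

variable {M M' N : Multiset TreeCode} {a b c d : TreeCode} {p : TreeCode × Bool}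

theorem leafDeck_node_of_forall (h : ∀ a ∈ M, a = pt) :
    leafDeck (node M) = M.map fun a => (node (M.erase a), decide (M.card = 1)) := by
  rw [leafDeck, if_pos (by simpa using h), kids_node]

theorem leafDeck_node_of_not_forall (h : ¬ ∀ a ∈ M, a = pt) :
    leafDeck (node M) = (branchDeck M).map (Prod.map node id) := by
  have hattach := Multiset.attach_bind_coe (kids (node M))
    (fun a => (leafDeck a).map fun p => (node (p.1 ::ₘ (kids (node M)).erase a), p.2))
  rw [leafDeck, if_neg (by simpa using h), branchDeck, Multiset.map_bind, hattach, kids_node]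
  simp only [Multiset.map_map, Function.comp_def, Prod.map, id_eq]

@[simp] theorem leafDeck_pt : leafDeck pt = 0 := by
  rw [pt, leafDeck_node_of_forall (by simp), Multiset.map_zero]

@[simp] theorem leafDeck_edge : leafDeck edge = {(pt, true)} := by
  rw [edge, leafDeck_node_of_forall (by simp)]; simp [pt]

@[simp] theorem branchDeck_zero : branchDeck 0 = 0 := rfl

theorem branchDeck_cons (a : TreeCode) (M : Multiset TreeCode) :
    branchDeck (a ::ₘ M) = ((leafDeck a).map fun p => (p.1 ::ₘ M, p.2)) +
      (branchDeck M).map fun X => (a ::ₘ X.1, X.2) := by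
  rw [branchDeck, Multiset.cons_bind, Multiset.erase_cons_head, branchDeck, Multiset.map_bind]
  congr 1
  refine Multiset.bind_congr fun c hc => ?_
  rw [Multiset.map_map, Multiset.erase_cons_tail_of_mem hc]
  exact Multiset.map_congr rfl fun p _ => Prod.ext (Multiset.cons_swap _ _ _) rfl

theorem branchDeck_replicate_pt (r : ℕ) : branchDeck (replicate r pt) = 0 := by
  induction r with
  | zero => rfl
  | succ r ih => rw [Multiset.replicate_succ, branchDeck_cons, ih, leafDeck_pt]; rfl

theorem branchDeck_cons_replicate_pt (b : TreeCode) (r : ℕ) :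
    branchDeck (b ::ₘ replicate r pt) =
      (leafDeck b).map fun p => (p.1 ::ₘ replicate r pt, p.2) := by
  rw [branchDeck_cons, branchDeck_replicate_pt, Multiset.map_zero, add_zero]

theorem cons_replicate_injective (r : ℕ) : Function.Injective
    (Multiset.map fun p : TreeCode × Bool => (p.1 ::ₘ replicate r pt, p.2)) := by
  refine Multiset.map_injective fun p q h => ?_
  simp only [Prod.mk.injEq, Multiset.cons_inj_left] at h
  exact Prod.ext h.1 h.2

theorem mem_branchDeck_of_mem (ha : a ∈ M) (hp : p ∈ leafDeck a) :
    (p.1 ::ₘ M.erase a, p.2) ∈ branchDeck M :=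
  Multiset.mem_bind.2 ⟨a, ha, Multiset.mem_map_of_mem _ hp⟩

theorem exists_of_mem_branchDeck {X : Multiset TreeCode × Bool} (h : X ∈ branchDeck M) :
    ∃ a ∈ M, ∃ p ∈ leafDeck a, X = (p.1 ::ₘ M.erase a, p.2) := by
  obtain ⟨a, ha, hX⟩ := Multiset.mem_bind.1 h
  obtain ⟨p, hp, rfl⟩ := Multiset.mem_map.1 hX
  exact ⟨a, ha, p, hp, rfl⟩

theorem card_branchDeck (M : Multiset TreeCode) :
    (branchDeck M).card = (M.map fun a => (leafDeck a).card).sum := by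
  simp [branchDeck, Multiset.card_bind]

theorem card_of_mem_branchDeck {X : Multiset TreeCode × Bool} (h : X ∈ branchDeck M) :
    X.1.card = M.card := by
  obtain ⟨a, ha, p, -, rfl⟩ := exists_of_mem_branchDeck h
  rw [Multiset.card_cons, Multiset.card_erase_add_one ha]

theorem leafDeck_ne_zero (h : c ≠ pt) : leafDeck c ≠ 0 := by
  induction c using Nat.strong_induction_on with
  | _ c ih =>
    obtain ⟨M, rfl⟩ := node.surjective c
    by_cases hM : ∀ a ∈ M, a = pt
    · rw [leafDeck_node_of_forall hM, Ne, Multiset.map_eq_zero]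
      rintro rfl
      exact h rfl
    · rw [leafDeck_node_of_not_forall hM, Ne, Multiset.map_eq_zero]
      push Not at hM
      obtain ⟨a, ha, ha'⟩ := hM
      obtain ⟨p, hp⟩ := Multiset.exists_mem_of_ne_zero (ih a (lt_node_of_mem ha) ha')
      exact fun h0 => Multiset.notMem_zero _ (h0 ▸ mem_branchDeck_of_mem ha hp)

theorem branchDeck_ne_zero (h : ¬ ∀ a ∈ M, a = pt) : branchDeck M ≠ 0 := by
  push Not at h
  obtain ⟨a, ha, ha'⟩ := h
  obtain ⟨p, hp⟩ := Multiset.exists_mem_of_ne_zero (leafDeck_ne_zero ha')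
  exact fun h0 => Multiset.notMem_zero _ (h0 ▸ mem_branchDeck_of_mem ha hp)

theorem size_of_mem_leafDeck (h : p ∈ leafDeck c) : size p.1 + 1 = size c := by
  induction c using Nat.strong_induction_on generalizing p with
  | _ c ih =>
    obtain ⟨M, rfl⟩ := node.surjective c
    by_cases hM : ∀ a ∈ M, a = pt
    · rw [leafDeck_node_of_forall hM, Multiset.mem_map] at h
      obtain ⟨a, ha, rfl⟩ := h
      rw [size_node_eq_add_erase ha, hM a ha, size_pt, add_comm]
    · rw [leafDeck_node_of_not_forall hM, Multiset.mem_map] at h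
      obtain ⟨X, hX, rfl⟩ := h
      obtain ⟨a, ha, p, hp, rfl⟩ := exists_of_mem_branchDeck hX
      have := ih a (lt_node_of_mem ha) hp
      simp only [Prod.map, size_node_eq_add_erase ha, size_node, Multiset.map_cons,
        Multiset.sum_cons]
      omega

theorem sum_map_ite_eq_count {α : Type*} [DecidableEq α] (s : Multiset α) (b : α) :
    (s.map fun a => if b = a then 1 else 0).sum = s.count b := by
  induction s using Multiset.induction with
  | empty => simp
  | cons a s ih => rw [Multiset.map_cons, Multiset.sum_cons, ih, Multiset.count_cons, add_comm]

theorem sum_count_branchDeck (M : Multiset TreeCode) (b : TreeCode) :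
    ((branchDeck M).map fun X => X.1.count b).sum + M.count b * (leafDeck b).card =
      (branchDeck M).card * M.count b +
        (M.map fun a => ((leafDeck a).map Prod.fst).count b).sum := by
  have hite (D : Multiset (TreeCode × Bool)) :
      (D.map fun p => if b = p.1 then 1 else 0).sum = (D.map Prod.fst).count b := by
    rw [← sum_map_ite_eq_count, Multiset.map_map, Function.comp_def]
  induction M using Multiset.induction with
  | empty => simp
  | cons a M ih =>
    rw [branchDeck_cons]
    simp only [Multiset.map_add, Multiset.map_map, Function.comp_def, Multiset.sum_add,
      Multiset.count_cons, Multiset.card_add, Multiset.card_map, Multiset.map_cons,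
      Multiset.sum_cons, Multiset.sum_map_add, Multiset.map_const', Multiset.sum_replicate,
      smul_eq_mul, hite]
    split_ifs with h
    · subst h; linarith
    · linarith

/-- Counting the occurrences of `b` in the deck, and using agreement of the two forests above the
size of `b`, shows that every leaf deletion takes place in a copy of `b`. -/
theorem card_branchDeck_eq_of_count_ne (hdeck : branchDeck M = branchDeck M')
    (hb : M.count b ≠ M'.count b) (hmax : ∀ c, size b < size c → M.count c = M'.count c) :
    (branchDeck M).card = (leafDeck b).card := by
  have hlarge : ∀ N : Multiset TreeCode, (N.map fun a => ((leafDeck a).map Prod.fst).count b).sum =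
      ((N.filter fun a => size b < size a).map
        fun a => ((leafDeck a).map Prod.fst).count b).sum := by
    intro N
    conv_lhs => rw [← Multiset.filter_add_not (fun a => size b < size a) N]
    rw [Multiset.map_add, Multiset.sum_add, add_eq_left]
    refine Multiset.sum_eq_zero fun x hx => ?_
    obtain ⟨a, ha, rfl⟩ := Multiset.mem_map.1 hx
    refine Multiset.count_eq_zero.2 fun hc => ?_
    obtain ⟨p, hp, rfl⟩ := Multiset.mem_map.1 hc
    have := size_of_mem_leafDeck hp
    have := (Multiset.mem_filter.1 ha).2
    omega
  have hfilter : (M.filter fun a => size b < size a) = M'.filter fun a => size b < size a := by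
    ext c
    by_cases hc : size b < size c
    · simp only [Multiset.count_filter, hc, if_true, hmax c hc]
    · simp only [Multiset.count_filter, hc, if_false]
  have hM := sum_count_branchDeck M b
  have hM' := sum_count_branchDeck M' b
  rw [hlarge, hfilter, ← hlarge] at hM
  rw [← hdeck] at hM'
  zify at hM hM' hb ⊢
  have hprod :
      ((M.count b : ℤ) - M'.count b) * ((branchDeck M).card - (leafDeck b).card) = 0 := by
    linarith
  exact sub_eq_zero.1 ((mul_eq_zero.1 hprod).resolve_left (sub_ne_zero.2 hb))

theorem eq_cons_replicate_of_card_branchDeck (hb : b ∈ M)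
    (h : (branchDeck M).card = (leafDeck b).card) : M = b ::ₘ replicate (M.card - 1) pt := by
  obtain ⟨N, rfl⟩ := Multiset.exists_cons_of_mem hb
  rw [card_branchDeck, Multiset.map_cons, Multiset.sum_cons, add_eq_left,
    Multiset.sum_eq_zero_iff] at h
  congr 1
  refine Multiset.eq_replicate.2 ⟨by simp, fun a ha => ?_⟩
  by_contra hne
  exact leafDeck_ne_zero hne (Multiset.card_eq_zero.1 (h _ (Multiset.mem_map_of_mem _ ha)))

theorem leafDeck_ne_replicate_two_edge (b : TreeCode) :
    leafDeck b ≠ replicate 2 (edge, true) := by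
  intro h
  have hmem : (edge, true) ∈ leafDeck b := by rw [h]; simp
  have hsize := size_of_mem_leafDeck hmem
  obtain ⟨M, rfl⟩ := node.surjective b
  have hcard := congrArg Multiset.card h
  by_cases hM : ∀ a ∈ M, a = pt
  · rw [leafDeck_node_of_forall hM] at hmem hcard
    obtain ⟨a, -, ha⟩ := Multiset.mem_map.1 hmem
    have : M.card = 1 := of_decide_eq_true (Prod.ext_iff.1 ha).2
    rw [Multiset.card_map, Multiset.card_replicate] at hcard
    omega
  · rw [leafDeck_node_of_not_forall hM, Multiset.card_map] at hcard
    push Not at hM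
    obtain ⟨a, ha, ha'⟩ := hM
    obtain ⟨N, rfl⟩ := Multiset.exists_cons_of_mem ha
    have hsize_a := one_le_size a
    have := mt size_eq_one_iff.1 ha'
    have := card_le_sum_size N
    simp only [size_node, Multiset.map_cons, Multiset.sum_cons, size_edge] at hsize
    obtain rfl : N = 0 := by rw [← Multiset.card_eq_zero]; omega
    obtain rfl : a = edge := size_eq_two_iff.1 (by omega)
    simp [card_branchDeck] at hcard

/-- Deleting a leaf from `c` must leave a single vertex, since `d` survives. -/
theorem eq_edge_of_branchDeck_cons_cons (hc : c ≠ pt) (hd : d ≠ pt) {r : ℕ}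
    (h : ∀ X ∈ branchDeck (c ::ₘ d ::ₘ N), ∃ q, X.1 = q ::ₘ replicate r pt) :
    c = edge ∧ pt ::ₘ N = replicate r pt := by
  obtain ⟨p, hp⟩ := Multiset.exists_mem_of_ne_zero (leafDeck_ne_zero hc)
  obtain ⟨q, hq⟩ := h _ (mem_branchDeck_of_mem (Multiset.mem_cons_self _ _) hp)
  rw [Multiset.erase_cons_head] at hq
  have hdq : d = q := by
    have hmem : d ∈ q ::ₘ replicate r pt := hq ▸ by simp
    exact (Multiset.mem_cons.1 hmem).resolve_right fun h => hd (Multiset.eq_of_mem_replicate h)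
  rw [Multiset.cons_swap, hdq, Multiset.cons_inj_right] at hq
  have hpt : p.1 = pt := Multiset.eq_of_mem_replicate (n := r) (hq ▸ Multiset.mem_cons_self _ _)
  refine ⟨size_eq_two_iff.1 ?_, hpt ▸ hq⟩
  rw [← size_of_mem_leafDeck hp, hpt, size_pt]

theorem branchDeck_cons_replicate_ne_of_ne_pt (hc : c ≠ pt) (hd : d ≠ pt) (b : TreeCode) (r : ℕ) :
    branchDeck (b ::ₘ replicate r pt) ≠ branchDeck (c ::ₘ d ::ₘ N) := by
  intro h
  have hshape : ∀ X ∈ branchDeck (c ::ₘ d ::ₘ N), ∃ q, X.1 = q ::ₘ replicate r pt := by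
    intro X hX
    rw [← h, branchDeck_cons_replicate_pt, Multiset.mem_map] at hX
    obtain ⟨p, -, rfl⟩ := hX
    exact ⟨p.1, rfl⟩
  obtain ⟨rfl, hN⟩ := eq_edge_of_branchDeck_cons_cons hc hd hshape
  rw [Multiset.cons_swap] at hshape
  obtain ⟨rfl, -⟩ := eq_edge_of_branchDeck_cons_cons hd hc hshape
  obtain rfl : N = replicate (r - 1) pt := by
    have hcard := congrArg Multiset.card hN
    have hmem := fun a ha => Multiset.eq_of_mem_replicate (hN ▸ Multiset.mem_cons_of_mem ha : a ∈ _)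
    simp only [Multiset.card_cons, Multiset.card_replicate] at hcard
    exact Multiset.eq_replicate.2 ⟨by omega, hmem⟩
  refine leafDeck_ne_replicate_two_edge b (cons_replicate_injective r ?_)
  rw [← branchDeck_cons_replicate_pt, h, branchDeck_cons, branchDeck_cons_replicate_pt]
  simp only [leafDeck_edge, Multiset.map_singleton, Multiset.cons_swap pt edge, hN,
    Multiset.map_replicate]
  rfl

/-- If `b` is a largest branch on which the forests differ, it carries the whole deck, so that all
the other branches of the first forest are single vertices. -/
theorem branchDeck_ne_of_count_lt (hM' : ¬ ∀ a ∈ M', a = pt)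
    (hsum : (M.map size).sum = (M'.map size).sum)
    (ih : ∀ a ∈ M, ∀ a', size a = size a' → leafDeck a = leafDeck a' → a = a')
    (hb : M'.count b < M.count b) (hmax : ∀ c, size b < size c → M.count c = M'.count c) :
    branchDeck M ≠ branchDeck M' := by
  intro hdeck
  have hbM : b ∈ M := Multiset.count_pos.1 (by omega)
  have hM := eq_cons_replicate_of_card_branchDeck hbM
    (card_branchDeck_eq_of_count_ne hdeck hb.ne' hmax)
  have hcard : M.card = M'.card := by
    obtain ⟨X, hX⟩ := Multiset.exists_mem_of_ne_zero (branchDeck_ne_zero hM')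
    rw [← card_of_mem_branchDeck hX, card_of_mem_branchDeck (hdeck ▸ hX)]
  push Not at hM'
  obtain ⟨c, hc, hcpt⟩ := hM'
  obtain ⟨N, rfl⟩ := Multiset.exists_cons_of_mem hc
  by_cases hN : ∀ d ∈ N, d = pt
  · obtain rfl : N = replicate (M.card - 1) pt :=
      Multiset.eq_replicate.2 ⟨by rw [hcard, Multiset.card_cons, Nat.add_sub_cancel], hN⟩
    generalize M.card - 1 = r at hM hdeck hsum hb hcard hN
    subst hM
    rw [branchDeck_cons_replicate_pt, branchDeck_cons_replicate_pt] at hdeck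
    rw [Multiset.map_cons, Multiset.sum_cons, Multiset.map_cons, Multiset.sum_cons] at hsum
    have hbc : b = c := ih b hbM c (by simpa using hsum) (cons_replicate_injective _ hdeck)
    rw [hbc] at hb
    exact lt_irrefl _ hb
  · push Not at hN
    obtain ⟨d, hd, hdpt⟩ := hN
    obtain ⟨N, rfl⟩ := Multiset.exists_cons_of_mem hd
    exact branchDeck_cons_replicate_ne_of_ne_pt hcpt hdpt b _ (hM ▸ hdeck)

theorem leafDeck_node_ne_of_forall_of_not_forall (hM : ∀ a ∈ M, a = pt)
    (hM' : ¬ ∀ a ∈ M', a = pt) : leafDeck (node M) ≠ leafDeck (node M') := by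
  intro h
  rw [leafDeck_node_of_forall hM, leafDeck_node_of_not_forall hM'] at h
  push Not at hM'
  obtain ⟨c, hc, hcpt⟩ := hM'
  obtain ⟨p, hp⟩ := Multiset.exists_mem_of_ne_zero (leafDeck_ne_zero hcpt)
  have hmem := Multiset.mem_map_of_mem (Prod.map node id) (mem_branchDeck_of_mem hc hp)
  obtain ⟨a, ha, hap⟩ := Multiset.mem_map.1 (h ▸ hmem)
  simp only [Prod.map_apply, id_eq, Prod.mk.injEq, EmbeddingLike.apply_eq_iff_eq] at hap
  have hpt : p.1 = pt := hM _ (Multiset.mem_of_mem_erase (hap.1 ▸ Multiset.mem_cons_self _ _))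
  obtain rfl : c = edge := size_eq_two_iff.1 (by rw [← size_of_mem_leafDeck hp, hpt, size_pt])
  rw [leafDeck_edge, Multiset.mem_singleton] at hp
  have hcard : M.card = 1 := of_decide_eq_true (by rw [hap.2, hp])
  have herase := Multiset.card_erase_of_mem ha
  rw [hap.1, hcard] at herase
  simp at herase

theorem exists_maximal_count_ne {α : Type*} [DecidableEq α] {M M' : Multiset α} (f : α → ℕ)
    (h : M ≠ M') :
    ∃ b, M.count b ≠ M'.count b ∧ ∀ c, f b < f c → M.count c = M'.count c := by
  let D := (M + M').toFinset.filter fun b => M.count b ≠ M'.count b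
  have hD (c : α) (hc : M.count c ≠ M'.count c) : c ∈ D := by
    refine Finset.mem_filter.2 ⟨?_, hc⟩
    rw [Multiset.mem_toFinset, ← Multiset.count_pos, Multiset.count_add]
    omega
  obtain ⟨b, hb⟩ := not_forall.1 (mt Multiset.ext.2 h)
  obtain ⟨b, hbD, hmax⟩ := D.exists_max_image f ⟨b, hD b hb⟩
  refine ⟨b, (Finset.mem_filter.1 hbD).2, fun c hc => ?_⟩
  by_contra hne
  exact (hmax c (hD c hne)).not_gt hc

theorem eq_of_leafDeck_eq {c c' : TreeCode} (hs : size c = size c')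
    (h : leafDeck c = leafDeck c') : c = c' := by
  induction hn : size c using Nat.strong_induction_on generalizing c c' with
  | _ n ih =>
    subst hn
    obtain ⟨M, rfl⟩ := node.surjective c
    obtain ⟨M', rfl⟩ := node.surjective c'
    have hsum : (M.map size).sum = (M'.map size).sum := by
      rw [size_node, size_node] at hs; omega
    by_cases hM : ∀ a ∈ M, a = pt <;> by_cases hM' : ∀ a ∈ M', a = pt
    · rw [Multiset.eq_replicate_card.2 hM, Multiset.eq_replicate_card.2 hM'] at hsum ⊢
      simp only [Multiset.map_replicate, Multiset.sum_replicate, size_pt, smul_eq_mul,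
        mul_one] at hsum
      rw [hsum]
    · exact absurd h (leafDeck_node_ne_of_forall_of_not_forall hM hM')
    · exact absurd h.symm (leafDeck_node_ne_of_forall_of_not_forall hM' hM)
    rw [leafDeck_node_of_not_forall hM, leafDeck_node_of_not_forall hM'] at h
    have hdeck : branchDeck M = branchDeck M' :=
      Multiset.map_injective (Prod.map_injective.2 ⟨node.injective, fun _ _ h => h⟩) h
    by_contra hne
    obtain ⟨b, hb, hmax⟩ := exists_maximal_count_ne size (mt (congrArg node) hne)
    rcases hb.lt_or_gt with hlt | hlt
    · exact branchDeck_ne_of_count_lt hM hsum.symm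
        (fun a ha a' h1 h2 => ih _ (hs ▸ size_lt_size_node_of_mem ha) h1 h2 rfl)
        hlt (fun c hc => (hmax c hc).symm) hdeck.symm
    · exact branchDeck_ne_of_count_lt hM' hsum
        (fun a ha a' h1 h2 => ih _ (size_lt_size_node_of_mem ha) h1 h2 rfl) hlt hmax hdeck

end BranchDeck

end TreeCode

namespace TreeCube

open Finset SimpleGraph TreeCode
open scoped Classical

/-! ### Branches and leaves -/

section Metric

variable {V : Type*} {T : SimpleGraph V}

theorem dist_eq_add_one_or (hT : T.IsTree) (w : V) {u v : V} (h : T.Adj u v) :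
    T.dist u w = T.dist v w + 1 ∨ T.dist v w = T.dist u w + 1 := by
  rw [SimpleGraph.dist_comm, SimpleGraph.dist_comm (u := v)]
  exact hT.dist_eq_dist_add_one_of_adj w h

theorem exists_adj_toward (hT : T.IsTree) {v w : V} (h : v ≠ w) :
    ∃ a, T.Adj v a ∧ T.dist v w = T.dist a w + 1 := by
  obtain ⟨p, hp⟩ := hT.connected.exists_walk_length_eq_dist v w
  cases p with
  | nil => exact absurd rfl h
  | @cons _ a _ hva q =>
    refine ⟨a, hva, ?_⟩
    refine (dist_eq_add_one_or hT w hva).resolve_right fun h => ?_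
    have := dist_le q
    rw [Walk.length_cons] at hp
    omega

theorem eq_of_adj_toward (hT : T.IsTree) {v w a b : V} (ha : T.Adj v a) (hb : T.Adj v b)
    (ha' : T.dist v w = T.dist a w + 1) (hb' : T.dist v w = T.dist b w + 1) : a = b := by
  obtain ⟨p, hp⟩ := hT.connected.exists_walk_length_eq_dist a w
  obtain ⟨q, hq⟩ := hT.connected.exists_walk_length_eq_dist b w
  have hpath : (Walk.cons ha p).IsPath := Walk.isPath_of_length_eq_dist _ (by simp [hp, ha'])
  have hpath' : (Walk.cons hb q).IsPath := Walk.isPath_of_length_eq_dist _ (by simp [hq, hb'])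
  have heq := (hT.isAcyclic.subsingleton_path v w).elim ⟨_, hpath⟩ ⟨_, hpath'⟩
  simpa using congrArg (fun p : T.Path v w => p.1.snd) heq

theorem dist_eq_add_one_of_ne (hT : T.IsTree) {v w a b : V} (ha : T.Adj v a) (hb : T.Adj v b)
    (hab : a ≠ b) (ha' : T.dist v w = T.dist a w + 1) : T.dist b w = T.dist v w + 1 := by
  rcases dist_eq_add_one_or hT w hb with h | h
  · exact absurd (eq_of_adj_toward hT ha hb ha' h) hab
  · exact h

end Metric

section Branch

variable {V : Type*} [Fintype V] {T : SimpleGraph V} {u v w a b x y : V}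

/-- The vertices closer to `v` than to `u`: in a tree with an edge `uv`, the component of `v` after
the deletion of this edge. -/
noncomputable def branch (T : SimpleGraph V) (u v : V) : Finset V :=
  {w | T.dist v w < T.dist u w}

theorem mem_branch : w ∈ branch T u v ↔ T.dist v w < T.dist u w := by simp [branch]

theorem mem_branch_iff (hT : T.IsTree) (h : T.Adj u v) :
    w ∈ branch T u v ↔ T.dist u w = T.dist v w + 1 := by
  rw [mem_branch]
  rcases dist_eq_add_one_or hT w h with h | h <;> omega

theorem notMem_branch_iff (hT : T.IsTree) (h : T.Adj u v) :
    w ∉ branch T u v ↔ w ∈ branch T v u := by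
  rw [mem_branch, mem_branch]
  rcases dist_eq_add_one_or hT w h with h | h <;> omega

theorem mem_branch_right (h : T.Adj u v) : v ∈ branch T u v := by
  rw [mem_branch, dist_self, dist_eq_one_iff_adj.2 h]; omega

theorem left_notMem_branch : u ∉ branch T u v := by simp [mem_branch]

theorem mem_branch_iff_eq_or (hT : T.IsTree) (h : T.Adj u v) :
    w ∈ branch T u v ↔ w = v ∨ ∃ a, (T.Adj v a ∧ a ≠ u) ∧ w ∈ branch T v a := by
  constructor
  · intro hw
    by_cases hwv : w = v
    · exact Or.inl hwv
    · obtain ⟨a, ha, ha'⟩ := exists_adj_toward hT (Ne.symm hwv)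
      refine Or.inr ⟨a, ⟨ha, ?_⟩, by rw [mem_branch]; omega⟩
      rintro rfl
      rw [mem_branch] at hw
      omega
  · rintro (rfl | ⟨a, ⟨ha, hau⟩, hw⟩)
    · exact mem_branch_right h
    · rw [mem_branch_iff hT ha] at hw
      rw [mem_branch_iff hT h]
      exact dist_eq_add_one_of_ne hT ha h.symm hau hw

theorem disjoint_branch (hT : T.IsTree) (ha : T.Adj v a) (hb : T.Adj v b) (hab : a ≠ b) :
    Disjoint (branch T v a) (branch T v b) := by
  rw [Finset.disjoint_left]
  intro w hwa hwb
  rw [mem_branch_iff hT ha] at hwa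
  rw [mem_branch_iff hT hb] at hwb
  exact hab (eq_of_adj_toward hT ha hb hwa hwb)

theorem branch_subset (hT : T.IsTree) (h : T.Adj u v) (ha : T.Adj v a) (hau : a ≠ u) :
    branch T v a ⊆ branch T u v := fun _ hw =>
  (mem_branch_iff_eq_or hT h).2 (Or.inr ⟨a, ⟨ha, hau⟩, hw⟩)

/-- The neighbours of `v` other than `u`. -/
noncomputable def kidSet (X : SimpleGraph V) (u v : V) : Finset V :=
  {w | X.Adj v w ∧ w ≠ u}

@[simp] theorem mem_kidSet {X : SimpleGraph V} : w ∈ kidSet X u v ↔ X.Adj v w ∧ w ≠ u := by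
  simp [kidSet]

theorem branch_eq (hT : T.IsTree) (h : T.Adj u v) :
    branch T u v = insert v ((kidSet T u v).biUnion (branch T v)) := by
  ext w
  rw [mem_branch_iff_eq_or hT h]
  simp

theorem branch_erase_eq (hT : T.IsTree) (h : T.Adj u v) :
    (branch T u v).erase v = (kidSet T u v).biUnion (branch T v) := by
  rw [branch_eq hT h, Finset.erase_insert]
  simp only [mem_biUnion, not_exists, not_and]
  exact fun _ _ => left_notMem_branch

theorem pairwiseDisjoint_branch (hT : T.IsTree) :
    ((kidSet T u v : Finset V) : Set V).PairwiseDisjoint (branch T v) := by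
  intro a ha b hb hab
  simp only [mem_coe, mem_kidSet] at ha hb
  exact disjoint_branch hT ha.1 hb.1 hab

theorem card_branch (hT : T.IsTree) (h : T.Adj u v) :
    (branch T u v).card = 1 + ∑ a ∈ kidSet T u v, (branch T v a).card := by
  rw [← Finset.card_biUnion, ← branch_erase_eq hT h, add_comm,
    Finset.card_erase_add_one (mem_branch_right h)]
  exact fun a ha b hb => pairwiseDisjoint_branch hT ha hb

theorem card_branch_lt (hT : T.IsTree) (h : T.Adj u v) (ha : T.Adj v a) (hau : a ≠ u) :
    (branch T v a).card < (branch T u v).card := by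
  refine Finset.card_lt_card ⟨branch_subset hT h ha hau, fun hs => ?_⟩
  exact left_notMem_branch (hs (mem_branch_right h))

theorem card_branch_add (hT : T.IsTree) (h : T.Adj u v) :
    (branch T u v).card + (branch T v u).card = Fintype.card V := by
  have : branch T v u = (branch T u v)ᶜ := by
    ext w; rw [Finset.mem_compl, notMem_branch_iff hT h]
  rw [this, Finset.card_add_card_compl]

theorem one_le_card_branch (h : T.Adj u v) : 1 ≤ (branch T u v).card :=
  Finset.card_pos.2 ⟨v, mem_branch_right h⟩

theorem eq_of_adj_of_notMem_branch (hT : T.IsTree) (h : T.Adj u v) (hw : w ∈ branch T u v)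
    (hwy : T.Adj w y) (hy : y ∉ branch T u v) : w = v ∧ y = u := by
  suffices hwv : w = v by
    subst hwv
    refine ⟨rfl, by_contra fun hyu => hy ?_⟩
    exact branch_subset hT h hwy hyu (mem_branch_right hwy)
  by_contra hwv
  rw [notMem_branch_iff hT h, mem_branch_iff hT h.symm] at hy
  rw [mem_branch_iff hT h] at hw
  obtain ⟨a, hwa, hav⟩ := exists_adj_toward hT hwv
  have hau : T.dist a u ≤ T.dist a v + 1 :=
    (hT.connected.dist_triangle (v := v)).trans_eq (by rw [dist_eq_one_iff_adj.2 h.symm])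
  have hdu := dist_eq_add_one_or hT u hwy
  have hdv := dist_eq_add_one_or hT v hwy
  have hdau := dist_eq_add_one_or hT u hwa
  simp only [SimpleGraph.dist_comm (v := u), SimpleGraph.dist_comm (v := v)] at *
  obtain rfl : y = a := eq_of_adj_toward hT (w := u) hwy hwa
    (by rw [SimpleGraph.dist_comm, SimpleGraph.dist_comm (u := y)]; omega)
    (by rw [SimpleGraph.dist_comm, SimpleGraph.dist_comm (u := a)]; omega)
  omega

end Branch

section Leaf

variable {V : Type*} {T : SimpleGraph V} {u v w a b x y p : V}

/-- `x` is a leaf attached to `p`. -/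
def IsLeafAt (T : SimpleGraph V) (p x : V) : Prop := ∀ y, T.Adj x y ↔ y = p

/-- `v` has at least two neighbours. -/
def IsInner (T : SimpleGraph V) (v : V) : Prop := ∃ a b, a ≠ b ∧ T.Adj v a ∧ T.Adj v b

/-- `x` is a leaf attached to a vertex with at most one neighbour that is not a leaf. -/
def IsDeepLeaf (T : SimpleGraph V) (x : V) : Prop :=
  ∃ p, IsLeafAt T p x ∧ ∀ a b, T.Adj p a → T.Adj p b → IsInner T a → IsInner T b → a = b

theorem IsLeafAt.adj (h : IsLeafAt T p x) : T.Adj x p := (h p).2 rfl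

theorem IsLeafAt.not_isInner (h : IsLeafAt T p x) : ¬ IsInner T x := by
  rintro ⟨a, b, hab, ha, hb⟩
  exact hab (((h a).1 ha).trans ((h b).1 hb).symm)

theorem isLeafAt_of_not_isInner (h : T.Adj x p) (hx : ¬ IsInner T x) : IsLeafAt T p x := by
  intro y
  refine ⟨fun hy => ?_, fun hy => hy ▸ h⟩
  by_contra hne
  exact hx ⟨y, p, hne, hy, h⟩

theorem IsLeafAt.eq (h : IsLeafAt T p x) (h' : IsLeafAt T a x) : a = p := (h a).1 h'.adj

theorem IsDeepLeaf.not_isInner (h : IsDeepLeaf T x) : ¬ IsInner T x := by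
  obtain ⟨p, hp, -⟩ := h
  exact hp.not_isInner

end Leaf

section Code

variable {V : Type*} [Fintype V] {T X Y : SimpleGraph V} {u v w a b x y p : V}

/-- The code of the branch at `v` away from `u`, cut off at depth `k`; the cut-off makes the
recursion well-founded in every graph. -/
noncomputable def codeAux (X : SimpleGraph V) : ℕ → V → V → TreeCode
  | 0, _, _ => pt
  | k + 1, u, v => node ((kidSet X u v).val.map (codeAux X k v))

/-- The code of the branch of a tree at `v` away from its neighbour `u`. -/
noncomputable def code (X : SimpleGraph V) (u v : V) : TreeCode :=
  codeAux X (Fintype.card V) u v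

theorem codeAux_succ_eq (hT : T.IsTree) (hX : X ≤ T) (k : ℕ) :
    ∀ {u v : V}, T.Adj u v → (branch T u v).card ≤ k →
      codeAux X (k + 1) u v = codeAux X k u v := by
  induction k with
  | zero =>
    intro u v h hk
    have := one_le_card_branch h
    omega
  | succ k ih =>
    intro u v h hk
    rw [codeAux, codeAux]
    congr 1
    refine Multiset.map_congr rfl fun a ha => ?_
    rw [Finset.mem_val, mem_kidSet] at ha
    refine ih (hX ha.1) ?_
    have := card_branch_lt hT h (hX ha.1) ha.2
    omega

theorem code_eq (hT : T.IsTree) (hX : X ≤ T) (h : T.Adj u v) :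
    code X u v = node ((kidSet X u v).val.map (code X v)) := by
  rw [code, ← codeAux_succ_eq hT hX _ h (Finset.card_le_univ _), codeAux]
  rfl

theorem size_code (hT : T.IsTree) (h : T.Adj u v) :
    size (code T u v) = (branch T u v).card := by
  induction hn : (branch T u v).card using Nat.strong_induction_on generalizing u v with
  | _ n ih =>
    subst hn
    rw [code_eq hT le_rfl h, size_node, Multiset.map_map, card_branch hT h]
    congr 1
    refine Finset.sum_congr rfl fun a ha => ?_
    rw [mem_kidSet] at ha
    exact ih _ (card_branch_lt hT h ha.1 ha.2) ha.1 rfl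

theorem code_eq_pt_iff (hT : T.IsTree) (h : T.Adj u v) : code T u v = pt ↔ ¬ IsInner T v := by
  rw [code_eq hT le_rfl h, pt, EmbeddingLike.apply_eq_iff_eq, Multiset.map_eq_zero,
    Finset.val_eq_zero, Finset.eq_empty_iff_forall_notMem]
  constructor
  · rintro hk ⟨a, b, hab, ha, hb⟩
    simp only [mem_kidSet, not_and, not_not] at hk
    exact hab ((hk a ha).trans (hk b hb).symm)
  · intro hv a ha
    rw [mem_kidSet] at ha
    exact hv ⟨a, u, ha.2, ha.1, h.symm⟩

theorem code_deleteIncidenceSet_of_notMem (hT : T.IsTree) (h : T.Adj u v)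
    (hx : x ∉ branch T u v) : code (T.deleteIncidenceSet x) u v = code T u v := by
  induction hn : (branch T u v).card using Nat.strong_induction_on generalizing u v with
  | _ n ih =>
    subst hn
    have hvx : v ≠ x := fun e => hx (e ▸ mem_branch_right h)
    have hk : kidSet (T.deleteIncidenceSet x) u v = kidSet T u v := by
      ext a
      simp only [mem_kidSet, deleteIncidenceSet_adj, and_congr_left_iff]
      intro hau
      refine ⟨fun ha => ha.1, fun ha => ⟨ha, hvx, ?_⟩⟩
      rintro rfl
      exact hx (branch_subset hT h ha hau (mem_branch_right ha))
    rw [code_eq hT (deleteIncidenceSet_le _ _) h, code_eq hT le_rfl h, hk]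
    congr 1
    refine Multiset.map_congr rfl fun a ha => ?_
    rw [Finset.mem_val, mem_kidSet] at ha
    exact ih _ (card_branch_lt hT h ha.1 ha.2) ha.1
      (fun hxa => hx (branch_subset hT h ha.1 ha.2 hxa)) rfl

/-- The label of a leaf `x`, which tells whether its neighbour has degree at most two; seen from a
root elsewhere in the tree, this says that `x` is an only child, as in `leafDeck`. -/
noncomputable def leafLabel (T : SimpleGraph V) (x : V) : Bool :=
  decide (∃ p q, IsLeafAt T p x ∧ ∀ y, T.Adj p y → y = x ∨ y = q)

/-- The set of deep leaves. -/
noncomputable def deepSet (T : SimpleGraph V) : Finset V := {x | IsDeepLeaf T x}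

@[simp] theorem mem_deepSet : x ∈ deepSet T ↔ IsDeepLeaf T x := by simp [deepSet]

theorem branch_eq_singleton (hT : T.IsTree) (h : T.Adj u v) (hv : ¬ IsInner T v) :
    branch T u v = {v} := by
  rw [branch_eq hT h]
  have : kidSet T u v = ∅ := by
    ext a
    simp only [mem_kidSet, Finset.notMem_empty, iff_false, not_and, not_not]
    intro ha
    by_contra hau
    exact hv ⟨a, u, hau, ha, h.symm⟩
  simp [this]

theorem code_deleteIncidenceSet_eq_cons (hT : T.IsTree) (h : T.Adj u v) (ha : T.Adj v a)
    (hau : a ≠ u) (hx : x ∈ (branch T v a).erase a) :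
    code (T.deleteIncidenceSet x) u v = node (code (T.deleteIncidenceSet x) v a ::ₘ
      ((kidSet T u v).val.map (code T v)).erase (code T v a)) := by
  rw [Finset.mem_erase] at hx
  have hvx : v ≠ x := by
    rintro rfl
    exact left_notMem_branch hx.2
  have hk : kidSet (T.deleteIncidenceSet x) u v = kidSet T u v := by
    ext b
    simp only [mem_kidSet, deleteIncidenceSet_adj, and_congr_left_iff]
    intro _
    refine ⟨fun hb => hb.1, fun hb => ⟨hb, hvx, ?_⟩⟩
    rintro rfl
    exact Finset.disjoint_left.1 (disjoint_branch hT ha hb hx.1.symm) hx.2 (mem_branch_right hb)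
  have hak : a ∈ (kidSet T u v).val := by rw [Finset.mem_val, mem_kidSet]; exact ⟨ha, hau⟩
  rw [code_eq hT (deleteIncidenceSet_le _ _) h, hk, ← Multiset.map_erase_of_mem _ _ hak]
  congr 1
  conv_lhs => rw [← Multiset.cons_erase hak, Multiset.map_cons]
  congr 1
  refine Multiset.map_congr rfl fun b hb => ?_
  rw [(kidSet T u v).nodup.mem_erase_iff, Finset.mem_val, mem_kidSet] at hb
  exact code_deleteIncidenceSet_of_notMem hT hb.2.1
    (Finset.disjoint_left.1 (disjoint_branch hT ha hb.2.1 hb.1.symm) hx.2)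

theorem leafLabel_eq (h : T.Adj u v) (hx : IsLeafAt T v x) (hxu : x ≠ u) :
    leafLabel T x = decide ((kidSet T u v).card = 1) := by
  rw [leafLabel, decide_eq_decide, Finset.card_eq_one]
  have hxk : x ∈ kidSet T u v := by rw [mem_kidSet]; exact ⟨hx.adj.symm, hxu⟩
  constructor
  · rintro ⟨p, q, hp, hq⟩
    obtain rfl := hx.eq hp
    refine ⟨x, Finset.ext fun y => ?_⟩
    rw [Finset.mem_singleton]
    refine ⟨fun hy => ?_, fun hy => hy ▸ hxk⟩
    rw [mem_kidSet] at hy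
    have hu := (hq u h.symm).resolve_left (Ne.symm hxu)
    exact (hq y hy.1).resolve_right (hu ▸ hy.2)
  · rintro ⟨y, hy⟩
    rw [hy, Finset.mem_singleton] at hxk
    subst hxk
    refine ⟨v, u, hx, fun z hz => ?_⟩
    by_contra hcon
    push Not at hcon
    have : z ∈ kidSet T u v := by rw [mem_kidSet]; exact ⟨hz, hcon.2⟩
    rw [hy, Finset.mem_singleton] at this
    exact hcon.1 this

theorem filter_isDeepLeaf_branch_of_forall (hT : T.IsTree) (h : T.Adj u v)
    (hv : ∀ a ∈ kidSet T u v, ¬ IsInner T a) :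
    {x ∈ (branch T u v).erase v | IsDeepLeaf T x} = kidSet T u v := by
  have eq_left : ∀ b, T.Adj v b → IsInner T b → b = u := fun b hb hbi => by
    by_contra hbu
    exact hv b (mem_kidSet.2 ⟨hb, hbu⟩) hbi
  rw [branch_erase_eq hT h]
  ext x
  rw [mem_filter, mem_biUnion]
  constructor
  · rintro ⟨⟨a, ha, hx⟩, -⟩
    rw [branch_eq_singleton hT (mem_kidSet.1 ha).1 (hv a ha), mem_singleton] at hx
    exact hx ▸ ha
  · intro hx
    have hvx := (mem_kidSet.1 hx).1
    refine ⟨⟨x, hx, mem_branch_right hvx⟩, v, isLeafAt_of_not_isInner hvx.symm (hv x hx), ?_⟩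
    intro a b ha hb hai hbi
    rw [eq_left a ha hai, eq_left b hb hbi]

theorem filter_isDeepLeaf_branch_of_exists (hT : T.IsTree) (h : T.Adj u v) (hu : IsInner T u)
    (ha : a ∈ kidSet T u v) (hai : IsInner T a) :
    {x ∈ (branch T u v).erase v | IsDeepLeaf T x} =
      (kidSet T u v).biUnion fun a => {x ∈ (branch T v a).erase a | IsDeepLeaf T x} := by
  have not_isDeepLeaf : ∀ b ∈ kidSet T u v, ¬ IsDeepLeaf T b := by
    rintro b hb ⟨p, hp, hp'⟩
    obtain rfl := (hp v).1 (mem_kidSet.1 hb).1.symm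
    exact (mem_kidSet.1 ha).2 (hp' a u (mem_kidSet.1 ha).1 h.symm hai hu)
  rw [branch_erase_eq hT h, Finset.filter_biUnion]
  refine Finset.biUnion_congr rfl fun b hb => ?_
  ext x
  simp only [mem_filter, mem_erase]
  refine ⟨fun hx => ⟨⟨?_, hx.1⟩, hx.2⟩, fun hx => ⟨hx.1.2, hx.2⟩⟩
  rintro rfl
  exact not_isDeepLeaf x hb hx.2

theorem code_deleteIncidenceSet_kid (hT : T.IsTree) (h : T.Adj u v) (ha : a ∈ kidSet T u v) :
    code (T.deleteIncidenceSet a) u v =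
      node (((kidSet T u v).val.map (code T v)).erase (code T v a)) := by
  have haK := mem_kidSet.1 ha
  have hk : kidSet (T.deleteIncidenceSet a) u v = (kidSet T u v).erase a := by
    ext b
    rw [mem_erase, mem_kidSet, mem_kidSet, deleteIncidenceSet_adj]
    have := haK.1.ne
    tauto
  rw [code_eq hT (deleteIncidenceSet_le _ _) h, hk,
    ← Multiset.map_erase_of_mem _ _ (Finset.mem_def.1 ha), ← Finset.erase_val]
  congr 1
  refine Multiset.map_congr rfl fun b hb => ?_
  rw [Finset.mem_val, mem_erase, mem_kidSet] at hb
  exact code_deleteIncidenceSet_of_notMem hT hb.2.1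
    (Finset.disjoint_left.1 (disjoint_branch hT haK.1 hb.2.1 hb.1.symm) (mem_branch_right haK.1))

theorem map_deepLeaf_branch (hT : T.IsTree) (h : T.Adj u v) (hu : IsInner T u) :
    ({x ∈ (branch T u v).erase v | IsDeepLeaf T x} : Finset V).val.map
      (fun x => (code (T.deleteIncidenceSet x) u v, leafLabel T x)) = leafDeck (code T u v) := by
  induction hn : (branch T u v).card using Nat.strong_induction_on generalizing u v with
  | _ n ih =>
    subst hn
    rw [code_eq hT le_rfl h]
    have hforall : (∀ c ∈ (kidSet T u v).val.map (code T v), c = pt) ↔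
        ∀ a ∈ kidSet T u v, ¬ IsInner T a := by
      rw [Multiset.forall_mem_map_iff]
      exact forall₂_congr fun a ha => code_eq_pt_iff hT (mem_kidSet.1 ha).1
    by_cases hkids : ∀ a ∈ kidSet T u v, ¬ IsInner T a
    · rw [filter_isDeepLeaf_branch_of_forall hT h hkids, leafDeck_node_of_forall (hforall.2 hkids),
        Multiset.map_map]
      refine Multiset.map_congr rfl fun a ha => ?_
      have hva := mem_kidSet.1 ha
      rw [code_deleteIncidenceSet_kid hT h ha, Function.comp_apply, Multiset.card_map,
        Finset.card_val, leafLabel_eq h (isLeafAt_of_not_isInner hva.1.symm (hkids a ha)) hva.2]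
    · rw [leafDeck_node_of_not_forall (mt hforall.1 hkids)]
      push Not at hkids
      obtain ⟨a₀, ha₀, ha₀i⟩ := hkids
      have hdisj : ((kidSet T u v : Finset V) : Set V).PairwiseDisjoint
          fun a => {x ∈ (branch T v a).erase a | IsDeepLeaf T x} := fun a ha b hb hab =>
        (pairwiseDisjoint_branch hT ha hb hab).mono
          ((Finset.filter_subset _ _).trans (Finset.erase_subset _ _))
          ((Finset.filter_subset _ _).trans (Finset.erase_subset _ _))
      rw [filter_isDeepLeaf_branch_of_exists hT h hu ha₀ ha₀i, ← disjiUnion_eq_biUnion _ _ hdisj,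
        disjiUnion_val, branchDeck, Multiset.map_bind, Multiset.map_bind, Multiset.bind_map]
      refine Multiset.bind_congr fun a ha => ?_
      have hva := mem_kidSet.1 ha
      rw [← ih _ (card_branch_lt hT h hva.1 hva.2) hva.1 ⟨a, u, hva.2, hva.1, h.symm⟩ rfl]
      simp only [Multiset.map_map]
      refine Multiset.map_congr rfl fun x hx => ?_
      rw [code_deleteIncidenceSet_eq_cons hT h hva.1 hva.2 (mem_filter.1 hx).1]
      rfl

end Code

section Geodesic

variable {V : Type*} {T : SimpleGraph V} {u v w a b x y : V}

theorem exists_crossing {P : ℕ → Prop} {m : ℕ} (h0 : P 0) (hm : ¬ P m) :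
    ∃ i < m, P i ∧ ¬ P (i + 1) := by
  by_contra hcon
  push Not at hcon
  have : ∀ i ≤ m, P i := by
    intro i
    induction i with
    | zero => exact fun _ => h0
    | succ i ih => exact fun hi => hcon i (by omega) (ih (by omega))
  exact hm (this m le_rfl)

theorem exists_geodesic (hT : T.IsTree) (p q : V) :
    ∃ z : ℕ → V, z 0 = p ∧ z (T.dist p q) = q ∧ (∀ i < T.dist p q, T.Adj (z i) (z (i + 1))) ∧
      ∀ i ≤ T.dist p q, T.dist p (z i) = i ∧ T.dist (z i) q + i = T.dist p q := by
  obtain ⟨W, hW⟩ := hT.connected.exists_walk_length_eq_dist p q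
  refine ⟨W.getVert, W.getVert_zero, hW ▸ W.getVert_length, fun i hi =>
    W.adj_getVert_succ (hW ▸ hi), fun i hi => ?_⟩
  have htake := dist_le (W.take i)
  have hdrop := dist_le (W.drop i)
  rw [Walk.take_length] at htake
  rw [Walk.drop_length] at hdrop
  have := hT.connected.dist_triangle (u := p) (v := W.getVert i) (w := q)
  omega

variable [Fintype V]

theorem dist_across (hT : T.IsTree) (h : T.Adj a b) (hw : w ∈ branch T a b)
    (hy : y ∉ branch T a b) : T.dist w y = T.dist w b + 1 + T.dist a y := by
  obtain ⟨z, h0, hm, hadj, hd⟩ := exists_geodesic hT w y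
  obtain ⟨i, hi, hin, hout⟩ := exists_crossing (P := fun i => z i ∈ branch T a b)
    (m := T.dist w y) (by rwa [h0]) (by rwa [hm])
  obtain ⟨hb, ha⟩ := eq_of_adj_of_notMem_branch hT h hin (hadj i hi) hout
  have hdb := hd i hi.le
  have hda := hd (i + 1) hi
  rw [hb] at hdb
  rw [ha] at hda
  omega

theorem branch_subset_of_mem (hT : T.IsTree) (h : T.Adj a b)
    (hu : u ∉ branch T a b) (hv : v ∉ branch T a b) (hx : x ∈ branch T a b)
    (hxu : x ∈ branch T u v) : branch T a b ⊆ branch T u v := by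
  intro w hw
  rw [mem_branch] at *
  rw [SimpleGraph.dist_comm (u := v), SimpleGraph.dist_comm (u := u)] at hxu ⊢
  rw [← mem_branch] at hw hx hu hv
  rw [dist_across hT h hw hu, dist_across hT h hw hv]
  rw [dist_across hT h hx hu, dist_across hT h hx hv] at hxu
  omega

end Geodesic

section Counting

variable {V : Type*} [Fintype V] {T : SimpleGraph V} {u v x p : V}

/-- The darts of a graph, as pairs of adjacent vertices. -/
noncomputable def dartSet (X : SimpleGraph V) : Finset (V × V) := {d | X.Adj d.1 d.2}

@[simp] theorem mem_dartSet {X : SimpleGraph V} {d : V × V} : d ∈ dartSet X ↔ X.Adj d.1 d.2 := by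
  simp [dartSet]

/-- The number of darts whose branch has the code `c`. -/
noncomputable def codeCount (X : SimpleGraph V) (c : TreeCode) : ℕ :=
  #{d ∈ dartSet X | code X d.1 d.2 = c}

/-- The deep leaves with a given label. -/
noncomputable def deepLabelSet (T : SimpleGraph V) (τ : Bool) : Finset V :=
  {x ∈ deepSet T | leafLabel T x = τ}

theorem mem_deepLabelSet {τ : Bool} :
    x ∈ deepLabelSet T τ ↔ IsDeepLeaf T x ∧ leafLabel T x = τ := by
  simp [deepLabelSet]

theorem size_code_deleteIncidenceSet (hT : T.IsTree) (h : T.Adj u v) (hx : ¬ IsInner T x)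
    (hxb : x ∈ (branch T u v).erase v) :
    size (code (T.deleteIncidenceSet x) u v) + 1 = size (code T u v) := by
  induction hn : (branch T u v).card using Nat.strong_induction_on generalizing u v with
  | _ n ih =>
    subst hn
    rw [branch_erase_eq hT h, mem_biUnion] at hxb
    obtain ⟨a, ha, hxa⟩ := hxb
    have hva := mem_kidSet.1 ha
    have hmem := Multiset.mem_map_of_mem (code T v) (Finset.mem_def.1 ha)
    rw [code_eq hT le_rfl h, size_node_eq_add_erase hmem]
    by_cases hax : x = a
    · subst hax
      rw [code_deleteIncidenceSet_kid hT h ha, (code_eq_pt_iff hT hva.1).2 hx, size_pt, add_comm]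
    · have hxa' : x ∈ (branch T v a).erase a := mem_erase.2 ⟨hax, hxa⟩
      rw [code_deleteIncidenceSet_eq_cons hT h hva.1 hva.2 hxa', size_node, Multiset.map_cons,
        Multiset.sum_cons, ← ih _ (card_branch_lt hT h hva.1 hva.2) hva.1 hxa' rfl, size_node]
      omega

theorem isInner_of_size_code (hT : T.IsTree) (h : T.Adj u v)
    (hc : size (code T u v) + 2 ≤ Fintype.card V) : IsInner T u := by
  by_contra hu
  have hadd := card_branch_add hT h
  rw [branch_eq_singleton hT h.symm hu, card_singleton, ← size_code hT h] at hadd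
  omega

theorem isInner_of_code_ne_pt (hT : T.IsTree) (h : T.Adj u v) (hc : code T u v ≠ pt) :
    IsInner T v :=
  not_not.1 (mt (code_eq_pt_iff hT h).2 hc)

theorem card_deletions_of_size_eq (hT : T.IsTree) (h : T.Adj u v) (τ : Bool) {c : TreeCode}
    (hc : size (code T u v) = size c + 1) (hV : size c + 3 ≤ Fintype.card V) :
    #{x ∈ deepLabelSet T τ | (T.deleteIncidenceSet x).Adj u v ∧
      code (T.deleteIncidenceSet x) u v = c} = (leafDeck (code T u v)).count (c, τ) := by
  have hu : IsInner T u := isInner_of_size_code hT h (by omega)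
  have hne : code T u v ≠ c := fun e => by simp [e] at hc
  rw [← map_deepLeaf_branch hT h hu, Multiset.count_map, ← Finset.filter_val, Finset.card_val]
  congr 1
  ext x
  simp only [mem_filter, mem_deepLabelSet, mem_erase, Prod.mk.injEq, deleteIncidenceSet_adj]
  constructor
  · rintro ⟨⟨hd, hl⟩, ⟨-, _, hxv⟩, hxc⟩
    refine ⟨⟨⟨hxv.symm, ?_⟩, hd⟩, hxc.symm, hl.symm⟩
    by_contra hxb
    exact hne (code_deleteIncidenceSet_of_notMem hT h hxb ▸ hxc)
  · rintro ⟨⟨⟨hxv, -⟩, hd⟩, hxc, hl⟩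
    refine ⟨⟨hd, hl.symm⟩, ⟨h, ?_, hxv.symm⟩, hxc.symm⟩
    rintro rfl
    exact hd.not_isInner hu

theorem code_eq_of_deletion (hT : T.IsTree) (h : T.Adj u v) (hx : ¬ IsInner T x) {c : TreeCode}
    (hc : size (code T u v) ≠ size c + 1) (hadj : (T.deleteIncidenceSet x).Adj u v)
    (hxc : code (T.deleteIncidenceSet x) u v = c) : code T u v = c ∧ x ∉ branch T u v := by
  have hxb : x ∉ branch T u v := fun hxb => by
    rw [deleteIncidenceSet_adj] at hadj
    refine hc ?_
    rw [← size_code_deleteIncidenceSet hT h hx (mem_erase.2 ⟨hadj.2.2.symm, hxb⟩), hxc]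
  exact ⟨code_deleteIncidenceSet_of_notMem hT h hxb ▸ hxc, hxb⟩

theorem card_deletions_of_code_eq (hT : T.IsTree) (h : T.Adj u v) (τ : Bool)
    (hV : size (code T u v) + 2 ≤ Fintype.card V) :
    #{x ∈ deepLabelSet T τ | (T.deleteIncidenceSet x).Adj u v ∧
        code (T.deleteIncidenceSet x) u v = code T u v} +
      #{x ∈ deepLabelSet T τ | x ∈ branch T u v} = #(deepLabelSet T τ) := by
  rw [add_comm, ← Finset.card_filter_add_card_filter_not (s := deepLabelSet T τ)
    (fun x => x ∈ branch T u v)]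
  congr 2
  refine Finset.filter_congr fun x hx => ?_
  have hxd := (mem_deepLabelSet.1 hx).1.not_isInner
  refine ⟨fun hxc => (code_eq_of_deletion hT h hxd (by omega) hxc.1 hxc.2).2, fun hxb => ⟨?_, ?_⟩⟩
  · rw [deleteIncidenceSet_adj]
    refine ⟨h, ?_, ?_⟩
    · rintro rfl
      exact hxd (isInner_of_size_code hT h hV)
    · rintro rfl
      exact hxb (mem_branch_right h)
  · exact code_deleteIncidenceSet_of_notMem hT h hxb

theorem card_deletions (hT : T.IsTree) (h : T.Adj u v) (τ : Bool) {c : TreeCode}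
    (hV : size c + 3 ≤ Fintype.card V) :
    #{x ∈ deepLabelSet T τ | (T.deleteIncidenceSet x).Adj u v ∧
        code (T.deleteIncidenceSet x) u v = c} +
      (if code T u v = c then #{x ∈ deepLabelSet T τ | x ∈ branch T u v} else 0) =
    (if code T u v = c then #(deepLabelSet T τ) else 0) +
      if size (code T u v) = size c + 1 then (leafDeck (code T u v)).count (c, τ) else 0 := by
  by_cases hc : code T u v = c
  · subst hc
    rw [if_pos rfl, if_pos rfl, if_neg (by omega), add_zero]
    exact card_deletions_of_code_eq hT h τ (by omega)
  rw [if_neg hc, if_neg hc, add_zero, zero_add]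
  split_ifs with hs
  · exact card_deletions_of_size_eq hT h τ hs hV
  · rw [Finset.card_eq_zero, Finset.filter_eq_empty_iff]
    intro x hx hxc
    have hxd := (mem_deepLabelSet.1 hx).1.not_isInner
    exact hc (code_eq_of_deletion hT h hxd hs hxc.1 hxc.2).1

theorem IsLeafAt.branch_eq (hT : T.IsTree) (h : IsLeafAt T p x) : branch T p x = {x} :=
  branch_eq_singleton hT h.adj.symm h.not_isInner

theorem sum_card_deep_branch_pt (hT : T.IsTree) (τ : Bool) :
    ∑ d ∈ dartSet T with code T d.1 d.2 = pt, #{x ∈ deepLabelSet T τ | x ∈ branch T d.1 d.2} =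
      #(deepLabelSet T τ) := by
  have hswap := sum_card_bipartiteAbove_eq_sum_card_bipartiteBelow
    (s := {d ∈ dartSet T | code T d.1 d.2 = pt}) (t := deepLabelSet T τ)
    (fun d x => x ∈ branch T d.1 d.2)
  simp only [bipartiteAbove] at hswap
  rw [hswap, Finset.card_eq_sum_ones]
  refine Finset.sum_congr rfl fun x hx => ?_
  obtain ⟨p, hp, -⟩ := (mem_deepLabelSet.1 hx).1
  refine Finset.card_eq_one.2 ⟨(p, x), ?_⟩
  ext ⟨a, b⟩
  simp only [mem_bipartiteBelow, mem_filter, mem_dartSet, mem_singleton, Prod.mk.injEq]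
  constructor
  · rintro ⟨⟨h, hc⟩, hx⟩
    rw [branch_eq_singleton hT h ((code_eq_pt_iff hT h).1 hc), mem_singleton] at hx
    subst hx
    exact ⟨(hp a).1 h.symm, rfl⟩
  · rintro ⟨rfl, rfl⟩
    have h := hp.adj.symm
    exact ⟨⟨h, (code_eq_pt_iff hT h).2 hp.not_isInner⟩, mem_branch_right h⟩

theorem card_deep_branch (hT : T.IsTree) (h : T.Adj u v) (hu : IsInner T u) (hv : IsInner T v)
    (τ : Bool) :
    #{x ∈ deepLabelSet T τ | x ∈ branch T u v} =
      ((leafDeck (code T u v)).filter fun p => p.2 = τ).card := by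
  rw [← map_deepLeaf_branch hT h hu, Multiset.filter_map, Multiset.card_map, ← Finset.filter_val,
    Finset.card_val]
  congr 1
  ext x
  simp only [mem_filter, mem_deepLabelSet, mem_erase, Function.comp_apply]
  have hxv : IsDeepLeaf T x → x ≠ v := by
    rintro hd rfl
    exact hd.not_isInner hv
  tauto

theorem sum_card_deep_branch (hT : T.IsTree) (τ : Bool) {c : TreeCode}
    (hc : size c + 2 ≤ Fintype.card V) :
    ∑ d ∈ dartSet T with code T d.1 d.2 = c, #{x ∈ deepLabelSet T τ | x ∈ branch T d.1 d.2} =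
      if c = pt then #(deepLabelSet T τ)
      else codeCount T c * ((leafDeck c).filter fun p => p.2 = τ).card := by
  split_ifs with hcp
  · subst hcp
    exact sum_card_deep_branch_pt hT τ
  rw [codeCount, ← smul_eq_mul]
  refine Finset.sum_eq_card_nsmul fun d hd => ?_
  rw [mem_filter, mem_dartSet] at hd
  obtain ⟨h, rfl⟩ := hd
  exact card_deep_branch hT h (isInner_of_size_code hT h hc) (isInner_of_code_ne_pt hT h hcp) τ

/-- Double counting of the pairs of a deep leaf and a dart whose branch has the code `c` once the
leaf is deleted. -/
theorem sum_codeCount_deleteIncidenceSet (hT : T.IsTree) (τ : Bool) {c : TreeCode}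
    (hV : size c + 3 ≤ Fintype.card V) :
    ∑ x ∈ deepLabelSet T τ, codeCount (T.deleteIncidenceSet x) c +
      (if c = pt then #(deepLabelSet T τ)
        else codeCount T c * ((leafDeck c).filter fun p => p.2 = τ).card) =
    codeCount T c * #(deepLabelSet T τ) + ∑ d ∈ dartSet T,
      if size (code T d.1 d.2) = size c + 1 then (leafDeck (code T d.1 d.2)).count (c, τ)
      else 0 := by
  have hcount : ∀ x, codeCount (T.deleteIncidenceSet x) c =
      #{d ∈ dartSet T | (T.deleteIncidenceSet x).Adj d.1 d.2 ∧
        code (T.deleteIncidenceSet x) d.1 d.2 = c} := fun x => by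
    rw [codeCount]
    congr 1
    ext d
    simp only [mem_filter, mem_dartSet, deleteIncidenceSet_adj]
    tauto
  have hswap := sum_card_bipartiteAbove_eq_sum_card_bipartiteBelow (s := deepLabelSet T τ)
    (t := dartSet T) (r := fun x d => (T.deleteIncidenceSet x).Adj d.1 d.2 ∧
      code (T.deleteIncidenceSet x) d.1 d.2 = c)
  simp only [bipartiteAbove, bipartiteBelow] at hswap
  rw [Finset.sum_congr rfl fun x _ => hcount x, hswap, ← sum_card_deep_branch hT τ (by omega),
    codeCount, ← smul_eq_mul, ← Finset.sum_const, Finset.sum_filter, Finset.sum_filter,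
    ← Finset.sum_add_distrib, ← Finset.sum_add_distrib]
  exact Finset.sum_congr rfl fun d hd => card_deletions hT (mem_dartSet.1 hd) τ hV

end Counting

/-! ### Moving a leaf along a path -/

section LeafMove

variable {V : Type*} {T S : SimpleGraph V} {u v w a b x p : V} {m : ℕ} {z : ℕ → V}

theorem IsLeafAt.dist_eq (hT : T.IsTree) (h : IsLeafAt T p x) (hw : w ≠ x) :
    T.dist x w = T.dist p w + 1 := by
  obtain ⟨a, ha, hdist⟩ := exists_adj_toward hT hw.symm
  obtain rfl := (h a).1 ha
  exact hdist

/-- `S` is obtained from the tree `T` by moving the leaf `x` from the vertex `z 0` to the vertex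
`z m`, where `z 0, …, z m` is a path. The values `z i` with `m < i` are irrelevant. -/
structure LeafMove (T S : SimpleGraph V) (x : V) (m : ℕ) (z : ℕ → V) : Prop where
  isTree_left : T.IsTree
  isTree_right : S.IsTree
  isLeafAt_left : IsLeafAt T (z 0) x
  isLeafAt_right : IsLeafAt S (z m) x
  adj_iff : ∀ a b, a ≠ x → b ≠ x → (T.Adj a b ↔ S.Adj a b)
  ne : ∀ i ≤ m, z i ≠ x
  adj : ∀ i < m, T.Adj (z i) (z (i + 1))
  dist : ∀ i ≤ m, T.dist (z 0) (z i) = i ∧ T.dist (z i) (z m) + i = m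

theorem dist_le_dist_of_adj_iff (hT : T.IsTree) (hS : S.IsTree) (h : IsLeafAt T p x)
    (hadj : ∀ a b, a ≠ x → b ≠ x → (T.Adj a b ↔ S.Adj a b)) (ha : a ≠ x) (hb : b ≠ x) :
    S.dist a b ≤ T.dist a b := by
  induction hn : T.dist a b generalizing a with
  | zero => rw [hT.connected.dist_eq_zero_iff.1 hn, dist_self]
  | succ n ih =>
    have hab : a ≠ b := by
      rintro rfl
      simp at hn
    obtain ⟨c, hac, hcb⟩ := exists_adj_toward hT hab
    have hcx : c ≠ x := by
      rintro rfl
      have := h.dist_eq hT hb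
      rw [(h a).1 hac.symm] at hcb
      omega
    have hc := ih hcx (by omega)
    have htri := hS.connected.dist_triangle (u := a) (v := c) (w := b)
    rw [dist_eq_one_iff_adj.2 ((hadj a c ha hcx).1 hac)] at htri
    omega

namespace LeafMove

variable (h : LeafMove T S x m z)
include h

theorem dist_eq (ha : a ≠ x) (hb : b ≠ x) : T.dist a b = S.dist a b :=
  le_antisymm
    (dist_le_dist_of_adj_iff h.isTree_right h.isTree_left h.isLeafAt_right
      (fun a b ha hb => (h.adj_iff a b ha hb).symm) ha hb)
    (dist_le_dist_of_adj_iff h.isTree_left h.isTree_right h.isLeafAt_left h.adj_iff ha hb)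

theorem symm : LeafMove S T x m fun i => z (m - i) where
  isTree_left := h.isTree_right
  isTree_right := h.isTree_left
  isLeafAt_left := h.isLeafAt_right
  isLeafAt_right := by simpa using h.isLeafAt_left
  adj_iff a b ha hb := (h.adj_iff a b ha hb).symm
  ne i _ := h.ne _ (by omega)
  adj i hi := by
    have hadj := h.adj (m - (i + 1)) (by omega)
    rw [show m - (i + 1) + 1 = m - i by omega] at hadj
    exact ((h.adj_iff _ _ (h.ne _ (by omega)) (h.ne _ (by omega))).1 hadj).symm
  dist i hi := by
    have hi := h.dist (m - i) (by omega)
    have h0 := h.dist 0 (by omega)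
    simp only [Nat.sub_zero, Nat.sub_self]
    rw [← h.dist_eq (h.ne _ le_rfl) (h.ne _ (by omega)),
      ← h.dist_eq (h.ne _ (by omega)) (h.ne _ (by omega)), SimpleGraph.dist_comm,
      SimpleGraph.dist_comm (v := z 0)]
    omega

theorem deleteIncidenceSet_eq : T.deleteIncidenceSet x = S.deleteIncidenceSet x := by
  ext a b
  rw [deleteIncidenceSet_adj, deleteIncidenceSet_adj]
  have := h.adj_iff a b
  tauto

theorem ne_of_lt {i j : ℕ} (hij : i < j) (hj : j ≤ m) : z i ≠ z j := by
  intro he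
  have hi := (h.dist i (by omega)).1
  have hj := (h.dist j hj).1
  rw [he] at hi
  omega

theorem adj_right {i : ℕ} (hi : i < m) : S.Adj (z i) (z (i + 1)) :=
  (h.adj_iff _ _ (h.ne _ hi.le) (h.ne _ hi)).1 (h.adj i hi)

end LeafMove

variable [Fintype V]

theorem IsLeafAt.mem_branch_iff (hT : T.IsTree) (h : IsLeafAt T p x) (hu : u ≠ x) (hv : v ≠ x) :
    x ∈ branch T u v ↔ p ∈ branch T u v := by
  rw [mem_branch, mem_branch, SimpleGraph.dist_comm (v := x), SimpleGraph.dist_comm (v := x),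
    h.dist_eq hT hu, h.dist_eq hT hv, SimpleGraph.dist_comm (u := p),
    SimpleGraph.dist_comm (u := p)]
  omega

namespace LeafMove

variable (h : LeafMove T S x m z)
include h

theorem mem_branch_iff (hu : u ≠ x) (hv : v ≠ x) (hw : w ≠ x) :
    w ∈ branch T u v ↔ w ∈ branch S u v := by
  rw [mem_branch, mem_branch, h.dist_eq hu hw, h.dist_eq hv hw]

theorem code_eq_of_notMem (hadj : T.Adj u v) (hu : u ≠ x) (hv : v ≠ x)
    (h0 : z 0 ∉ branch T u v) (hm : z m ∉ branch T u v) : code T u v = code S u v := by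
  rw [← code_deleteIncidenceSet_of_notMem h.isTree_left hadj, h.deleteIncidenceSet_eq,
    code_deleteIncidenceSet_of_notMem h.isTree_right ((h.adj_iff u v hu hv).1 hadj)]
  · rwa [h.isLeafAt_right.mem_branch_iff h.isTree_right hu hv,
      ← mem_branch_iff h hu hv (h.ne _ le_rfl)]
  · rwa [h.isLeafAt_left.mem_branch_iff h.isTree_left hu hv]

theorem branch_eq_insert (hu : u ≠ x) (hv : v ≠ x) (h0 : z 0 ∈ branch T u v)
    (hm : z m ∉ branch T u v) : branch T u v = insert x (branch S u v) ∧ x ∉ branch S u v := by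
  constructor
  · ext w
    rw [mem_insert]
    by_cases hw : w = x
    · subst hw
      simp [h.isLeafAt_left.mem_branch_iff h.isTree_left hu hv, h0]
    · simp [hw, mem_branch_iff h hu hv hw]
  · rwa [h.isLeafAt_right.mem_branch_iff h.isTree_right hu hv,
      ← mem_branch_iff h hu hv (h.ne _ le_rfl)]

theorem zero_mem_branch {i : ℕ} (hi : i < m) : z 0 ∈ branch T (z (i + 1)) (z i) := by
  have hi' := (h.dist i hi.le).1
  have hsucc := (h.dist (i + 1) hi).1
  rw [mem_branch, SimpleGraph.dist_comm, SimpleGraph.dist_comm (u := z (i + 1))]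
  omega

theorem last_notMem_branch {i : ℕ} (hi : i < m) : z m ∉ branch T (z (i + 1)) (z i) := by
  have hi' := (h.dist i hi.le).2
  have hsucc := (h.dist (i + 1) hi).2
  rw [mem_branch]
  omega

theorem exists_eq_of_mem_branch (hadj : T.Adj u v) (h0 : z 0 ∈ branch T u v)
    (hm : z m ∉ branch T u v) : ∃ i < m, v = z i ∧ u = z (i + 1) := by
  obtain ⟨i, hi, hin, hout⟩ := exists_crossing (P := fun i => z i ∈ branch T u v) h0 hm
  obtain ⟨hv, hu⟩ := eq_of_adj_of_notMem_branch h.isTree_left hadj hin (h.adj i hi) hout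
  exact ⟨i, hi, hv.symm, hu.symm⟩

theorem card_branch_eq {i : ℕ} (hi : i < m) :
    (branch T (z (i + 1)) (z i)).card = (branch S (z (i + 1)) (z i)).card + 1 := by
  obtain ⟨hinsert, hx⟩ := h.branch_eq_insert (h.ne _ hi) (h.ne _ hi.le) (h.zero_mem_branch hi)
    (h.last_notMem_branch hi)
  rw [hinsert, card_insert_of_notMem hx]

theorem size_code_eq {i : ℕ} (hi : i < m) :
    size (code T (z (i + 1)) (z i)) = size (code S (z (i + 1)) (z i)) + 1 := by
  rw [size_code h.isTree_left (h.adj i hi).symm, size_code h.isTree_right (h.adj_right hi).symm,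
    h.card_branch_eq hi]

theorem size_code_lt {i j : ℕ} (hij : i < j) (hj : j < m) :
    size (code S (z (i + 1)) (z i)) < size (code S (z (j + 1)) (z j)) := by
  induction j with
  | zero => omega
  | succ j ih =>
    have hstep : size (code S (z (j + 1)) (z j)) <
        size (code S (z (j + 1 + 1)) (z (j + 1))) := by
      rw [size_code h.isTree_right (h.adj_right (by omega)).symm,
        size_code h.isTree_right (h.adj_right (by omega)).symm]
      exact card_branch_lt h.isTree_right (h.adj_right hj).symm (h.adj_right (by omega)).symm
        (h.ne_of_lt (by omega) (by omega))
    rcases Nat.lt_succ_iff_lt_or_eq.1 hij with hlt | rfl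
    · exact (ih hlt (by omega)).trans hstep
    · exact hstep

theorem card_branch_add_two_le {i : ℕ} (hi : i < m) :
    (branch S (z (i + 1)) (z i)).card + 2 ≤ Fintype.card V := by
  have hcard := h.card_branch_eq hi
  have hadd := card_branch_add h.isTree_left (h.adj i hi).symm
  have hpos := one_le_card_branch (h.adj i hi)
  omega

theorem kidSet_eq (hadj : T.Adj u v) (hv : v ≠ x) (h0 : z 0 ≠ v) (hm : z m ∉ branch T u v) :
    kidSet T u v = kidSet S u v := by
  ext b
  rw [mem_kidSet, mem_kidSet, and_congr_left_iff]
  intro _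
  by_cases hbx : b = x
  · subst hbx
    refine iff_of_false (fun hb => h0 ((h.isLeafAt_left v).1 hb.symm).symm) fun hb => hm ?_
    rw [← (h.isLeafAt_right v).1 hb.symm]
    exact mem_branch_right hadj
  · exact h.adj_iff v b hv hbx

theorem code_cons (hadj : T.Adj u v) (hu : u ≠ x) (hv : v ≠ x) (ha : T.Adj v a) (hau : a ≠ u)
    (h0 : z 0 ∈ branch T v a) (hm : z m ∉ branch T u v) :
    code T u v = node (code T v a ::ₘ (kids (code S u v)).erase (code S v a)) := by
  have h0v : z 0 ≠ v := fun e => left_notMem_branch (e ▸ h0)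
  have hk := h.kidSet_eq hadj hv h0v hm
  have hak : a ∈ (kidSet S u v).val := by
    rw [← Finset.mem_def, ← hk, mem_kidSet]
    exact ⟨ha, hau⟩
  rw [code_eq h.isTree_left le_rfl hadj,
    code_eq h.isTree_right le_rfl ((h.adj_iff u v hu hv).1 hadj), kids_node,
    ← Multiset.map_erase_of_mem _ _ hak, hk]
  congr 1
  conv_lhs => rw [← Multiset.cons_erase hak, Multiset.map_cons]
  congr 1
  refine Multiset.map_congr rfl fun b hb => ?_
  rw [(kidSet S u v).nodup.mem_erase_iff, Finset.mem_val, ← hk, mem_kidSet] at hb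
  have hd := Finset.disjoint_left.1 (disjoint_branch h.isTree_left ha hb.2.1 hb.1.symm) h0
  refine h.code_eq_of_notMem hb.2.1 hv ?_ hd fun hmb => hm ?_
  · rintro rfl
    exact h0v ((h.isLeafAt_left v).1 hb.2.1.symm).symm
  · exact branch_subset h.isTree_left hadj hb.2.1 hb.2.2 hmb

theorem code_cons_zero (hadj : T.Adj u (z 0)) (hu : u ≠ x) (hm : z m ∉ branch T u (z 0)) :
    code T u (z 0) = node (pt ::ₘ kids (code S u (z 0))) := by
  have h0x := h.ne 0 (Nat.zero_le _)
  have hx := h.isLeafAt_left.adj.symm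
  have hxS : x ∉ kidSet S u (z 0) := by
    rw [mem_kidSet]
    rintro ⟨hb, -⟩
    have := (h.isLeafAt_right _).1 hb.symm
    exact hm (this ▸ mem_branch_right hadj)
  have hk : kidSet T u (z 0) = insert x (kidSet S u (z 0)) := by
    ext b
    rw [mem_insert, mem_kidSet, mem_kidSet]
    by_cases hbx : b = x
    · subst hbx
      simp [hx, hu.symm]
    · simp [hbx, h.adj_iff _ b h0x hbx]
  rw [code_eq h.isTree_left le_rfl hadj,
    code_eq h.isTree_right le_rfl ((h.adj_iff _ _ hu h0x).1 hadj), kids_node, hk,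
    Finset.insert_val_of_notMem hxS, Multiset.map_cons,
    (code_eq_pt_iff h.isTree_left hx).2 h.isLeafAt_left.not_isInner]
  congr 2
  refine Multiset.map_congr rfl fun b hb => ?_
  rw [Finset.mem_val] at hb
  have hbx : b ≠ x := fun e => hxS (e ▸ hb)
  rw [mem_kidSet] at hb
  have hbT := (h.adj_iff _ _ h0x hbx).2 hb.1
  refine h.code_eq_of_notMem hbT h0x hbx left_notMem_branch fun hmb => hm ?_
  exact branch_subset h.isTree_left hadj hbT hb.2 hmb

/-- The branches `S (z (i + 1)) (z i)` for `i ≤ j` determine `T (z (j + 1)) (z j)`, which differs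
from the last of them by the leaf `x`; the same recursion runs from the other end. -/
theorem left_code_eq_right_code {j : ℕ} (hj : j < m)
    (hP : ∀ i ≤ j, code S (z (i + 1)) (z i) = code T (z (m - (i + 1))) (z (m - i))) :
    code T (z (j + 1)) (z j) = code S (z (m - (j + 1))) (z (m - j)) := by
  have h' := h.symm
  induction j with
  | zero =>
    rw [h.code_cons_zero (h.adj 0 hj).symm (h.ne _ hj) (h.last_notMem_branch hj), hP 0 le_rfl]
    exact (h'.code_cons_zero (h'.adj 0 hj).symm (h'.ne _ hj) (h'.last_notMem_branch hj)).symm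
  | succ j ih =>
    have hcons {T S : SimpleGraph V} {z : ℕ → V} (h : LeafMove T S x m z) :=
      h.code_cons (h.adj _ hj).symm (h.ne _ hj) (h.ne _ hj.le)
        (h.adj j (by omega)).symm (h.ne_of_lt (by omega) (by omega))
        (h.zero_mem_branch (by omega)) (h.last_notMem_branch hj)
    rw [hcons h, hP _ le_rfl, hP j (by omega), ih (by omega) fun i hi => hP i (by omega)]
    exact (hcons h').symm

theorem branch_subset_or (hadj : T.Adj u v) (h0 : z 0 ∈ branch T u v) (hm : z m ∈ branch T u v)
    {i : ℕ} (hi : i < m) :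
    branch T (z (i + 1)) (z i) ⊆ branch T u v ∨ branch T (z i) (z (i + 1)) ⊆ branch T u v := by
  have hT := h.isTree_left
  have he := h.adj i hi
  have hz0 := h.zero_mem_branch hi
  have hzm := h.last_notMem_branch hi
  have hcross := fun a b hab ha hb =>
    eq_of_adj_of_notMem_branch (w := a) (y := b) hT he.symm ha hab hb
  by_cases hu : u ∈ branch T (z (i + 1)) (z i) <;> by_cases hv : v ∈ branch T (z (i + 1)) (z i)
  · refine Or.inr (branch_subset_of_mem hT he ?_ ?_ ((notMem_branch_iff hT he.symm).1 hzm) hm)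
    · rwa [notMem_branch_iff hT he]
    · rwa [notMem_branch_iff hT he]
  · obtain ⟨rfl, rfl⟩ := hcross u v hadj hu hv
    rw [← notMem_branch_iff hT he.symm] at h0
    exact absurd hz0 h0
  · obtain ⟨rfl, rfl⟩ := hcross v u hadj.symm hv hu
    exact absurd hm hzm
  · exact Or.inl (branch_subset_of_mem hT he.symm hu hv hz0 h0)

theorem min_size_code_lt_of_mem_branch {j : ℕ} (hj : 2 * j + 1 ≤ m) (hadj : T.Adj u v)
    (hu : u ≠ x) (hv : v ≠ x) (h0 : z 0 ∈ branch T u v) (hm : z m ∈ branch T u v) :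
    min (size (code S (z (j + 1)) (z j))) (size (code T (z (m - (j + 1))) (z (m - j)))) <
      (branch T u v).card := by
  have hT := h.isTree_left
  have hjm : j < m := by omega
  have he := h.adj j hjm
  rcases h.branch_subset_or hadj h0 hm hjm with hsub | hsub
  · have hcard := h.card_branch_eq hjm
    rw [← size_code h.isTree_right (h.adj_right hjm).symm] at hcard
    have := Finset.card_le_card hsub
    omega
  · have hxn : x ∉ branch T (z j) (z (j + 1)) := by
      rw [notMem_branch_iff hT he,
        h.isLeafAt_left.mem_branch_iff hT (h.ne _ hjm) (h.ne _ hjm.le)]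
      exact h.zero_mem_branch hjm
    have hlt : (branch T (z j) (z (j + 1))).card < (branch T u v).card :=
      Finset.card_lt_card
        ⟨hsub, fun hs => hxn (hs ((h.isLeafAt_left.mem_branch_iff hT hu hv).2 h0))⟩
    rw [← size_code hT he] at hlt
    refine min_lt_of_right_lt (lt_of_le_of_lt ?_ hlt)
    rcases Nat.lt_or_ge j (m - (j + 1)) with hlt | hge
    · have hsize := h.symm.size_code_lt hlt (by omega)
      rw [show m - (m - (j + 1) + 1) = j by omega, show m - (m - (j + 1)) = j + 1 by omega]
        at hsize
      exact hsize.le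
    · rw [show m - (j + 1) = j by omega, show m - j = j + 1 by omega]

end LeafMove

end LeafMove

section Compare

variable {V : Type*} [Fintype V] {T S : SimpleGraph V} {x p : V} {m : ℕ} {z : ℕ → V}
  {F : TreeCode → ℕ}

/-- The sum of a statistic `F` of rooted trees over all branches of `X`. -/
noncomputable def dartSum (X : SimpleGraph V) (F : TreeCode → ℕ) : ℕ :=
  ∑ d ∈ dartSet X, F (code X d.1 d.2)

theorem dartSum_indicator (X : SimpleGraph V) (c : TreeCode) :
    dartSum X (fun e => if e = c then 1 else 0) = codeCount X c :=
  (card_filter _ _).symm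

theorem IsLeafAt.dartSet_eq_insert (h : IsLeafAt T p x) :
    dartSet T = insert (p, x) (insert (x, p) (dartSet (T.deleteIncidenceSet x))) := by
  ext ⟨a, b⟩
  simp only [mem_insert, mem_dartSet, Prod.mk.injEq, deleteIncidenceSet_adj]
  constructor
  · intro hab
    by_cases ha : a = x
    · subst ha
      exact Or.inr (Or.inl ⟨rfl, (h b).1 hab⟩)
    · by_cases hb : b = x
      · subst hb
        exact Or.inl ⟨(h a).1 hab.symm, rfl⟩
      · exact Or.inr (Or.inr ⟨hab, ha, hb⟩)
  · rintro (⟨rfl, rfl⟩ | ⟨rfl, rfl⟩ | ⟨hab, -⟩)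
    · exact h.adj.symm
    · exact h.adj
    · exact hab

theorem dartSum_eq_of_isLeafAt (hT : T.IsTree) (h : IsLeafAt T p x)
    (hF : F (code T x p) = 0) :
    dartSum T F = (∑ d ∈ dartSet (T.deleteIncidenceSet x), F (code T d.1 d.2)) + F pt := by
  have hpx := h.adj.ne
  rw [dartSum, h.dartSet_eq_insert, sum_insert, sum_insert, hF,
    (code_eq_pt_iff hT h.adj.symm).2 h.not_isInner]
  · ring
  · simp [deleteIncidenceSet_adj]
  · simp [deleteIncidenceSet_adj, hpx.symm]

theorem IsLeafAt.size_code_add_one (hT : T.IsTree) (h : IsLeafAt T p x) :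
    size (code T x p) + 1 = Fintype.card V := by
  rw [size_code hT h.adj, ← card_branch_add hT h.adj, h.branch_eq hT, card_singleton]

namespace LeafMove

variable (h : LeafMove T S x m z)
include h

theorem sum_darts_across (f : V × V → ℕ) :
    ∑ d ∈ dartSet (T.deleteIncidenceSet x) with
        z 0 ∈ branch T d.1 d.2 ∧ z m ∉ branch T d.1 d.2, f d =
      ∑ i ∈ range m, f (z (i + 1), z i) := by
  refine (sum_bij (fun i _ => (z (i + 1), z i)) ?_ ?_ ?_ fun _ _ => rfl).symm
  · intro i hi
    rw [mem_range] at hi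
    rw [mem_filter, mem_dartSet, deleteIncidenceSet_adj]
    exact ⟨⟨(h.adj i hi).symm, h.ne _ hi, h.ne _ hi.le⟩, h.zero_mem_branch hi,
      h.last_notMem_branch hi⟩
  · intro i hi j hj hij
    rw [mem_range] at hi hj
    rw [Prod.mk.injEq] at hij
    by_contra hne
    rcases lt_or_gt_of_ne hne with hlt | hlt
    · exact h.ne_of_lt hlt hj.le hij.2
    · exact h.ne_of_lt hlt hi.le hij.2.symm
  · rintro ⟨u, v⟩ hd
    rw [mem_filter, mem_dartSet, deleteIncidenceSet_adj] at hd
    obtain ⟨i, hi, rfl, rfl⟩ := h.exists_eq_of_mem_branch hd.1.1 hd.2.1 hd.2.2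
    exact ⟨i, mem_range.2 hi, rfl⟩

theorem sum_dartSet_deleteIncidenceSet (f : V × V → ℕ) :
    ∑ d ∈ dartSet (T.deleteIncidenceSet x), f d =
      (∑ i ∈ range m, (f (z (i + 1), z i) + f (z (m - (i + 1)), z (m - i)))) +
        ∑ d ∈ dartSet (T.deleteIncidenceSet x) with
          (z 0 ∈ branch T d.1 d.2 ↔ z m ∈ branch T d.1 d.2), f d := by
  have hback := h.symm.sum_darts_across f
  rw [← h.deleteIncidenceSet_eq] at hback
  simp only [Nat.sub_zero, Nat.sub_self] at hback
  rw [sum_add_distrib, ← h.sum_darts_across f, ← hback, sum_filter, sum_filter, sum_filter,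
    ← sum_add_distrib, ← sum_add_distrib]
  refine sum_congr rfl fun d hd => ?_
  rw [mem_dartSet, deleteIncidenceSet_adj] at hd
  simp only [← mem_branch_iff h hd.2.1 hd.2.2 (h.ne 0 (Nat.zero_le _)),
    ← mem_branch_iff h hd.2.1 hd.2.2 (h.ne m le_rfl)]
  by_cases h0 : z 0 ∈ branch T d.1 d.2 <;> by_cases hm : z m ∈ branch T d.1 d.2 <;>
    simp [h0, hm]

/-- The darts that do not cross the path see either none of the leaf's two positions, so that
their codes agree, or both of them, so that their branches are too large for `F`. -/
theorem sum_darts_not_across {j : ℕ} (hj : 2 * j + 1 ≤ m)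
    (hF : ∀ c, min (size (code S (z (j + 1)) (z j)))
      (size (code T (z (m - (j + 1))) (z (m - j)))) < size c → F c = 0) :
    ∑ d ∈ dartSet (T.deleteIncidenceSet x) with
        (z 0 ∈ branch T d.1 d.2 ↔ z m ∈ branch T d.1 d.2), F (code T d.1 d.2) =
      ∑ d ∈ dartSet (T.deleteIncidenceSet x) with
        (z 0 ∈ branch T d.1 d.2 ↔ z m ∈ branch T d.1 d.2), F (code S d.1 d.2) := by
  have h' := h.symm
  refine sum_congr rfl fun d hd => ?_
  rw [mem_filter, mem_dartSet, deleteIncidenceSet_adj] at hd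
  obtain ⟨⟨hadj, hd1, hd2⟩, hiff⟩ := hd
  by_cases h0 : z 0 ∈ branch T d.1 d.2
  · have hm := hiff.1 h0
    have hadjS := (h.adj_iff _ _ hd1 hd2).1 hadj
    have hlargeT := h.min_size_code_lt_of_mem_branch hj hadj hd1 hd2 h0 hm
    have hlargeS := h'.min_size_code_lt_of_mem_branch hj hadjS hd1 hd2
      (by simpa using (mem_branch_iff h hd1 hd2 (h.ne m le_rfl)).1 hm)
      (by simpa using (mem_branch_iff h hd1 hd2 (h.ne 0 (Nat.zero_le _))).1 h0)
    rw [show m - (m - (j + 1)) = j + 1 by omega, show m - (m - j) = j by omega, min_comm]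
      at hlargeS
    rw [hF _ (by rwa [size_code h.isTree_left hadj]),
      hF _ (by rwa [size_code h.isTree_right hadjS])]
  · rw [h.code_eq_of_notMem hadj hd1 hd2 h0 fun hm => h0 (hiff.2 hm)]

theorem add_apply_code_eq {i j : ℕ} (hij : i ≠ j) (hi : i < m)
    (hP : ∀ k < j, code S (z (k + 1)) (z k) = code T (z (m - (k + 1))) (z (m - k)))
    (hF : ∀ c, min (size (code S (z (j + 1)) (z j)))
      (size (code T (z (m - (j + 1))) (z (m - j)))) < size c → F c = 0) :
    F (code T (z (i + 1)) (z i)) + F (code T (z (m - (i + 1))) (z (m - i))) =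
      F (code S (z (i + 1)) (z i)) + F (code S (z (m - (i + 1))) (z (m - i))) := by
  rcases lt_or_gt_of_ne hij with hlt | hlt
  · rw [h.left_code_eq_right_code hi fun k hk => hP k (by omega), hP i hlt, add_comm]
  · have hltS := h.size_code_lt hlt hi
    have hltT := h.symm.size_code_lt hlt hi
    have heqS := h.size_code_eq hi
    have heqT := h.symm.size_code_eq hi
    rw [hF _ (by omega), hF _ (by omega), hF _ (by omega), hF _ (by omega)]

theorem dartSum_add_eq {j : ℕ} (hj : 2 * j + 1 ≤ m)
    (hP : ∀ i < j, code S (z (i + 1)) (z i) = code T (z (m - (i + 1))) (z (m - i)))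
    (hF : ∀ c, min (size (code S (z (j + 1)) (z j)))
      (size (code T (z (m - (j + 1))) (z (m - j)))) < size c → F c = 0) :
    dartSum T F + F (code S (z (j + 1)) (z j)) =
      dartSum S F + F (code T (z (m - (j + 1))) (z (m - j))) := by
  have hjm : j < m := by omega
  have hsmall := h.card_branch_add_two_le hjm
  rw [← size_code h.isTree_right (h.adj_right hjm).symm] at hsmall
  have hsizeT := h.isLeafAt_left.size_code_add_one h.isTree_left
  have hsizeS := h.isLeafAt_right.size_code_add_one h.isTree_right
  have heqS := h.size_code_eq hjm
  have heqT := h.symm.size_code_eq hjm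
  rw [dartSum_eq_of_isLeafAt h.isTree_left h.isLeafAt_left (hF _ (by omega)),
    dartSum_eq_of_isLeafAt h.isTree_right h.isLeafAt_right (hF _ (by omega)),
    ← h.deleteIncidenceSet_eq, h.sum_dartSet_deleteIncidenceSet fun d => F (code T d.1 d.2),
    h.sum_dartSet_deleteIncidenceSet fun d => F (code S d.1 d.2), h.sum_darts_not_across hj hF,
    ← add_sum_erase _ _ (mem_range.2 hjm), ← add_sum_erase (range m) (fun i =>
      F (code S (z (i + 1)) (z i)) + F (code S (z (m - (i + 1))) (z (m - i)))) (mem_range.2 hjm),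
    sum_congr rfl fun i hi => h.add_apply_code_eq (ne_of_mem_erase hi)
      (mem_range.1 (mem_of_mem_erase hi)) hP hF,
    hF (code T (z (j + 1)) (z j)) (by omega),
    hF (code S (z (m - (j + 1))) (z (m - j))) (by omega)]
  ring

end LeafMove

end Compare

section Propagate

variable {V : Type*} [Fintype V] {T S : SimpleGraph V} {x : V} {m : ℕ} {z : ℕ → V}

theorem eq_of_leafDeck_min_size_eq {P Q : TreeCode} (hs : 1 < min (size P) (size Q))
    (h : (if size P = min (size P) (size Q) then leafDeck P else 0) =
      if size Q = min (size P) (size Q) then leafDeck Q else 0) : P = Q := by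
  have hne {c : TreeCode} (hc : min (size P) (size Q) ≤ size c) : leafDeck c ≠ 0 :=
    leafDeck_ne_zero fun hpt => by rw [hpt, size_pt] at hc; omega
  rcases lt_trichotomy (size P) (size Q) with hlt | heq | hlt
  · rw [min_eq_left hlt.le, if_pos rfl, if_neg hlt.ne'] at h
    exact absurd h (hne (min_le_left _ _))
  · rw [heq, min_self, if_pos rfl, if_pos rfl] at h
    exact eq_of_leafDeck_eq heq h
  · rw [min_eq_right hlt.le, if_pos rfl, if_neg hlt.ne'] at h
    exact absurd h.symm (hne (min_le_right _ _))

/-- Two trees on the same vertices whose deep leaves, sorted by label, have deletions with the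
same numbers of branches of each code. -/
structure SameDeletions (T S : SimpleGraph V) : Prop where
  card_eq : ∀ τ, #(deepLabelSet T τ) = #(deepLabelSet S τ)
  sum_codeCount_eq : ∀ τ c, ∑ y ∈ deepLabelSet T τ, codeCount (T.deleteIncidenceSet y) c =
    ∑ y ∈ deepLabelSet S τ, codeCount (S.deleteIncidenceSet y) c
  codeCount_pt_eq : codeCount T pt = codeCount S pt

theorem SameDeletions.dartSum_count_eq (hD : SameDeletions T S) (hT : T.IsTree) (hS : S.IsTree)
    {c : TreeCode} (hV : size c + 3 ≤ Fintype.card V) (hc : codeCount T c = codeCount S c)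
    (τ : Bool) :
    dartSum T (fun e => if size e = size c + 1 then (leafDeck e).count (c, τ) else 0) =
      dartSum S (fun e => if size e = size c + 1 then (leafDeck e).count (c, τ) else 0) := by
  have hsumT := sum_codeCount_deleteIncidenceSet hT τ hV
  have hsumS := sum_codeCount_deleteIncidenceSet hS τ hV
  rw [hD.sum_codeCount_eq, hD.card_eq, hc] at hsumT
  rw [dartSum, dartSum]
  omega

namespace LeafMove

variable (h : LeafMove T S x m z)
include h

theorem codeCount_add_eq {j : ℕ} (hj : 2 * j + 1 ≤ m)
    (hP : ∀ i < j, code S (z (i + 1)) (z i) = code T (z (m - (i + 1))) (z (m - i)))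
    {c : TreeCode} (hc : size c ≤ min (size (code S (z (j + 1)) (z j)))
      (size (code T (z (m - (j + 1))) (z (m - j))))) :
    codeCount T c + (if code S (z (j + 1)) (z j) = c then 1 else 0) =
      codeCount S c + if code T (z (m - (j + 1))) (z (m - j)) = c then 1 else 0 := by
  rw [← dartSum_indicator, ← dartSum_indicator]
  refine h.dartSum_add_eq (F := fun e => if e = c then 1 else 0) hj hP fun e he => if_neg ?_
  rintro rfl
  omega

/-- The conditionals select the smaller of the two branches at the ends of the path, or both of them
in case of a tie; the deck of what they select is read off the numbers of branches of the
deletions. -/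
theorem leafDeck_min_size_eq (hD : SameDeletions T S) {j : ℕ} (hj : 2 * j + 1 ≤ m)
    (hP : ∀ i < j, code S (z (i + 1)) (z i) = code T (z (m - (i + 1))) (z (m - i)))
    {P Q : TreeCode} (hPdef : P = code S (z (j + 1)) (z j))
    (hQdef : Q = code T (z (m - (j + 1))) (z (m - j))) :
    (if size P = min (size P) (size Q) then leafDeck P else 0) =
      if size Q = min (size P) (size Q) then leafDeck Q else 0 := by
  set s := min (size P) (size Q)
  ext ⟨c, τ⟩
  by_cases hc : size c + 1 = s
  · have hsmall := h.card_branch_add_two_le (i := j) (by omega)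
    rw [← size_code h.isTree_right (h.adj_right (by omega)).symm, ← hPdef] at hsmall
    have hcount := h.codeCount_add_eq hj hP (c := c) (by rw [← hPdef, ← hQdef]; omega)
    rw [← hPdef, ← hQdef, if_neg (by rintro rfl; omega), if_neg (by rintro rfl; omega)] at hcount
    have hsum := h.dartSum_add_eq hj hP
      (F := fun e => if size e = size c + 1 then (leafDeck e).count (c, τ) else 0)
      fun e he => if_neg (by rw [← hPdef, ← hQdef] at he; omega)
    rw [hD.dartSum_count_eq h.isTree_left h.isTree_right (by omega) (by simpa using hcount) τ,
      hc, ← hPdef, ← hQdef] at hsum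
    simpa only [apply_ite (Multiset.count (c, τ)), Multiset.count_zero]
      using Nat.add_left_cancel hsum
  · have hzero {e : TreeCode} (he : size e = s) : (leafDeck e).count (c, τ) = 0 :=
      Multiset.count_eq_zero.2 fun hmem => hc ((size_of_mem_leafDeck hmem).trans he)
    rw [apply_ite (Multiset.count (c, τ)), apply_ite (Multiset.count (c, τ)), Multiset.count_zero,
      ite_eq_right_iff.2 hzero, ite_eq_right_iff.2 hzero]

theorem code_eq_code (hD : SameDeletions T S) {j : ℕ} (hj : 2 * j + 1 ≤ m) :
    code S (z (j + 1)) (z j) = code T (z (m - (j + 1))) (z (m - j)) := by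
  induction j using Nat.strong_induction_on with
  | _ j ih =>
    have hP : ∀ i < j, code S (z (i + 1)) (z i) = code T (z (m - (i + 1))) (z (m - i)) :=
      fun i hi => ih i hi (by omega)
    have hpt := h.codeCount_add_eq hj hP (c := pt)
      (by rw [size_pt]; exact le_min (one_le_size _) (one_le_size _))
    have hdeck := h.leafDeck_min_size_eq hD hj hP rfl rfl
    set P := code S (z (j + 1)) (z j)
    set Q := code T (z (m - (j + 1))) (z (m - j))
    rw [hD.codeCount_pt_eq, Nat.add_left_cancel_iff] at hpt
    by_cases hs : 1 < min (size P) (size Q)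
    · exact eq_of_leafDeck_min_size_eq hs hdeck
    · have hPQ : P = pt ↔ Q = pt := by
        by_cases hP : P = pt <;> by_cases hQ : Q = pt <;> simp_all
      have hor : P = pt ∨ Q = pt := by
        have := one_le_size P
        have := one_le_size Q
        rw [← size_eq_one_iff, ← size_eq_one_iff]
        omega
      rw [hor.elim id hPQ.2, hor.elim hPQ.1 id]

end LeafMove

end Propagate

section Embedding

variable {V W : Type*} {T : SimpleGraph V} {S : SimpleGraph W} {u v : V} {u' v' : W}

theorem exists_injOn_of_map_eq {α β γ : Type*} [Nonempty β] {f : α → γ} {g : β → γ}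
    {s : Finset α} {t : Finset β} (h : s.val.map f = t.val.map g) :
    ∃ σ : α → β, (∀ a ∈ s, σ a ∈ t ∧ g (σ a) = f a) ∧ Set.InjOn σ s := by
  induction s using Finset.induction generalizing t with
  | empty => exact ⟨fun _ => Classical.arbitrary β, by simp, by simp⟩
  | insert a s ha ih =>
    rw [insert_val_of_notMem ha, Multiset.map_cons] at h
    obtain ⟨b, hb, hba⟩ := Multiset.mem_map.1 (h ▸ Multiset.mem_cons_self (f a) _)
    rw [← Multiset.cons_erase hb, Multiset.map_cons, hba, Multiset.cons_inj_right,
      ← erase_val] at h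
    obtain ⟨σ, hσ, hσi⟩ := ih h
    have heq : Set.EqOn (Function.update σ a b) σ s := fun c hc =>
      Function.update_of_ne (ne_of_mem_of_not_mem hc ha) _ _
    refine ⟨Function.update σ a b, (forall_mem_insert _ _ _).2 ⟨?_, fun c hc => ?_⟩, ?_⟩
    · rw [Function.update_self]
      exact ⟨hb, hba⟩
    · rw [heq hc]
      exact ⟨mem_of_mem_erase (hσ c hc).1, (hσ c hc).2⟩
    · rw [coe_insert, Set.injOn_insert ha, heq.image_eq, Function.update_self]
      refine ⟨hσi.congr heq.symm, ?_⟩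
      rintro ⟨c, hc, hcb⟩
      exact ne_of_mem_erase (hσ c hc).1 hcb

theorem nonempty_iso_of_injective [Fintype V] [Fintype W] (hT : T.IsTree) (hS : S.IsTree)
    {f : V → W} (hf : Function.Injective f) (hcard : Fintype.card V = Fintype.card W)
    (hadj : ∀ a b, T.Adj a b → S.Adj (f a) (f b)) : Nonempty (T ≃g S) := by
  have hbij : Function.Bijective f := (Fintype.bijective_iff_injective_and_card f).2 ⟨hf, hcard⟩
  have hacyclic : (S.comap f).IsAcyclic :=
    IsAcyclic.comap (⟨f, fun h => h⟩ : S.comap f →g S) hf hS.isAcyclic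
  have hge := (isTree_iff_maximal_isAcyclic.1 hT).2.2 hacyclic hadj
  exact ⟨⟨Equiv.ofBijective f hbij, fun {a b} => ⟨fun h => hge h, fun h => hadj a b h⟩⟩⟩

variable [Fintype V]

theorem exists_eq_on_branches (hT : T.IsTree) (u v : V) (w₀ : W) (F : V → V → W) :
    ∃ f : V → W, f v = w₀ ∧ ∀ a ∈ kidSet T u v, ∀ w ∈ branch T v a, f w = F a w := by
  refine ⟨fun w => if hw : ∃ a ∈ kidSet T u v, w ∈ branch T v a then F hw.choose w else w₀,
    dif_neg ?_, fun a ha w hw => ?_⟩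
  · rintro ⟨a, -, hva⟩
    exact left_notMem_branch hva
  · have hex : ∃ a ∈ kidSet T u v, w ∈ branch T v a := ⟨a, ha, hw⟩
    dsimp only
    rw [dif_pos hex, (pairwiseDisjoint_branch hT).elim_finset hex.choose_spec.1 ha w
      hex.choose_spec.2 hw]

variable [Fintype W] {a b : V}

/-- `f` embeds the rooted tree `branch T u v` into the rooted tree `branch S u' v'`. Nothing is
assumed about the values of `f` outside this branch. -/
structure IsBranchEmbedding (T : SimpleGraph V) (S : SimpleGraph W) (u v : V) (u' v' : W)
    (f : V → W) : Prop where
  map_root : f v = v'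
  injOn : Set.InjOn f (branch T u v)
  map_mem : ∀ w ∈ branch T u v, f w ∈ branch S u' v'
  map_adj : ∀ a ∈ branch T u v, ∀ b ∈ branch T u v, T.Adj a b → S.Adj (f a) (f b)

theorem eq_or_exists_mem_kidSet (hT : T.IsTree) (h : T.Adj u v) {w : V} (hw : w ∈ branch T u v) :
    w = v ∨ ∃ a ∈ kidSet T u v, w ∈ branch T v a := by
  rwa [branch_eq hT h, mem_insert, mem_biUnion] at hw

section Glue

variable {σ f : V → W} (hT : T.IsTree) (hS : S.IsTree) (h : T.Adj u v) (h' : S.Adj u' v')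
  (hσ : ∀ a ∈ kidSet T u v, σ a ∈ kidSet S u' v') (hfv : f v = v')
  (hf : ∀ a ∈ kidSet T u v, IsBranchEmbedding T S v a v' (σ a) f)
include hT hfv hf

include hS hσ in
theorem injOn_branch_of_kidSet (h : T.Adj u v) (hσi : Set.InjOn σ (kidSet T u v)) :
    Set.InjOn f (branch T u v) := by
  have hne {a w : V} (ha : a ∈ kidSet T u v) (hw : w ∈ branch T v a) : f w ≠ v' := fun he =>
    left_notMem_branch (he ▸ (hf a ha).map_mem w hw)
  intro w hw y hy he
  rcases eq_or_exists_mem_kidSet hT h hw with rfl | ⟨a, ha, hwa⟩ <;>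
    rcases eq_or_exists_mem_kidSet hT h hy with rfl | ⟨b, hb, hyb⟩
  · rfl
  · exact absurd (he.symm.trans hfv) (hne hb hyb)
  · exact absurd (he.trans hfv) (hne ha hwa)
  · have hab : σ a = σ b := (pairwiseDisjoint_branch hS).elim_finset (hσ a ha) (hσ b hb) (f w)
      ((hf a ha).map_mem w hwa) (he ▸ (hf b hb).map_mem y hyb)
    obtain rfl := hσi ha hb hab
    exact (hf a ha).injOn hwa hyb he

include hσ in
theorem map_adj_of_kidSet (h : T.Adj u v) (ha : a ∈ branch T u v) (hb : b ∈ branch T u v)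
    (hab : T.Adj a b) : S.Adj (f a) (f b) := by
  have hroot {b : V} (hb : b ∈ branch T u v) (hvb : T.Adj v b) : S.Adj (f v) (f b) := by
    have hbk : b ∈ kidSet T u v :=
      mem_kidSet.2 ⟨hvb, fun hbu => left_notMem_branch (hbu ▸ hb)⟩
    rw [hfv, (hf b hbk).map_root]
    exact (mem_kidSet.1 (hσ b hbk)).1
  rcases eq_or_exists_mem_kidSet hT h ha with rfl | ⟨c, hc, hac⟩
  · exact hroot hb hab
  rcases eq_or_exists_mem_kidSet hT h hb with rfl | ⟨d, hd, hbd⟩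
  · exact (hroot ha hab.symm).symm
  by_cases hbc : b ∈ branch T v c
  · exact (hf c hc).map_adj a hac b hbc hab
  · obtain rfl := (eq_of_adj_of_notMem_branch hT (mem_kidSet.1 hc).1 hac hab hbc).2
    exact absurd hbd left_notMem_branch

include hS h h' hσ in
theorem isBranchEmbedding_of_kidSet (hσi : Set.InjOn σ (kidSet T u v)) :
    IsBranchEmbedding T S u v u' v' f where
  map_root := hfv
  injOn := injOn_branch_of_kidSet hT hS hσ hfv hf h hσi
  map_mem w hw := by
    rcases eq_or_exists_mem_kidSet hT h hw with rfl | ⟨a, ha, hwa⟩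
    · rw [hfv]
      exact mem_branch_right h'
    · obtain ⟨hadj, hne⟩ := mem_kidSet.1 (hσ a ha)
      exact branch_subset hS h' hadj hne ((hf a ha).map_mem w hwa)
  map_adj a ha b hb hab := map_adj_of_kidSet hT hσ hfv hf h ha hb hab

end Glue

theorem IsBranchEmbedding.congr {f g : V → W} (hf : IsBranchEmbedding T S u v u' v' f)
    (h : T.Adj u v) (hfg : ∀ w ∈ branch T u v, g w = f w) :
    IsBranchEmbedding T S u v u' v' g where
  map_root := by rw [hfg v (mem_branch_right h), hf.map_root]
  injOn := hf.injOn.congr fun w hw => (hfg w hw).symm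
  map_mem w hw := hfg w hw ▸ hf.map_mem w hw
  map_adj a ha b hb hab := by
    rw [hfg a ha, hfg b hb]
    exact hf.map_adj a ha b hb hab

theorem exists_isBranchEmbedding (hT : T.IsTree) (hS : S.IsTree) (h : T.Adj u v)
    (h' : S.Adj u' v') (hc : code T u v = code S u' v') :
    ∃ f, IsBranchEmbedding T S u v u' v' f := by
  induction hn : (branch T u v).card using Nat.strong_induction_on generalizing u v u' v' with
  | _ n ih =>
    subst hn
    rw [code_eq hT le_rfl h, code_eq hS le_rfl h', EmbeddingLike.apply_eq_iff_eq] at hc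
    have : Nonempty W := ⟨v'⟩
    obtain ⟨σ, hσ, hσi⟩ := exists_injOn_of_map_eq hc
    have hex : ∀ a : V, ∃ f : V → W, a ∈ kidSet T u v → IsBranchEmbedding T S v a v' (σ a) f := by
      intro a
      by_cases ha : a ∈ kidSet T u v
      · obtain ⟨hva, hau⟩ := mem_kidSet.1 ha
        obtain ⟨f, hf⟩ := ih _ (card_branch_lt hT h hva hau) hva (mem_kidSet.1 (hσ a ha).1).1
          (hσ a ha).2.symm rfl
        exact ⟨f, fun _ => hf⟩
      · exact ⟨fun _ => v', fun ha' => absurd ha' ha⟩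
    choose F hF using hex
    obtain ⟨f, hfv, hf⟩ := exists_eq_on_branches hT u v v' F
    exact ⟨f, isBranchEmbedding_of_kidSet hT hS h h' (fun a ha => (hσ a ha).1) hfv
      (fun a ha => (hF a ha).congr (mem_kidSet.1 ha).1 (hf a ha)) hσi⟩

theorem nonempty_iso_of_isBranchEmbedding (hT : T.IsTree) (hS : S.IsTree) (h : T.Adj u v)
    (h' : S.Adj u' v') (hcard : Fintype.card V = Fintype.card W) {f g : V → W}
    (hf : IsBranchEmbedding T S u v u' v' f) (hg : IsBranchEmbedding T S v u v' u' g) :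
    Nonempty (T ≃g S) := by
  have hmem {w : V} (hw : w ∉ branch T u v) : w ∈ branch T v u := (notMem_branch_iff hT h).1 hw
  have hdisj {a b : V} (ha : a ∈ branch T u v) (hb : b ∉ branch T u v) : f a ≠ g b := fun he =>
    (notMem_branch_iff hS h').2 (hg.map_mem b (hmem hb)) (he ▸ hf.map_mem a ha)
  have hcross {a b : V} (ha : a ∈ branch T u v) (hb : b ∉ branch T u v) (hab : T.Adj a b) :
      S.Adj (f a) (g b) := by
    obtain ⟨rfl, rfl⟩ := eq_of_adj_of_notMem_branch hT h ha hab hb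
    rw [hf.map_root, hg.map_root]
    exact h'.symm
  refine nonempty_iso_of_injective hT hS (f := fun w => if w ∈ branch T u v then f w else g w)
    (fun a b he => ?_) hcard fun a b hab => ?_
  · dsimp only at he
    split_ifs at he with ha hb hb
    · exact hf.injOn ha hb he
    · exact absurd he (hdisj ha hb)
    · exact absurd he.symm (hdisj hb ha)
    · exact hg.injOn (hmem ha) (hmem hb) he
  · split_ifs with ha hb hb
    · exact hf.map_adj a ha b hb hab
    · exact hcross ha hb hab
    · exact (hcross hb ha hab.symm).symm
    · exact hg.map_adj a (hmem ha) b (hmem hb) hab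

theorem nonempty_iso_of_code_eq (hT : T.IsTree) (hS : S.IsTree) (h : T.Adj u v)
    (h' : S.Adj u' v') (hcode : code T u v = code S u' v')
    (hcode' : code T v u = code S v' u') : Nonempty (T ≃g S) := by
  obtain ⟨f, hf⟩ := exists_isBranchEmbedding hT hS h h' hcode
  obtain ⟨g, hg⟩ := exists_isBranchEmbedding hT hS h.symm h'.symm hcode'
  refine nonempty_iso_of_isBranchEmbedding hT hS h h' ?_ hf hg
  rw [← card_branch_add hT h, ← card_branch_add hS h', ← size_code hT h, ← size_code hS h',
    ← size_code hT h.symm, ← size_code hS h'.symm, hcode, hcode']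

end Embedding

namespace LeafMove

variable {V : Type*} {T S : SimpleGraph V} {x : V} {m : ℕ} {z : ℕ → V}

theorem eq_of_zero (h : LeafMove T S x 0 z) : T = S := by
  ext a b
  by_cases ha : a = x
  · rw [ha, h.isLeafAt_left b, h.isLeafAt_right b]
  · by_cases hb : b = x
    · rw [hb, T.adj_comm, S.adj_comm, h.isLeafAt_left a, h.isLeafAt_right a]
    · exact h.adj_iff a b ha hb

theorem adj_middle_iff (h : LeafMove T S x m z) {j : ℕ} (hj : 0 < j) (hjm : j < m) (w : V) :
    T.Adj (z j) w ↔ S.Adj (z j) w := by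
  by_cases hw : w = x
  · subst hw
    refine iff_of_false (fun hadj => ?_) fun hadj => ?_
    · exact h.ne_of_lt hj hjm.le ((h.isLeafAt_left _).1 hadj.symm).symm
    · exact h.ne_of_lt hjm le_rfl ((h.isLeafAt_right _).1 hadj.symm)
  · exact h.adj_iff _ w (h.ne _ hjm.le) hw

variable [Fintype V]

theorem erase_kidSet_eq (h : LeafMove T S x m z) {j : ℕ} (hj : j + 2 ≤ m) :
    (kidSet T (z j) (z (j + 1))).erase (z (j + 2)) =
      (kidSet S (z (j + 2)) (z (j + 1))).erase (z j) := by
  ext w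
  rw [mem_erase, mem_erase, mem_kidSet, mem_kidSet, h.adj_middle_iff j.succ_pos hj]
  tauto

/-- At an inner vertex of the path, only the two branches along the path see the leaf move; here
they are exchanged. -/
theorem code_middle_eq (h : LeafMove T S x m z) {j : ℕ} (hj : j + 2 ≤ m)
    (heq : code S (z (j + 1)) (z j) = code T (z (j + 1)) (z (j + 2))) :
    code T (z j) (z (j + 1)) = code S (z (j + 2)) (z (j + 1)) := by
  have hT := h.isTree_left
  have hadj := h.adj j (by omega)
  have hadj' := h.adj (j + 1) hj
  have hne := h.ne_of_lt (i := j) (j := j + 2) (by omega) hj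
  have hT' : z (j + 2) ∈ kidSet T (z j) (z (j + 1)) := mem_kidSet.2 ⟨hadj', hne.symm⟩
  have hS' : z j ∈ kidSet S (z (j + 2)) (z (j + 1)) :=
    mem_kidSet.2 ⟨(h.adj_right (by omega)).symm, hne⟩
  rw [code_eq hT le_rfl hadj, code_eq h.isTree_right le_rfl (h.adj_right hj).symm,
    ← insert_erase hT', ← insert_erase hS', insert_val_of_notMem (notMem_erase _ _),
    insert_val_of_notMem (notMem_erase _ _), Multiset.map_cons, Multiset.map_cons, heq,
    h.erase_kidSet_eq hj]
  congr 2
  refine Multiset.map_congr rfl fun w hw => ?_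
  rw [← Finset.mem_def, ← h.erase_kidSet_eq hj, mem_erase, mem_kidSet] at hw
  obtain ⟨hw2, hw, hw0⟩ := hw
  have hwx : w ≠ x := by
    rintro rfl
    exact h.ne_of_lt (i := 0) j.succ_pos (by omega) ((h.isLeafAt_left _).1 hw.symm).symm
  refine h.code_eq_of_notMem hw (h.ne _ (by omega)) hwx ?_ ?_
  · exact Finset.disjoint_left.1 (disjoint_branch hT hadj.symm hw hw0.symm)
      (h.zero_mem_branch (by omega))
  · refine Finset.disjoint_left.1 (disjoint_branch hT hadj' hw hw2.symm) ?_
    rw [← notMem_branch_iff hT hadj'.symm]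
    exact h.last_notMem_branch hj

/-- The isomorphism reflects the path, swapping the branches of `S` and of `T` at its ends. -/
theorem nonempty_iso (h : LeafMove T S x m z) (hD : SameDeletions T S) : Nonempty (T ≃g S) := by
  have hleft j (hj : 2 * j + 1 ≤ m) :
      code T (z (j + 1)) (z j) = code S (z (m - (j + 1))) (z (m - j)) :=
    h.left_code_eq_right_code (by omega) fun i hi => h.code_eq_code hD (by omega)
  rcases Nat.even_or_odd' m with ⟨j, rfl | rfl⟩
  · cases j with
    | zero => exact h.eq_of_zero ▸ ⟨RelIso.refl _⟩
    | succ j =>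
      have heq := h.code_eq_code hD (j := j) (by omega)
      have heq' := hleft j (by omega)
      rw [show 2 * (j + 1) - (j + 1) = j + 1 by omega, show 2 * (j + 1) - j = j + 2 by omega]
        at heq heq'
      exact nonempty_iso_of_code_eq h.isTree_left h.isTree_right (h.adj j (by omega)).symm
        (h.adj_right (by omega)) heq' (h.code_middle_eq (by omega) heq)
  · have heq := h.code_eq_code hD (j := j) (by omega)
    have heq' := hleft j (by omega)
    rw [show 2 * j + 1 - (j + 1) = j by omega, show 2 * j + 1 - j = j + 1 by omega] at heq heq'
    exact nonempty_iso_of_code_eq h.isTree_left h.isTree_right (h.adj j (by omega)).symm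
      (h.adj_right (by omega)) heq' heq.symm

end LeafMove

section Transport

variable {V W : Type*} [Fintype V] [Fintype W] {X : SimpleGraph V} {Y : SimpleGraph W}

theorem kidSet_map_iso (e : X ≃g Y) (u v : V) :
    kidSet Y (e u) (e v) = (kidSet X u v).map e.toEquiv.toEmbedding := by
  ext w
  obtain ⟨a, rfl⟩ := e.surjective w
  rw [mem_kidSet, e.map_adj_iff, e.injective.ne_iff, ← mem_kidSet (X := X)]
  exact (mem_map' e.toEquiv.toEmbedding).symm

theorem codeAux_map_iso (e : X ≃g Y) (k : ℕ) (u v : V) :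
    codeAux X k u v = codeAux Y k (e u) (e v) := by
  induction k generalizing u v with
  | zero => rfl
  | succ k ih =>
    rw [codeAux, codeAux, kidSet_map_iso, map_val, Multiset.map_map]
    exact congrArg node (Multiset.map_congr rfl fun a _ => ih v a)

theorem code_map_iso (e : X ≃g Y) (u v : V) : code X u v = code Y (e u) (e v) := by
  rw [code, code, codeAux_map_iso e, Fintype.card_congr e.toEquiv]

theorem codeCount_eq_of_iso (e : X ≃g Y) (c : TreeCode) : codeCount X c = codeCount Y c := by
  refine card_equiv (e.toEquiv.prodCongr e.toEquiv) fun d => ?_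
  simp [code_map_iso e, e.map_adj_iff]

end Transport

/-! ### Matching the leaf deletions of two trees -/

section InducedIso

variable {V W : Type*} {T : SimpleGraph V} {S : SimpleGraph W} {x : V} {y : W}

theorem exists_equiv_of_induce_iso
    (e : T.induce ({x}ᶜ : Set V) ≃g S.induce ({y}ᶜ : Set W)) :
    ∃ ψ : V ≃ W, ψ x = y ∧ ∀ a b, a ≠ x → b ≠ x → (T.Adj a b ↔ S.Adj (ψ a) (ψ b)) := by
  let e' : {a // a ≠ x} ≃ {b // b ≠ y} := e.toEquiv
  let ψ := (Equiv.optionSubtypeNe x).symm.trans (e'.optionCongr.trans (Equiv.optionSubtypeNe y))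
  have hψ : ∀ a (ha : a ≠ x), ψ a = e ⟨a, ha⟩ := fun a ha => by
    rw [Equiv.trans_apply, Equiv.optionSubtypeNe_symm_of_ne ha]
    rfl
  refine ⟨ψ, by simp [ψ], fun a b ha hb => ?_⟩
  rw [hψ a ha, hψ b hb]
  exact (e.map_adj_iff (v := ⟨a, ha⟩) (w := ⟨b, hb⟩)).symm

theorem codeCount_eq_of_induce_iso [Fintype V] [Fintype W]
    (e : T.induce ({x}ᶜ : Set V) ≃g S.induce ({y}ᶜ : Set W)) (c : TreeCode) :
    codeCount (T.deleteIncidenceSet x) c = codeCount (S.deleteIncidenceSet y) c := by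
  obtain ⟨ψ, rfl, h⟩ := exists_equiv_of_induce_iso e
  refine codeCount_eq_of_iso ⟨ψ, fun {a b} => ?_⟩ c
  rw [deleteIncidenceSet_adj, deleteIncidenceSet_adj, ψ.injective.ne_iff, ψ.injective.ne_iff]
  have := h a b
  tauto

end InducedIso

section LongTree

variable {V : Type*} {T : SimpleGraph V} {u v p x : V}

theorem exists_adj_isInner (hT : T.IsTree) (hd : ∃ a b, 4 ≤ T.dist a b) (p : V) :
    ∃ u, T.Adj p u ∧ IsInner T u := by
  obtain ⟨a, b, hab⟩ := hd
  have htri := hT.connected.dist_triangle (u := a) (v := p) (w := b)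
  rw [SimpleGraph.dist_comm (u := a) (v := p)] at htri
  obtain ⟨w, hw⟩ : ∃ w, 2 ≤ T.dist p w := by
    rcases Nat.lt_or_ge (T.dist p a) 2 with h | h
    · exact ⟨b, by omega⟩
    · exact ⟨a, h⟩
  obtain ⟨u, hu, huw⟩ := exists_adj_toward hT (v := p) (w := w) (by rintro rfl; simp at hw)
  obtain ⟨c, hc, hcw⟩ := exists_adj_toward hT (v := u) (w := w)
    (by rintro rfl; rw [dist_self] at huw; omega)
  refine ⟨u, hu, p, c, ?_, hu.symm, hc⟩
  rintro rfl
  omega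

theorem IsLeafAt.isInner (hT : T.IsTree) (hd : ∃ a b, 4 ≤ T.dist a b) (h : IsLeafAt T p x) :
    IsInner T p := by
  obtain ⟨u, hu, hui⟩ := exists_adj_isInner hT hd p
  exact ⟨u, x, fun e => h.not_isInner (e ▸ hui), hu, h.adj.symm⟩

theorem exists_isDeepLeaf_mem_branch [Fintype V] (hT : T.IsTree) (h : T.Adj u v) (hu : IsInner T u)
    (hv : IsInner T v) : ∃ x ∈ branch T u v, IsDeepLeaf T x := by
  have hne : leafDeck (code T u v) ≠ 0 := leafDeck_ne_zero fun hc => (code_eq_pt_iff hT h).1 hc hv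
  rw [← map_deepLeaf_branch hT h hu, Ne, Multiset.map_eq_zero, Finset.val_eq_zero, ← Ne,
    ← nonempty_iff_ne_empty] at hne
  obtain ⟨x, hx⟩ := hne
  rw [mem_filter, mem_erase] at hx
  exact ⟨x, hx.1.2, hx.2⟩

theorem exists_isDeepLeaf [Finite V] (hT : T.IsTree) (hd : ∃ a b, 4 ≤ T.dist a b) :
    ∃ x, IsDeepLeaf T x := by
  cases nonempty_fintype V
  obtain ⟨a, -⟩ := id hd
  obtain ⟨u, -, hu⟩ := exists_adj_isInner hT hd a
  obtain ⟨v, huv, hv⟩ := exists_adj_isInner hT hd u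
  obtain ⟨x, -, hx⟩ := exists_isDeepLeaf_mem_branch hT huv hu hv
  exact ⟨x, hx⟩

end LongTree

section Label

variable {V : Type*} [Fintype V] {T S X : SimpleGraph V} {u v a p q x : V}

theorem code_eq_pt_iff_of_le (hT : T.IsTree) (hX : X ≤ T) (h : T.Adj u v) :
    code X u v = pt ↔ kidSet X u v = ∅ := by
  rw [code_eq hT hX h, pt, EmbeddingLike.apply_eq_iff_eq, Multiset.map_eq_zero, Finset.val_eq_zero]

theorem code_eq_edge_iff_of_le (hT : T.IsTree) (hX : X ≤ T) (h : T.Adj u v) :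
    code X u v = TreeCode.edge ↔ ∃ a, kidSet X u v = {a} ∧ kidSet X v a = ∅ := by
  rw [code_eq hT hX h, TreeCode.edge, EmbeddingLike.apply_eq_iff_eq, Multiset.map_eq_singleton]
  refine exists_congr fun a => ?_
  rw [← Finset.singleton_val, Finset.val_inj]
  refine and_congr_right fun ha => ?_
  have hva : a ∈ kidSet X u v := ha ▸ mem_singleton_self a
  exact code_eq_pt_iff_of_le hT hX (hX (mem_kidSet.1 hva).1)

theorem leafLabel_eq_true_iff (hx : IsLeafAt T p x) :
    leafLabel T x = true ↔ ∃ q, ∀ y, T.Adj p y → y = x ∨ y = q := by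
  rw [leafLabel, decide_eq_true_iff]
  constructor
  · rintro ⟨p', q, hp', hq⟩
    obtain rfl := hx.eq hp'
    exact ⟨q, hq⟩
  · rintro ⟨q, hq⟩
    exact ⟨p, q, hx, hq⟩

theorem kidSet_deleteIncidenceSet_of_ne (hx : IsLeafAt T p x) (hvp : v ≠ p) (hvx : v ≠ x) :
    kidSet (T.deleteIncidenceSet x) u v = kidSet T u v := by
  ext c
  rw [mem_kidSet, mem_kidSet, deleteIncidenceSet_adj]
  refine and_congr_left fun _ => ⟨And.left, fun h => ⟨h, hvx, ?_⟩⟩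
  rintro rfl
  exact hvp ((hx v).1 h.symm)

theorem kidSet_deleteIncidenceSet_eq_empty_iff (hx : IsLeafAt T p x) :
    kidSet (T.deleteIncidenceSet x) a p = ∅ ↔ ∀ y, T.Adj p y → y = x ∨ y = a := by
  have hpx := hx.adj.ne.symm
  simp only [eq_empty_iff_forall_notMem, mem_kidSet, deleteIncidenceSet_adj]
  exact forall_congr' fun y => by tauto

theorem codeCount_pt_eq_card (hT : T.IsTree) (hX : X ≤ T) :
    codeCount X pt = #{d ∈ dartSet X | kidSet X d.1 d.2 = ∅} := by
  rw [codeCount]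
  refine congrArg Finset.card (filter_congr fun d hd => ?_)
  exact code_eq_pt_iff_of_le hT hX (hX (mem_dartSet.1 hd))

theorem filter_darts_not_into (hT : T.IsTree) (hx : IsLeafAt T p x) (hp : IsInner T p) :
    {d ∈ dartSet (T.deleteIncidenceSet x) |
        kidSet (T.deleteIncidenceSet x) d.1 d.2 = ∅ ∧ d.2 ≠ p} =
      {d ∈ dartSet T | kidSet T d.1 d.2 = ∅}.erase (p, x) := by
  ext ⟨a, b⟩
  simp only [mem_filter, mem_dartSet, mem_erase, ne_eq, Prod.mk.injEq, deleteIncidenceSet_adj]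
  by_cases hab : T.Adj a b
  swap
  · simp [hab]
  have hbp : kidSet T a b = ∅ → b ≠ p := by
    rintro hk rfl
    exact (code_eq_pt_iff hT hab).1 ((code_eq_pt_iff_of_le hT le_rfl hab).2 hk) hp
  have hbx : b = x → a = p := by
    rintro rfl
    exact (hx a).1 hab.symm
  have hax : a = x → b = p := by
    rintro rfl
    exact (hx b).1 hab
  have hk : b ≠ p → b ≠ x → kidSet (T.deleteIncidenceSet x) a b = kidSet T a b :=
    kidSet_deleteIncidenceSet_of_ne hx
  grind

theorem card_filter_darts_into (hx : IsLeafAt T p x) (hp : IsInner T p) :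
    #{d ∈ dartSet (T.deleteIncidenceSet x) |
        kidSet (T.deleteIncidenceSet x) d.1 d.2 = ∅ ∧ d.2 = p} =
      if leafLabel T x = true then 1 else 0 := by
  have hmem : ∀ d, d ∈ ({d ∈ dartSet (T.deleteIncidenceSet x) |
      kidSet (T.deleteIncidenceSet x) d.1 d.2 = ∅ ∧ d.2 = p} : Finset (V × V)) ↔
        d.2 = p ∧ T.Adj p d.1 ∧ d.1 ≠ x ∧ ∀ y, T.Adj p y → y = x ∨ y = d.1 := by
    rintro ⟨a, b⟩
    rw [mem_filter, mem_dartSet, deleteIncidenceSet_adj, T.adj_comm]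
    constructor
    · rintro ⟨⟨hab, hax, -⟩, hk, rfl⟩
      exact ⟨rfl, hab, hax, (kidSet_deleteIncidenceSet_eq_empty_iff hx).1 hk⟩
    · rintro ⟨rfl, hab, hax, hk⟩
      exact ⟨⟨hab, hax, hx.adj.ne.symm⟩, (kidSet_deleteIncidenceSet_eq_empty_iff hx).2 hk, rfl⟩
  obtain ⟨u, hu, hux⟩ : ∃ u, T.Adj p u ∧ u ≠ x := by
    obtain ⟨a, b, hab, ha, hb⟩ := hp
    by_cases hax : a = x
    · exact ⟨b, hb, fun h => hab (hax.trans h.symm)⟩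
    · exact ⟨a, ha, hax⟩
  split_ifs with hl
  · obtain ⟨q, hq⟩ := (leafLabel_eq_true_iff hx).1 hl
    obtain rfl := (hq u hu).resolve_left hux
    refine card_eq_one.2 ⟨(u, p), ext fun d => ?_⟩
    rw [hmem, mem_singleton, Prod.ext_iff]
    constructor
    · rintro ⟨hd, -, -, hk⟩
      exact ⟨((hk u hu).resolve_left hux).symm, hd⟩
    · rintro ⟨hd₁, hd₂⟩
      simp only at hd₁ hd₂
      rw [hd₁]
      exact ⟨hd₂, hu, hux, hq⟩
  · refine card_eq_zero.2 (eq_empty_of_forall_notMem fun d hd => hl ?_)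
    exact (leafLabel_eq_true_iff hx).2 ⟨d.1, ((hmem d).1 hd).2.2.2⟩

/-- Deleting `x` destroys the dart into `x`; its neighbour becomes a leaf exactly when `x` is
labelled. -/
theorem codeCount_pt_deleteIncidenceSet (hT : T.IsTree) (hx : IsLeafAt T p x) (hp : IsInner T p) :
    codeCount (T.deleteIncidenceSet x) pt + 1 =
      codeCount T pt + if leafLabel T x = true then 1 else 0 := by
  have hpx : (p, x) ∈ ({d ∈ dartSet T | kidSet T d.1 d.2 = ∅} : Finset (V × V)) := by
    rw [mem_filter, mem_dartSet, ← code_eq_pt_iff_of_le hT le_rfl hx.adj.symm,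
      code_eq_pt_iff hT hx.adj.symm]
    exact ⟨hx.adj.symm, hx.not_isInner⟩
  have hsplit := card_filter_add_card_filter_not
    (s := {d ∈ dartSet (T.deleteIncidenceSet x) | kidSet (T.deleteIncidenceSet x) d.1 d.2 = ∅})
    fun d => d.2 = p
  rw [filter_filter, filter_filter, card_filter_darts_into hx hp, filter_darts_not_into hT hx hp,
    ← codeCount_pt_eq_card hT (deleteIncidenceSet_le T x)] at hsplit
  rw [codeCount_pt_eq_card hT le_rfl, ← card_erase_add_one hpx]
  omega

end Label

section EdgeCount

variable {V : Type*} [Fintype V] {T : SimpleGraph V} {u v p x y : V}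

theorem IsDeepLeaf.exists_kidSet_eq_singleton (hT : T.IsTree) (hd : ∃ a b, 4 ≤ T.dist a b)
    (hy : IsDeepLeaf T y) (hl : leafLabel T y = true) :
    ∃ u p, IsInner T u ∧ T.Adj u p ∧ IsLeafAt T p y ∧ kidSet T u p = {y} := by
  obtain ⟨p, hp, -⟩ := hy
  obtain ⟨u, hu, hui⟩ := exists_adj_isInner hT hd p
  have huy : u ≠ y := fun e => hp.not_isInner (e ▸ hui)
  obtain ⟨q, hq⟩ := (leafLabel_eq_true_iff hp).1 hl
  obtain rfl := (hq u hu).resolve_left huy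
  refine ⟨u, p, hui, hu.symm, hp, ext fun w => ?_⟩
  rw [mem_kidSet, mem_singleton]
  refine ⟨fun hw => (hq w hw.1).resolve_right hw.2, ?_⟩
  rintro rfl
  exact ⟨hp.adj.symm, huy.symm⟩

theorem code_deleteIncidenceSet_eq_edge (hT : T.IsTree) (h : T.Adj u p) (hy : IsLeafAt T p y)
    (hk : kidSet T u p = {y}) (hpx : p ≠ x) (hyx : y ≠ x) :
    code (T.deleteIncidenceSet x) u p = TreeCode.edge := by
  rw [code_deleteIncidenceSet_of_notMem hT h, code_eq_edge_iff_of_le hT le_rfl h]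
  · refine ⟨y, hk, ?_⟩
    rw [← code_eq_pt_iff_of_le hT le_rfl hy.adj.symm, code_eq_pt_iff hT hy.adj.symm]
    exact hy.not_isInner
  · rw [branch_eq hT h, hk, singleton_biUnion, hy.branch_eq hT]
    simp [hpx.symm, hyx.symm]

theorem card_deepSet_le (hT : T.IsTree) (hd : ∃ a b, 4 ≤ T.dist a b)
    (hl : ∀ y, IsDeepLeaf T y → leafLabel T y = true) (hx : IsDeepLeaf T x) :
    #(deepSet T) ≤ codeCount (T.deleteIncidenceSet x) TreeCode.edge + 1 := by
  choose! u p hu hup hp hk using fun y hy =>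
    IsDeepLeaf.exists_kidSet_eq_singleton hT hd hy (hl y hy)
  rw [← card_erase_add_one (mem_deepSet.2 hx), codeCount]
  refine Nat.add_le_add_right (card_le_card_of_injOn (fun y => (u y, p y)) ?_ ?_) 1
  · intro y hy
    rw [mem_coe, mem_erase, mem_deepSet] at hy
    have hpx : p y ≠ x := fun e => hx.not_isInner (e ▸ (hp y hy.2).isInner hT hd)
    have hux : u y ≠ x := fun e => hx.not_isInner (e ▸ hu y hy.2)
    rw [mem_coe, mem_filter, mem_dartSet, deleteIncidenceSet_adj]
    exact ⟨⟨hup y hy.2, hux, hpx⟩, code_deleteIncidenceSet_eq_edge hT (hup y hy.2) (hp y hy.2)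
      (hk y hy.2) hpx hy.1⟩
  · intro y hy y' hy' he
    rw [mem_coe, mem_erase, mem_deepSet] at hy hy'
    obtain ⟨heu, hep⟩ := Prod.mk.inj he
    rw [← singleton_inj, ← hk y hy.2, ← hk y' hy'.2, heu, hep]

theorem exists_isDeepLeaf_of_code_eq_edge (hT : T.IsTree) (h : T.Adj u v)
    (hc : code T u v = TreeCode.edge) : ∃ a, IsDeepLeaf T a ∧ leafLabel T a = true := by
  obtain ⟨a, ha, ha'⟩ := (code_eq_edge_iff_of_le hT le_rfl h).1 hc
  have hva : T.Adj v a := (mem_kidSet.1 (ha ▸ mem_singleton_self a)).1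
  have hleaf : IsLeafAt T v a := isLeafAt_of_not_isInner hva.symm
    ((code_eq_pt_iff hT hva).1 ((code_eq_pt_iff_of_le hT le_rfl hva).2 ha'))
  have hv : ∀ w, T.Adj v w → w = a ∨ w = u := fun w hw => by
    by_contra! hcon
    exact hcon.1 (mem_singleton.1 (ha ▸ mem_kidSet.2 ⟨hw, hcon.2⟩))
  have hinner : ∀ w, T.Adj v w → IsInner T w → w = u := fun w hw hwi =>
    (hv w hw).resolve_left fun e => hleaf.not_isInner (e ▸ hwi)
  exact ⟨a, ⟨v, hleaf, fun b c hb hc hbi hci => (hinner b hb hbi).trans (hinner c hc hci).symm⟩,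
    (leafLabel_eq_true_iff hleaf).2 ⟨u, hv⟩⟩

theorem eq_and_isInner_of_code_deleteIncidenceSet_eq_edge (hT : T.IsTree)
    (hd : ∃ a b, 4 ≤ T.dist a b) (hl : ∀ y, IsDeepLeaf T y → leafLabel T y ≠ true)
    (hx : IsDeepLeaf T x) (hp : IsLeafAt T p x) (h : (T.deleteIncidenceSet x).Adj u v)
    (hc : code (T.deleteIncidenceSet x) u v = TreeCode.edge) : v = p ∧ IsInner T u := by
  have hadj := deleteIncidenceSet_adj.1 h
  obtain ⟨a, ha, ha'⟩ :=
    (code_eq_edge_iff_of_le hT (deleteIncidenceSet_le T x) hadj.1).1 hc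
  have hva : T.Adj v a ∧ v ≠ x ∧ a ≠ x :=
    deleteIncidenceSet_adj.1 (mem_kidSet.1 (ha ▸ mem_singleton_self a)).1
  have hvp : v = p := by
    by_contra hvp
    by_cases hap : a = p
    · subst hap
      exact hl x hx ((leafLabel_eq_true_iff hp).2
        ⟨v, (kidSet_deleteIncidenceSet_eq_empty_iff hp).1 ha'⟩)
    · rw [kidSet_deleteIncidenceSet_of_ne hp hvp hadj.2.2] at ha
      rw [kidSet_deleteIncidenceSet_of_ne hp hap hva.2.2] at ha'
      obtain ⟨b, hb, hbl⟩ := exists_isDeepLeaf_of_code_eq_edge hT hadj.1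
        ((code_eq_edge_iff_of_le hT le_rfl hadj.1).2 ⟨a, ha, ha'⟩)
      exact hl b hb hbl
  subst hvp
  obtain ⟨c, hvc, hci⟩ := exists_adj_isInner hT hd v
  have hcx : c ≠ x := fun e => hp.not_isInner (e ▸ hci)
  refine ⟨rfl, ?_⟩
  by_cases hcu : c = u
  · exact hcu ▸ hci
  · have hca : c ∈ kidSet (T.deleteIncidenceSet x) u v :=
      mem_kidSet.2 ⟨deleteIncidenceSet_adj.2 ⟨hvc, hva.2.1, hcx⟩, hcu⟩
    obtain rfl := mem_singleton.1 (ha ▸ hca)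
    rw [kidSet_deleteIncidenceSet_of_ne hp hvc.ne.symm hcx] at ha'
    exact absurd hci ((code_eq_pt_iff hT hvc).1 ((code_eq_pt_iff_of_le hT le_rfl hvc).2 ha'))

theorem codeCount_edge_le_one (hT : T.IsTree) (hd : ∃ a b, 4 ≤ T.dist a b)
    (hl : ∀ y, IsDeepLeaf T y → leafLabel T y ≠ true) (hx : IsDeepLeaf T x) :
    codeCount (T.deleteIncidenceSet x) TreeCode.edge ≤ 1 := by
  obtain ⟨p, hp, hpu⟩ := id hx
  rw [codeCount, card_le_one]
  rintro ⟨u, v⟩ hd₁ ⟨u', v'⟩ hd₂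
  rw [mem_filter, mem_dartSet] at hd₁ hd₂
  obtain ⟨rfl, hu⟩ :=
    eq_and_isInner_of_code_deleteIncidenceSet_eq_edge hT hd hl hx hp hd₁.1 hd₁.2
  obtain ⟨rfl, hu'⟩ :=
    eq_and_isInner_of_code_deleteIncidenceSet_eq_edge hT hd hl hx hp hd₂.1 hd₂.2
  have hadj := deleteIncidenceSet_le T x hd₁.1
  have hadj' := deleteIncidenceSet_le T x hd₂.1
  rw [hpu u u' hadj.symm hadj'.symm hu hu']

theorem three_le_card_deepSet (hT : T.IsTree) (hd : ∃ a b, 4 ≤ T.dist a b)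
    (hx : IsDeepLeaf T x) (hl : leafLabel T x ≠ true) : 3 ≤ #(deepSet T) := by
  obtain ⟨p, hp, hpu⟩ := id hx
  obtain ⟨u, hu, hui⟩ := exists_adj_isInner hT hd p
  obtain ⟨y, hy, hyx, hyu⟩ : ∃ y, T.Adj p y ∧ y ≠ x ∧ y ≠ u := by
    by_contra! hcon
    refine hl ((leafLabel_eq_true_iff hp).2 ⟨u, fun y hy => ?_⟩)
    by_cases hyx : y = x
    · exact Or.inl hyx
    · exact Or.inr (hcon y hy hyx)
  have hyd : IsDeepLeaf T y :=
    ⟨p, isLeafAt_of_not_isInner hy.symm fun h => hyu (hpu y u hy hu h hui), hpu⟩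
  obtain ⟨w, hw, hwd⟩ := exists_isDeepLeaf_mem_branch hT hu (hp.isInner hT hd) hui
  have hne : ∀ v, T.Adj p v → v ≠ u → w ≠ v := by
    rintro v hv hvu rfl
    exact disjoint_left.1 (disjoint_branch hT hu hv hvu.symm) hw (mem_branch_right hv)
  have hwx := hne x hp.adj.symm fun e => hp.not_isInner (e ▸ hui)
  rw [← card_eq_three.2 ⟨x, y, w, hyx.symm, hwx.symm, (hne y hy hyu).symm, rfl⟩]
  refine card_le_card fun v hv => ?_
  simp only [mem_insert, mem_singleton] at hv
  rw [mem_deepSet]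
  rcases hv with rfl | rfl | rfl <;> assumption

end EdgeCount

theorem exists_leafMove {V : Type*} {T S : SimpleGraph V} {p q x : V} (hT : T.IsTree)
    (hS : S.IsTree) (hp : IsLeafAt T p x) (hq : IsLeafAt S q x)
    (hadj : ∀ a b, a ≠ x → b ≠ x → (T.Adj a b ↔ S.Adj a b)) :
    ∃ z, LeafMove T S x (T.dist p q) z := by
  obtain ⟨z, hz0, hzm, hzadj, hzd⟩ := exists_geodesic hT p q
  refine ⟨z, hT, hS, hz0.symm ▸ hp, hzm.symm ▸ hq, hadj, fun i hi hix => ?_, hzadj, ?_⟩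
  · have hdist := hzd i hi
    rw [hix, hp.dist_eq hT hq.adj.ne.symm, SimpleGraph.dist_comm,
      hp.dist_eq hT hp.adj.ne.symm] at hdist
    omega
  · rw [hz0, hzm]
    exact hzd

section Deletions

variable {V : Type*} [Fintype V] {T S : SimpleGraph V} {φ : Equiv.Perm V} {x : V}

/-- `φ` matches the deep leaves of `T` with those of `S` in such a way that deleting matching
leaves leaves forests with the same numbers of branches of each code. -/
structure IsDeletionMatching (T S : SimpleGraph V) (φ : Equiv.Perm V) : Prop where
  isDeepLeaf_iff : ∀ x, IsDeepLeaf T x ↔ IsDeepLeaf S (φ x)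
  codeCount_eq : ∀ x, IsDeepLeaf T x → ∀ c,
    codeCount (T.deleteIncidenceSet x) c = codeCount (S.deleteIncidenceSet (φ x)) c

namespace IsDeletionMatching

theorem symm (h : IsDeletionMatching T S φ) : IsDeletionMatching S T φ.symm where
  isDeepLeaf_iff x := by simp [h.isDeepLeaf_iff]
  codeCount_eq x hx c := by
    rw [h.codeCount_eq _ (by simpa [h.isDeepLeaf_iff] using hx), Equiv.apply_symm_apply]

theorem card_deepSet_eq (h : IsDeletionMatching T S φ) : #(deepSet T) = #(deepSet S) :=
  card_equiv φ fun x => by rw [mem_deepSet, mem_deepSet, h.isDeepLeaf_iff]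

theorem codeCount_pt_add_eq (h : IsDeletionMatching T S φ) (hT : T.IsTree) (hS : S.IsTree)
    (hdT : ∃ a b, 4 ≤ T.dist a b) (hdS : ∃ a b, 4 ≤ S.dist a b) (hx : IsDeepLeaf T x) :
    (codeCount T pt + if leafLabel T x = true then 1 else 0) =
      codeCount S pt + if leafLabel S (φ x) = true then 1 else 0 := by
  obtain ⟨p, hp, -⟩ := id hx
  obtain ⟨q, hq, -⟩ := (h.isDeepLeaf_iff x).1 hx
  rw [← codeCount_pt_deleteIncidenceSet hT hp (hp.isInner hT hdT),
    ← codeCount_pt_deleteIncidenceSet hS hq (hq.isInner hS hdS), h.codeCount_eq x hx]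

/-- If `S` had more leaves than `T`, then all deep leaves of `T` and none of `S` would be labelled,
and the numbers of pendant paths with two vertices left by a deletion would differ. -/
theorem codeCount_pt_le (h : IsDeletionMatching T S φ) (hT : T.IsTree) (hS : S.IsTree)
    (hdT : ∃ a b, 4 ≤ T.dist a b) (hdS : ∃ a b, 4 ≤ S.dist a b) :
    codeCount S pt ≤ codeCount T pt := by
  by_contra! hlt
  have hlabel : ∀ x, IsDeepLeaf T x → leafLabel T x = true ∧ leafLabel S (φ x) ≠ true := by
    intro x hx
    have hpt := h.codeCount_pt_add_eq hT hS hdT hdS hx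
    split_ifs at hpt with hT' hS' <;> first | omega | exact ⟨hT', hS'⟩
  have hlabelS : ∀ y, IsDeepLeaf S y → leafLabel S y ≠ true := fun y hy => by
    simpa using (hlabel (φ.symm y) (by simpa [h.isDeepLeaf_iff] using hy)).2
  obtain ⟨x, hx⟩ := exists_isDeepLeaf hT hdT
  have hxS := (h.isDeepLeaf_iff x).1 hx
  have hle := card_deepSet_le hT hdT (fun y hy => (hlabel y hy).1) hx
  have hle_one := codeCount_edge_le_one hS hdS hlabelS hxS
  have hthree := three_le_card_deepSet hS hdS hxS (hlabel x hx).2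
  rw [h.codeCount_eq x hx, h.card_deepSet_eq] at hle
  omega

theorem sameDeletions (h : IsDeletionMatching T S φ) (hT : T.IsTree) (hS : S.IsTree)
    (hdT : ∃ a b, 4 ≤ T.dist a b) (hdS : ∃ a b, 4 ≤ S.dist a b) : SameDeletions T S := by
  have hpt : codeCount T pt = codeCount S pt :=
    (h.symm.codeCount_pt_le hS hT hdS hdT).antisymm (h.codeCount_pt_le hT hS hdT hdS)
  have hlabel : ∀ x, IsDeepLeaf T x → (leafLabel T x = leafLabel S (φ x)) := by
    intro x hx
    have hadd := h.codeCount_pt_add_eq hT hS hdT hdS hx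
    rw [hpt, Nat.add_left_cancel_iff] at hadd
    rw [Bool.eq_iff_iff]
    split_ifs at hadd <;> simp_all
  have hmem : ∀ τ x, x ∈ deepLabelSet T τ ↔ φ x ∈ deepLabelSet S τ := by
    intro τ x
    rw [mem_deepLabelSet, mem_deepLabelSet, ← h.isDeepLeaf_iff]
    exact and_congr_right fun hx => by rw [hlabel x hx]
  exact ⟨fun τ => card_equiv φ (hmem τ), fun τ c => sum_equiv φ (hmem τ) fun x hx =>
    h.codeCount_eq x (mem_deepLabelSet.1 hx).1 c, hpt⟩

end IsDeletionMatching

theorem IsDeletionMatching.nonempty_iso (h : IsDeletionMatching T S φ) (hT : T.IsTree)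
    (hS : S.IsTree) (hdT : ∃ a b, 4 ≤ T.dist a b) (hdS : ∃ a b, 4 ≤ S.dist a b)
    (hx : IsDeepLeaf T x) (hφ : φ x = x)
    (hadj : ∀ a b, a ≠ x → b ≠ x → (T.Adj a b ↔ S.Adj a b)) : Nonempty (T ≃g S) := by
  obtain ⟨p, hp, -⟩ := id hx
  obtain ⟨q, hq, -⟩ := hφ ▸ (h.isDeepLeaf_iff x).1 hx
  obtain ⟨z, hz⟩ := exists_leafMove hT hS hp hq hadj
  exact hz.nonempty_iso (h.sameDeletions hT hS hdT hdS)

end Deletions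

section InducedSubgraphs

variable {V W : Type*} {T : SimpleGraph V} {S : SimpleGraph W}

theorem IsInner.map_iso (e : T ≃g S) {v : V} (h : IsInner T v) : IsInner S (e v) := by
  obtain ⟨a, b, hab, ha, hb⟩ := h
  exact ⟨e a, e b, e.injective.ne hab, e.map_adj_iff.2 ha, e.map_adj_iff.2 hb⟩

theorem IsDeepLeaf.map_iso (e : T ≃g S) {x : V} (h : IsDeepLeaf T x) : IsDeepLeaf S (e x) := by
  obtain ⟨p, hp, hu⟩ := h
  refine ⟨e p, fun y => ?_, fun a b ha hb hai hbi => ?_⟩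
  · obtain ⟨y, rfl⟩ := e.surjective y
    rw [e.map_adj_iff, hp y, e.injective.eq_iff]
  · obtain ⟨a, rfl⟩ := e.surjective a
    obtain ⟨b, rfl⟩ := e.surjective b
    rw [hu a b (e.map_adj_iff.1 ha) (e.map_adj_iff.1 hb)]
    · simpa using hai.map_iso e.symm
    · simpa using hbi.map_iso e.symm

theorem isDeepLeaf_iso_iff (e : T ≃g S) {x : V} : IsDeepLeaf S (e x) ↔ IsDeepLeaf T x :=
  ⟨fun h => by simpa using h.map_iso e.symm, fun h => h.map_iso e⟩

theorem edist_map_le (f : T →g S) (a b : V) : S.edist (f a) (f b) ≤ T.edist a b :=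
  le_iInf fun w => (edist_le (w.map f)).trans_eq (by rw [Walk.length_map])

theorem edist_map_iso (e : T ≃g S) (a b : V) : S.edist (e a) (e b) = T.edist a b :=
  le_antisymm (edist_map_le e.toHom a b) <| by simpa using edist_map_le e.symm.toHom (e a) (e b)

theorem nonempty_iso_of_induce_iso [Finite V] [Finite W] (hT : T.IsTree) (hS : S.IsTree)
    (hdT : ∃ a b, 4 ≤ T.dist a b) (hdS : ∃ a b, 4 ≤ S.dist a b) (φ : V ≃ W)
    (hφ : ∀ x, IsDeepLeaf T x ↔ IsDeepLeaf S (φ x))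
    (he : ∀ x, IsDeepLeaf T x →
      Nonempty (T.induce ({x}ᶜ : Set V) ≃g S.induce ({φ x}ᶜ : Set W))) : Nonempty (T ≃g S) := by
  cases nonempty_fintype V
  cases nonempty_fintype W
  obtain ⟨x, hx⟩ := exists_isDeepLeaf hT hdT
  obtain ⟨ψ, hψx, hψ⟩ := exists_equiv_of_induce_iso (he x hx).some
  let e : S.comap ψ ≃g S := Iso.comap ψ S
  have hS' : (S.comap ψ).IsTree := e.isTree_iff.2 hS
  have hdS' : ∃ a b, 4 ≤ (S.comap ψ).dist a b := by
    obtain ⟨a, b, hab⟩ := hdS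
    refine ⟨e.symm a, e.symm b, hab.trans_eq ?_⟩
    rw [SimpleGraph.dist, SimpleGraph.dist, edist_map_iso]
  have hmatch : IsDeletionMatching T (S.comap ψ) (φ.trans ψ.symm) := by
    refine ⟨fun y => ?_, fun y hy c => ?_⟩
    · rw [hφ, ← isDeepLeaf_iso_iff e]
      simp [e]
    · rw [codeCount_eq_of_induce_iso (he y hy).some]
      refine (codeCount_eq_of_iso ⟨ψ, fun {a b} => ?_⟩ c).symm
      simp [deleteIncidenceSet_adj, Equiv.eq_symm_apply]
  obtain ⟨e'⟩ := hmatch.nonempty_iso hT hS' hdT hdS' hx (by simp [← hψx]) hψ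
  exact ⟨e'.trans e⟩

end InducedSubgraphs

/-! ### Deep leaves in the cube -/

/-- The neighbours of `x` are pairwise adjacent. -/
def IsSimplicialVertex {V : Type*} (G : SimpleGraph V) (x : V) : Prop :=
  ∀ a b, G.Adj x a → G.Adj x b → a ≠ b → G.Adj a b

/-- `v` has at least two neighbours that are not leaves. -/
def IsCore {V : Type*} (T : SimpleGraph V) (v : V) : Prop :=
  ∃ a b, a ≠ b ∧ T.Adj v a ∧ T.Adj v b ∧ IsInner T a ∧ IsInner T b

section Core

variable {V : Type*} {T : SimpleGraph V} {a b c u v w x y p : V}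

theorem IsCore.isInner (h : IsCore T u) : IsInner T u := by
  obtain ⟨a, b, hab, ha, hb, -⟩ := h
  exact ⟨a, b, hab, ha, hb⟩

theorem IsInner.exists_adj_ne (h : IsInner T u) (c : V) : ∃ a, T.Adj u a ∧ a ≠ c := by
  obtain ⟨a, b, hab, ha, hb⟩ := h
  by_cases hac : a = c
  · exact ⟨b, hb, fun e => hab (hac.trans e.symm)⟩
  · exact ⟨a, ha, hac⟩

theorem isDeepLeaf_iff : IsDeepLeaf T x ↔ ∃ p, IsLeafAt T p x ∧ ¬ IsCore T p := by
  simp only [IsDeepLeaf, IsCore]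
  refine exists_congr fun p => and_congr_right fun _ => ⟨?_, fun h a b ha hb hai hbi => ?_⟩
  · rintro h ⟨a, b, hab, ha, hb, hai, hbi⟩
    exact hab (h a b ha hb hai hbi)
  · by_contra hab
    exact h ⟨a, b, hab, ha, hb, hai, hbi⟩

theorem dist_eq_two (hT : T.IsTree) (ha : T.Adj u a) (hb : T.Adj u b) (hab : a ≠ b) :
    T.dist a b = 2 := by
  have hub : T.dist u b = 1 := dist_eq_one_iff_adj.2 hb
  rw [dist_eq_add_one_of_ne hT hb ha hab.symm (by rw [hub, dist_self]), hub]

theorem isInner_of_adj_toward (hT : T.IsTree) (ha : T.Adj v a)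
    (ha' : T.dist v w = T.dist a w + 1) (haw : a ≠ w) : IsInner T a := by
  obtain ⟨c, hc, hc'⟩ := exists_adj_toward hT haw
  exact ⟨v, c, ne_of_apply_ne (T.dist · w) (by omega), ha.symm, hc⟩

theorem exists_adj_toward_isInner (hT : T.IsTree) (h : 2 ≤ T.dist v w) :
    ∃ a, T.Adj v a ∧ T.dist v w = T.dist a w + 1 ∧ IsInner T a := by
  obtain ⟨a, ha, ha'⟩ := exists_adj_toward hT (v := v) (w := w) (by rintro rfl; simp at h)
  exact ⟨a, ha, ha', isInner_of_adj_toward hT ha ha' (by rintro rfl; rw [dist_self] at ha'; omega)⟩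

theorem isCore_of_dist_add_dist_eq (hT : T.IsTree) (ha : 2 ≤ T.dist u a) (hb : 2 ≤ T.dist u b)
    (hab : T.dist a u + T.dist u b = T.dist a b) : IsCore T u := by
  obtain ⟨c, hc, hca, hci⟩ := exists_adj_toward_isInner hT ha
  obtain ⟨d, hd, hdb, hdi⟩ := exists_adj_toward_isInner hT hb
  refine ⟨c, d, ?_, hc, hd, hci, hdi⟩
  rintro rfl
  have htri := hT.connected.dist_triangle (u := a) (v := c) (w := b)
  rw [SimpleGraph.dist_comm (u := a) (v := u)] at hab
  rw [SimpleGraph.dist_comm (u := a) (v := c)] at htri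
  omega

theorem dist_eq_add_of_toward_ne [Finite V] (hT : T.IsTree) (hc : T.Adj u c) (hb : T.Adj u b)
    (hcb : c ≠ b) (hy : T.dist u y = T.dist c y + 1) (ha : T.dist u a = T.dist b a + 1) :
    T.dist a y = T.dist a u + T.dist u y := by
  cases nonempty_fintype V
  have hyb : y ∉ branch T u b := by
    rw [mem_branch, dist_eq_add_one_of_ne hT hc hb hcb hy]
    omega
  rw [dist_across hT hb ((mem_branch_iff hT hb).2 ha) hyb, SimpleGraph.dist_comm (u := a),
    SimpleGraph.dist_comm (u := a), ha]

theorem IsCore.exists_dist_eq_four [Finite V] (hT : T.IsTree) (hu : IsCore T u) :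
    ∃ a b, T.dist u a = 2 ∧ T.dist u b = 2 ∧ T.dist a b = 4 := by
  obtain ⟨c, d, hcd, hc, hd, hci, hdi⟩ := hu
  obtain ⟨a, ha, hau⟩ := hci.exists_adj_ne u
  obtain ⟨b, hb, hbu⟩ := hdi.exists_adj_ne u
  have hua := dist_eq_two hT hc.symm ha hau.symm
  have hub := dist_eq_two hT hd.symm hb hbu.symm
  have hab := dist_eq_add_of_toward_ne hT hd hc hcd.symm (y := b) (a := a)
    (by rw [hub, dist_eq_one_iff_adj.2 hb]) (by rw [hua, dist_eq_one_iff_adj.2 ha])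
  refine ⟨a, b, hua, hub, ?_⟩
  rw [hab, SimpleGraph.dist_comm, hua, hub]

theorem IsInner.exists_isLeafAt (h : IsInner T p) (hp : ¬ IsCore T p) : ∃ x, IsLeafAt T p x := by
  obtain ⟨a, b, hab, ha, hb⟩ := h
  by_cases hai : IsInner T a
  · by_cases hbi : IsInner T b
    · exact absurd ⟨a, b, hab, ha, hb, hai, hbi⟩ hp
    · exact ⟨b, isLeafAt_of_not_isInner hb.symm hbi⟩
  · exact ⟨a, isLeafAt_of_not_isInner ha.symm hai⟩

theorem IsLeafAt.dist_le_three_iff (hT : T.IsTree) (hx : IsLeafAt T p x) (hp : ¬ IsCore T p)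
    (hu : T.Adj p u) (hui : IsInner T u) :
    T.dist x y ≤ 3 ↔ T.dist p y ≤ 1 ∨ T.dist u y ≤ 1 := by
  have hpu : T.dist p u = 1 := dist_eq_one_iff_adj.2 hu
  rcases eq_or_ne y x with rfl | hyx
  · simp [dist_eq_one_iff_adj.2 hx.adj.symm]
  rw [hx.dist_eq hT hyx]
  have htri := hT.connected.dist_triangle (u := p) (v := u) (w := y)
  refine ⟨fun h => ?_, fun h => by omega⟩
  by_contra! hcon
  obtain ⟨c, hc, hc', hci⟩ := exists_adj_toward_isInner hT hcon.1
  exact hp ⟨u, c, ne_of_apply_ne (T.dist · y) (by omega), hu, hc, hui, hci⟩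

theorem IsDeepLeaf.dist_le_three (hT : T.IsTree) (hd : ∃ a b, 4 ≤ T.dist a b)
    (hx : IsDeepLeaf T x) (ha : T.dist x a ≤ 3) (hb : T.dist x b ≤ 3) : T.dist a b ≤ 3 := by
  obtain ⟨p, hp, hpc⟩ := isDeepLeaf_iff.1 hx
  obtain ⟨u, hu, hui⟩ := exists_adj_isInner hT hd p
  rw [hp.dist_le_three_iff hT hpc hu hui] at ha hb
  have hpu : T.dist p u = 1 := dist_eq_one_iff_adj.2 hu
  have h₁ := hT.connected.dist_triangle (u := a) (v := p) (w := b)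
  have h₂ := hT.connected.dist_triangle (u := a) (v := u) (w := b)
  have h₃ := hT.connected.dist_triangle (u := p) (v := u) (w := b)
  have h₄ := hT.connected.dist_triangle (u := u) (v := p) (w := b)
  rw [SimpleGraph.dist_comm (u := u) (v := p)] at h₄
  rw [SimpleGraph.dist_comm (u := a) (v := p)] at h₁
  rw [SimpleGraph.dist_comm (u := a) (v := u)] at h₂
  omega

end Core

section SimplicialVertex

variable {V : Type*} {T : SimpleGraph V} {x y p : V}

/-- The ball of radius `r` about `x` has diameter at most `r`. -/
def IsBallClique (T : SimpleGraph V) (r : ℕ) (x : V) : Prop :=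
  ∀ a b, T.dist x a ≤ r → T.dist x b ≤ r → T.dist a b ≤ r

theorem kthPower_adj (hT : T.IsTree) {k : ℕ} :
    (T.kthPower k).Adj x y ↔ x ≠ y ∧ T.dist x y ≤ k := by
  refine and_congr_right fun _ => ?_
  rw [← (hT.connected x y).coe_dist_eq_edist, Nat.cast_le]

theorem kthPower_ne_top_iff (hT : T.IsTree) {k : ℕ} :
    T.kthPower k ≠ ⊤ ↔ ∃ a b, k < T.dist a b := by
  rw [← not_iff_not, not_not]
  push Not
  simp only [SimpleGraph.ext_iff, funext_iff, kthPower_adj hT, top_adj, eq_iff_iff,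
    and_iff_left_iff_imp]
  refine forall₂_congr fun a b => ⟨fun h => ?_, fun h _ => h⟩
  rcases eq_or_ne a b with rfl | hab
  · simp
  · exact h hab

theorem isSimplicialVertex_kthPower_iff (hT : T.IsTree) {k : ℕ} :
    IsSimplicialVertex (T.kthPower k) x ↔ IsBallClique T k x := by
  constructor
  · intro h a b ha hb
    rcases eq_or_ne a b with rfl | hab
    · simp
    rcases eq_or_ne x a with rfl | hxa
    · exact hb
    rcases eq_or_ne x b with rfl | hxb
    · rwa [SimpleGraph.dist_comm]
    exact ((kthPower_adj hT).1 (h a b ((kthPower_adj hT).2 ⟨hxa, ha⟩)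
      ((kthPower_adj hT).2 ⟨hxb, hb⟩) hab)).2
  · intro h a b ha hb hab
    rw [kthPower_adj hT] at ha hb ⊢
    exact ⟨hab, h a b ha.2 hb.2⟩

theorem IsBallClique.exists_lt_dist {r : ℕ} (h : IsBallClique T r x)
    (hd : ∃ a b, r < T.dist a b) : ∃ z, r < T.dist x z := by
  by_contra! hcon
  obtain ⟨a, b, hab⟩ := hd
  exact hab.not_ge (h a b (hcon a) (hcon b))

theorem IsBallClique.not_isInner {r : ℕ} (hT : T.IsTree) (hr : 0 < r) (hd : ∃ a b, r < T.dist a b)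
    (h : IsBallClique T r x) : ¬ IsInner T x := by
  intro hx
  obtain ⟨z, hz⟩ := h.exists_lt_dist hd
  obtain ⟨g, -, -, -, hg⟩ := exists_geodesic hT x z
  have hxg := (hg r hz.le).1
  obtain ⟨a, ha, ha'⟩ := exists_adj_toward hT (v := x) (w := g r)
    (ne_of_apply_ne (T.dist x) (by rw [hxg, dist_self]; omega))
  obtain ⟨c, hc, hca⟩ := hx.exists_adj_ne a
  have hcg := dist_eq_add_one_of_ne hT ha hc hca.symm ha'
  have := h c (g r) (by rw [dist_eq_one_iff_adj.2 hc]; omega) hxg.le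
  omega

theorem isBallClique_three_iff [Finite V] (hT : T.IsTree) (hd : ∃ a b, 4 ≤ T.dist a b) :
    IsBallClique T 3 x ↔ IsDeepLeaf T x := by
  refine ⟨fun h => ?_, fun hx a b => hx.dist_le_three hT hd⟩
  obtain ⟨u, hu, -⟩ := exists_adj_isInner hT hd x
  refine isDeepLeaf_iff.2
    ⟨u, isLeafAt_of_not_isInner hu (h.not_isInner hT (by omega) hd), fun hc => ?_⟩
  obtain ⟨a, b, ha, hb, hab⟩ := hc.exists_dist_eq_four hT
  have hxu : T.dist x u = 1 := dist_eq_one_iff_adj.2 hu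
  have hxa := hT.connected.dist_triangle (u := x) (v := u) (w := a)
  have hxb := hT.connected.dist_triangle (u := x) (v := u) (w := b)
  have := h a b (by omega) (by omega)
  omega

theorem isSimplicialVertex_iff [Finite V] (hT : T.IsTree) (hd : ∃ a b, 4 ≤ T.dist a b) :
    IsSimplicialVertex (T.kthPower 3) x ↔ IsDeepLeaf T x :=
  (isSimplicialVertex_kthPower_iff hT).trans (isBallClique_three_iff hT hd)

theorem isCore_of_adj (hT : T.IsTree) (hd : ∃ a b, 4 ≤ T.dist a b) {u : V} (hpi : IsInner T p)
    (hp : ¬ IsCore T p) (h : T.Adj p u) (hu : IsInner T u) : IsCore T u := by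
  obtain ⟨x, hx⟩ := hpi.exists_isLeafAt hp
  have hball : IsBallClique T 3 x := fun a b =>
    (isDeepLeaf_iff.2 ⟨p, hx, hp⟩).dist_le_three hT hd
  obtain ⟨z, hz⟩ := hball.exists_lt_dist hd
  have hux : u ≠ x := fun e => hx.not_isInner (e ▸ hu)
  have hxu : T.dist x u = 2 := dist_eq_two hT hx.adj.symm h hux.symm
  have hxz := hx.dist_eq hT (w := z) (by rintro rfl; simp at hz)
  obtain ⟨c, hc, hcz, hci⟩ := exists_adj_toward_isInner hT (v := p) (w := z) (by omega)
  obtain rfl : c = u := by_contra fun hcu => hp ⟨c, u, hcu, hc, h, hci, hu⟩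
  exact isCore_of_dist_add_dist_eq hT (a := x) (b := z) (by rw [SimpleGraph.dist_comm, hxu])
    (by omega) (by omega)

end SimplicialVertex

section Delete

variable {V : Type*} [Finite V] {T : SimpleGraph V} {x p : V}

theorem IsLeafAt.isTree_induce (hT : T.IsTree) (hx : IsLeafAt T p x) :
    (T.induce ({x}ᶜ : Set V)).IsTree := by
  cases nonempty_fintype V
  refine ⟨hT.connected.induce_compl_singleton_of_degree_eq_one ?_, hT.isAcyclic.induce _⟩
  rw [← card_neighborFinset_eq_degree, Finset.card_eq_one]
  exact ⟨p, by ext y; rw [mem_neighborFinset, hx y, mem_singleton]⟩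

theorem IsLeafAt.dist_induce (hT : T.IsTree) (hx : IsLeafAt T p x) (a b : ({x}ᶜ : Set V)) :
    (T.induce ({x}ᶜ : Set V)).dist a b = T.dist a b := by
  have hconn := (hx.isTree_induce hT).connected
  refine le_antisymm ?_ ?_
  · induction hn : T.dist a b generalizing a with
    | zero =>
      obtain rfl : a = b := Subtype.ext (hT.connected.dist_eq_zero_iff.1 hn)
      simp
    | succ n ih =>
      obtain ⟨c, hc, hcb⟩ := exists_adj_toward hT (v := (a : V)) (w := b)
        (by intro e; rw [e, dist_self] at hn; omega)
      have hcx : c ≠ x := by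
        rintro rfl
        rw [(hx a).1 hc.symm, hx.dist_eq hT b.2] at hcb
        omega
      have hac : (T.induce ({x}ᶜ : Set V)).dist a ⟨c, hcx⟩ = 1 := dist_eq_one_iff_adj.2 hc
      have htri := hconn.dist_triangle (u := a) (v := ⟨c, hcx⟩) (w := b)
      have := ih ⟨c, hcx⟩ (by simp only; omega)
      omega
  · obtain ⟨q, hq⟩ := hconn.exists_walk_length_eq_dist a b
    rw [← hq, ← Walk.length_map (Embedding.induce ({x}ᶜ : Set V)).toHom q]
    exact dist_le _

theorem IsLeafAt.kthPower_induce (hT : T.IsTree) (hx : IsLeafAt T p x) (k : ℕ) :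
    (T.induce ({x}ᶜ : Set V)).kthPower k = (T.kthPower k).induce ({x}ᶜ : Set V) := by
  ext a b
  rw [kthPower_adj (hx.isTree_induce hT), hx.dist_induce hT, comap_adj, kthPower_adj hT]
  simp [Subtype.ext_iff]

end Delete

/-! ### Recovering a tree from its cube -/

/-- The closed neighbourhood of `x`. -/
noncomputable def closedNbhd {V : Type*} [Fintype V] (G : SimpleGraph V) (x : V) : Finset V :=
  {y | y = x ∨ G.Adj x y}

/-- The simplicial vertices with the same closed neighbourhood as `x`. -/
noncomputable def twinSet {V : Type*} [Fintype V] (G : SimpleGraph V) (x : V) : Finset V :=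
  {y | IsSimplicialVertex G y ∧ closedNbhd G y = closedNbhd G x}

/-- The leaves attached to `p`. -/
noncomputable def leafSet {V : Type*} [Fintype V] (T : SimpleGraph V) (p : V) : Finset V :=
  {x | IsLeafAt T p x}

section Nbhd

variable {V : Type*} [Fintype V] {T : SimpleGraph V} {u v w a b c x y p q : V}

theorem mem_closedNbhd_iff : y ∈ closedNbhd T x ↔ y = x ∨ T.Adj x y := by simp [closedNbhd]

theorem mem_leafSet : x ∈ leafSet T p ↔ IsLeafAt T p x := by simp [leafSet]

theorem mem_closedNbhd (hT : T.IsTree) : y ∈ closedNbhd T x ↔ T.dist x y ≤ 1 := by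
  rw [mem_closedNbhd_iff, ← dist_eq_one_iff_adj, eq_comm, ← hT.connected.dist_eq_zero_iff]
  omega

theorem mem_closedNbhd_kthPower (hT : T.IsTree) {k : ℕ} :
    y ∈ closedNbhd (T.kthPower k) x ↔ T.dist x y ≤ k := by
  rw [mem_closedNbhd_iff, kthPower_adj hT]
  rcases eq_or_ne y x with rfl | h
  · simp
  · simp [h, h.symm]

theorem closedNbhd_inter_of_dist_eq_four (hT : T.IsTree) (ha : T.dist u a = 2)
    (hb : T.dist u b = 2) (hab : T.dist a b = 4) :
    closedNbhd (T.kthPower 3) a ∩ closedNbhd (T.kthPower 3) b = closedNbhd T u := by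
  have htri := fun y => hT.connected.dist_triangle (u := a) (v := y) (w := b)
  ext y
  rw [mem_inter, mem_closedNbhd_kthPower hT, mem_closedNbhd_kthPower hT, mem_closedNbhd hT]
  have hay := hT.connected.dist_triangle (u := a) (v := u) (w := y)
  have hby := hT.connected.dist_triangle (u := b) (v := u) (w := y)
  rw [SimpleGraph.dist_comm (v := u)] at hay hby
  refine ⟨fun hy => ?_, fun h => ⟨by omega, by omega⟩⟩
  by_contra! hcon
  obtain ⟨c, hc, hc', -⟩ := exists_adj_toward_isInner hT ha.ge
  obtain ⟨d, hd, hd', -⟩ := exists_adj_toward_isInner hT hb.ge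
  obtain ⟨e, he, he', -⟩ := exists_adj_toward_isInner hT hcon
  have hcd : c ≠ d := by
    rintro rfl
    have := htri c
    rw [SimpleGraph.dist_comm (u := a) (v := c)] at this
    omega
  by_cases hec : e = c
  · have := dist_eq_add_of_toward_ne hT he hd (hec.trans_ne hcd) he' hd'
    rw [SimpleGraph.dist_comm (u := b) (v := u)] at this
    omega
  · have := dist_eq_add_of_toward_ne hT he hc hec he' hc'
    rw [SimpleGraph.dist_comm (u := a) (v := u)] at this
    omega

theorem closedNbhd_inter_subset (hT : T.IsTree) (ha : 2 ≤ T.dist a u) (hb : 2 ≤ T.dist v b)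
    (h : T.Adj u v) (hab : T.dist a b = T.dist a u + 1 + T.dist v b) :
    closedNbhd (T.kthPower 3) a ∩ closedNbhd (T.kthPower 3) b ⊆ {u, v} := by
  have hav := hT.connected.dist_triangle (u := a) (v := v) (w := b)
  have hub := hT.connected.dist_triangle (u := a) (v := u) (w := b)
  intro y hy
  rw [mem_inter, mem_closedNbhd_kthPower hT, mem_closedNbhd_kthPower hT] at hy
  rw [mem_insert, mem_singleton]
  by_cases hyv : y ∈ branch T u v
  · have hay := dist_across hT h hyv (y := a) (by
      rw [mem_branch, SimpleGraph.dist_comm, SimpleGraph.dist_comm (u := u)]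
      omega)
    rw [SimpleGraph.dist_comm (u := y) (v := a), SimpleGraph.dist_comm (u := u)] at hay
    exact Or.inr (hT.connected.dist_eq_zero_iff.1 (by omega))
  · have hby := dist_across hT h (w := b) (y := y) (by rw [mem_branch]; omega) hyv
    rw [SimpleGraph.dist_comm (u := b) (v := v)] at hby
    exact Or.inl (hT.connected.dist_eq_zero_iff.1 (by omega)).symm

theorem IsCore.exists_closedNbhd_inter (hT : T.IsTree) (hu : IsCore T u) :
    ∃ a b, b ∉ closedNbhd (T.kthPower 3) a ∧
      closedNbhd (T.kthPower 3) a ∩ closedNbhd (T.kthPower 3) b = closedNbhd T u := by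
  obtain ⟨a, b, ha, hb, hab⟩ := hu.exists_dist_eq_four hT
  refine ⟨a, b, ?_, closedNbhd_inter_of_dist_eq_four hT ha hb hab⟩
  rw [mem_closedNbhd_kthPower hT]
  omega

theorem IsInner.three_le_card_closedNbhd (hu : IsInner T u) : 3 ≤ #(closedNbhd T u) := by
  obtain ⟨c, d, hcd, hc, hd⟩ := hu
  rw [← Finset.card_eq_three.2 ⟨u, c, d, hc.ne, hd.ne, hcd, rfl⟩]
  refine Finset.card_le_card fun y hy => ?_
  simp only [mem_insert, mem_singleton] at hy
  rw [mem_closedNbhd_iff]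
  rcases hy with rfl | rfl | rfl <;> tauto

theorem exists_isCore_of_closedNbhd_inter (hT : T.IsTree)
    (hab : b ∉ closedNbhd (T.kthPower 3) a)
    (hcard : 3 ≤ #(closedNbhd (T.kthPower 3) a ∩ closedNbhd (T.kthPower 3) b)) :
    ∃ u, IsCore T u ∧
      closedNbhd T u = closedNbhd (T.kthPower 3) a ∩ closedNbhd (T.kthPower 3) b := by
  rw [mem_closedNbhd_kthPower hT, not_le] at hab
  obtain ⟨g, -, -, hadj, hg⟩ := exists_geodesic hT a b
  have hg₂ := hg 2 (by omega)
  have hg₃ := hg 3 (by omega)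
  have hadj₂₃ : T.Adj (g 2) (g 3) := hadj 2 (by omega)
  obtain hab | hab : 5 ≤ T.dist a b ∨ T.dist a b = 4 := by omega
  · have hsub := closedNbhd_inter_subset hT (a := a) (b := b) (by omega) (by omega) hadj₂₃
      (by omega)
    have := (Finset.card_le_card hsub).trans card_le_two
    omega
  · have hua : T.dist (g 2) a = 2 := by rw [SimpleGraph.dist_comm, hg₂.1]
    have hub : T.dist (g 2) b = 2 := by omega
    exact ⟨g 2, isCore_of_dist_add_dist_eq hT hua.ge hub.ge (by omega),
      (closedNbhd_inter_of_dist_eq_four hT hua hub hab).symm⟩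

theorem IsInner.eq_of_closedNbhd_eq (hT : T.IsTree) (hu : IsInner T u)
    (h : closedNbhd T u = closedNbhd T v) : u = v := by
  by_contra huv
  obtain ⟨c, hc, hcv⟩ := hu.exists_adj_ne v
  have hadj : T.Adj u v :=
    (mem_closedNbhd_iff.1 (h ▸ mem_closedNbhd_iff.2 (Or.inl rfl))).resolve_left (Ne.symm huv)
  have hcmem : c ∈ closedNbhd T v := h ▸ mem_closedNbhd_iff.2 (Or.inr hc)
  rw [mem_closedNbhd hT, dist_eq_two hT hadj hc hcv.symm] at hcmem
  omega

theorem closedNbhd_inter_of_adj (hT : T.IsTree) (h : T.Adj u v) :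
    closedNbhd T u ∩ closedNbhd T v = {u, v} := by
  ext y
  rw [mem_inter, mem_insert, mem_singleton]
  constructor
  · rw [mem_closedNbhd hT, mem_closedNbhd hT]
    rintro ⟨huy, hvy⟩
    rcases dist_eq_add_one_or hT y h with huv | huv
    · exact Or.inr (hT.connected.dist_eq_zero_iff.1 (by omega)).symm
    · exact Or.inl (hT.connected.dist_eq_zero_iff.1 (by omega)).symm
  · rw [mem_closedNbhd_iff, mem_closedNbhd_iff]
    rintro (rfl | rfl)
    · exact ⟨Or.inl rfl, Or.inr h.symm⟩
    · exact ⟨Or.inr h, Or.inl rfl⟩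

theorem card_closedNbhd_inter_le_one (hT : T.IsTree) (huv : u ≠ v) (h : ¬ T.Adj u v) :
    #(closedNbhd T u ∩ closedNbhd T v) ≤ 1 := by
  have hmem : ∀ y ∈ closedNbhd T u ∩ closedNbhd T v, T.Adj u y ∧ T.Adj v y := by
    intro y hy
    rw [mem_inter, mem_closedNbhd_iff, mem_closedNbhd_iff] at hy
    rcases hy with ⟨rfl | hu, rfl | hv⟩
    · exact absurd rfl huv
    · exact absurd hv.symm h
    · exact absurd hu h
    · exact ⟨hu, hv⟩
  refine Finset.card_le_one.2 fun a ha b hb => ?_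
  have hdist := dist_eq_two hT (hmem a ha).1.symm (hmem a ha).2.symm huv
  exact eq_of_adj_toward hT (w := v) (hmem a ha).1 (hmem b hb).1
    (by rw [hdist, dist_eq_one_iff_adj.2 (hmem a ha).2.symm])
    (by rw [hdist, dist_eq_one_iff_adj.2 (hmem b hb).2.symm])

theorem adj_iff_card_closedNbhd_inter (hT : T.IsTree) (huv : u ≠ v) :
    T.Adj u v ↔ #(closedNbhd T u ∩ closedNbhd T v) = 2 := by
  refine ⟨fun h => by rw [closedNbhd_inter_of_adj hT h, card_pair huv], fun h => ?_⟩
  by_contra hadj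
  have := card_closedNbhd_inter_le_one hT huv hadj
  omega

theorem IsLeafAt.closedNbhd_kthPower (hT : T.IsTree) (hx : IsLeafAt T p x) (hp : ¬ IsCore T p)
    (hu : T.Adj p u) (hui : IsInner T u) :
    closedNbhd (T.kthPower 3) x = closedNbhd T p ∪ closedNbhd T u := by
  ext y
  rw [mem_union, mem_closedNbhd_kthPower hT, mem_closedNbhd hT, mem_closedNbhd hT,
    hx.dist_le_three_iff hT hp hu hui]

theorem IsLeafAt.closedNbhd_subset_iff (hT : T.IsTree) (hd : ∃ a b, 4 ≤ T.dist a b)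
    (hx : IsLeafAt T p x) (hp : ¬ IsCore T p) (hw : IsCore T w) :
    closedNbhd T w ⊆ closedNbhd (T.kthPower 3) x ↔ T.Adj w p := by
  obtain ⟨u, hu, hui⟩ := exists_adj_isInner hT hd p
  rw [hx.closedNbhd_kthPower hT hp hu hui]
  have hwp : w ≠ p := fun e => hp (e ▸ hw)
  constructor
  · intro h
    by_contra hadj
    have hwu : w ≠ u := by rintro rfl; exact hadj hu.symm
    have huw : T.Adj u w := by
      have hmem := h (mem_closedNbhd_iff.2 (Or.inl rfl))
      simp only [mem_union, mem_closedNbhd_iff, hwp, hwu, false_or] at hmem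
      exact hmem.resolve_left fun h => hadj h.symm
    obtain ⟨c, hc, hcu⟩ := hw.isInner.exists_adj_ne u
    have huc : T.dist u c = 2 := dist_eq_two hT huw.symm hc hcu.symm
    have hpc := dist_eq_add_one_of_ne hT huw hu.symm hwp (w := c) (by
      rw [huc, dist_eq_one_iff_adj.2 hc])
    have hmem := h (mem_closedNbhd_iff.2 (Or.inr hc))
    rw [mem_union, mem_closedNbhd hT, mem_closedNbhd hT] at hmem
    omega
  · intro h
    obtain rfl : w = u :=
      by_contra fun hwu => hp ⟨w, u, hwu, h.symm, hu, hw.isInner, hui⟩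
    exact subset_union_right

theorem IsLeafAt.twinSet_kthPower (hT : T.IsTree) (hd : ∃ a b, 4 ≤ T.dist a b)
    (hx : IsLeafAt T p x) (hp : ¬ IsCore T p) : twinSet (T.kthPower 3) x = leafSet T p := by
  obtain ⟨u, hu, hui⟩ := exists_adj_isInner hT hd p
  ext y
  rw [twinSet, mem_filter_univ, mem_leafSet, isSimplicialVertex_iff hT hd, isDeepLeaf_iff]
  refine ⟨?_, fun hy => ⟨⟨p, hy, hp⟩, by
    rw [hx.closedNbhd_kthPower hT hp hu hui, hy.closedNbhd_kthPower hT hp hu hui]⟩⟩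
  rintro ⟨⟨q, hy, hq⟩, he⟩
  obtain rfl | hqp := eq_or_ne q p
  · exact hy
  have hymem : y ∈ closedNbhd T p ∪ closedNbhd T u := by
    rw [← hx.closedNbhd_kthPower hT hp hu hui, ← he, mem_closedNbhd_iff]
    exact Or.inl rfl
  simp only [mem_union, mem_closedNbhd_iff] at hymem
  rcases hymem with (rfl | hpy) | (rfl | huy)
  · exact absurd (hx.isInner hT hd) hy.not_isInner
  · exact absurd ((hy p).1 hpy.symm).symm hqp
  · exact absurd hui hy.not_isInner
  · exact absurd ((hy u).1 huy.symm ▸ isCore_of_adj hT hd (hx.isInner hT hd) hp hu hui) hq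

end Nbhd

theorem exists_equiv_of_card_fiber_eq {V W K : Type*} [Fintype V] [Fintype W] {f : V → K}
    {g : W → K} (h : ∀ k, #{x | f x = k} = #{y | g y = k}) : ∃ e : V ≃ W, ∀ x, g (e x) = f x :=
  ⟨Equiv.ofFiberEquiv fun k => Fintype.equivOfCardEq (by
    rw [Fintype.card_subtype, Fintype.card_subtype, h k]), Equiv.ofFiberEquiv_map _⟩

section Skeleton

variable {V W : Type*} {T : SimpleGraph V} {S : SimpleGraph W}

theorem exists_anchor (hT : T.IsTree) (hd : ∃ a b, 4 ≤ T.dist a b) :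
    ∃ α : V → {p // IsInner T p},
      ∀ x, (IsInner T x ∧ α x = x) ∨ (¬ IsInner T x ∧ IsLeafAt T (α x) x) := by
  have hex : ∀ x, ∃ p : {p // IsInner T p},
      (IsInner T x ∧ p = x) ∨ (¬ IsInner T x ∧ IsLeafAt T p x) := by
    intro x
    by_cases hx : IsInner T x
    · exact ⟨⟨x, hx⟩, Or.inl ⟨hx, rfl⟩⟩
    · obtain ⟨p, hp, hpi⟩ := exists_adj_isInner hT hd x
      exact ⟨⟨p, hpi⟩, Or.inr ⟨hx, isLeafAt_of_not_isInner hp hx⟩⟩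
  exact Classical.axiom_of_choice hex

variable [Fintype V]

theorem card_fiber_anchor {α : V → {p // IsInner T p}}
    (hα : ∀ x, (IsInner T x ∧ α x = x) ∨ (¬ IsInner T x ∧ IsLeafAt T (α x) x))
    (p : {p // IsInner T p}) (i : Prop) :
    #{x | α x = p ∧ IsInner T x = i} = if i then 1 else #(leafSet T p) := by
  split_ifs with hi
  · refine Finset.card_eq_one.2 ⟨p, ?_⟩
    ext x
    simp only [mem_filter_univ, mem_singleton, hi, eq_iff_iff, iff_true]
    refine ⟨fun h => ?_, ?_⟩
    · obtain ⟨-, hx⟩ | ⟨hx, -⟩ := hα x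
      · exact hx.symm.trans (congrArg _ h.1)
      · exact absurd h.2 hx
    · rintro rfl
      obtain ⟨hp, hx⟩ | ⟨hx, -⟩ := hα p
      · exact ⟨Subtype.ext hx, hp⟩
      · exact absurd p.2 hx
  · congr 1
    ext x
    simp only [mem_filter_univ, mem_leafSet, hi, eq_iff_iff, iff_false]
    obtain ⟨hx, -⟩ | ⟨hx, hleaf⟩ := hα x
    · exact iff_of_false (fun h => h.2 hx) fun h => h.not_isInner hx
    · exact ⟨fun h => h.1 ▸ hleaf, fun h => ⟨Subtype.ext (h.eq hleaf), hx⟩⟩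

theorem nonempty_iso_of_equiv_isInner [Fintype W] (hT : T.IsTree) (hS : S.IsTree)
    (hdT : ∃ a b, 4 ≤ T.dist a b) (hdS : ∃ a b, 4 ≤ S.dist a b)
    (e : {p // IsInner T p} ≃ {q // IsInner S q})
    (hadj : ∀ p p' : {p // IsInner T p}, T.Adj p p' → S.Adj (e p) (e p'))
    (hcard : ∀ p : {p // IsInner T p}, #(leafSet T p) = #(leafSet S (e p))) :
    Nonempty (T ≃g S) := by
  obtain ⟨α, hα⟩ := exists_anchor hT hdT
  obtain ⟨β, hβ⟩ := exists_anchor hS hdS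
  obtain ⟨φ, hφ⟩ := exists_equiv_of_card_fiber_eq
    (f := fun x => (e (α x), IsInner T x)) (g := fun y => (β y, IsInner S y)) (by
      rintro ⟨q, i⟩
      obtain ⟨p, rfl⟩ := e.surjective q
      simp only [Prod.mk.injEq, e.apply_eq_iff_eq]
      rw [card_fiber_anchor hα, card_fiber_anchor hβ, hcard])
  simp only [Prod.mk.injEq, eq_iff_iff] at hφ
  have hinner : ∀ x, IsInner T x → φ x = (e (α x) : W) := fun x hx => by
    rcases hβ (φ x) with ⟨-, h⟩ | ⟨h, -⟩
    · rw [← (hφ x).1, h]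
    · exact absurd ((hφ x).2.2 hx) h
  have hleaf : ∀ x y, T.Adj x y → ¬ IsInner T y → S.Adj (φ x) (φ y) := by
    intro x y hxy hy
    obtain ⟨h, -⟩ | ⟨-, hy'⟩ := hα y
    · exact absurd h hy
    obtain rfl : x = α y := (hy' x).1 hxy.symm
    obtain ⟨h, -⟩ | ⟨-, hφy⟩ := hβ (φ y)
    · exact absurd ((hφ y).2.1 h) hy
    obtain ⟨-, h⟩ | ⟨h, -⟩ := hα (α y)
    · rw [hinner _ (α y).2, Subtype.ext h, ← (hφ y).1]
      exact hφy.adj.symm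
    · exact absurd (α y).2 h
  refine nonempty_iso_of_injective hT hS φ.injective (Fintype.card_congr φ) fun x y hxy => ?_
  by_cases hy : IsInner T y
  · by_cases hx : IsInner T x
    · rw [hinner x hx, hinner y hy]
      apply hadj
      have hαx := ((hα x).resolve_right fun h => h.1 hx).2
      have hαy := ((hα y).resolve_right fun h => h.1 hy).2
      rwa [hαx, hαy]
    · exact (hleaf y x hxy.symm hx).symm
  · exact hleaf x y hxy hy

end Skeleton

/-- Two trees on the same vertices have the same cube, which is not complete. -/
structure IsCubeRootPair {V : Type*} (T S : SimpleGraph V) : Prop where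
  left : T.IsTree
  right : S.IsTree
  exists_dist : ∃ a b, 4 ≤ T.dist a b
  kthPower_eq : T.kthPower 3 = S.kthPower 3

/-- The inner vertex `u` of `T` and the inner vertex `v` of `S` leave the same trace in the cube:
the closed neighbourhood for a core vertex, the set of leaves attached to it for a vertex that is
not core. -/
inductive SamePlace {V : Type*} [Fintype V] (T S : SimpleGraph V) (u v : V) : Prop
  | core (hu : IsCore T u) (hv : IsCore S v) (h : closedNbhd T u = closedNbhd S v)
  | rim (hu : IsInner T u) (hu' : ¬ IsCore T u) (hv : IsInner S v) (hv' : ¬ IsCore S v)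
      (h : leafSet T u = leafSet S v)

section SamePlace

variable {V : Type*} {T S : SimpleGraph V} {u u' v v' p q : V}

theorem IsCubeRootPair.symm (h : IsCubeRootPair T S) : IsCubeRootPair S T where
  left := h.right
  right := h.left
  exists_dist := (kthPower_ne_top_iff h.right).1
    (h.kthPower_eq ▸ (kthPower_ne_top_iff h.left).2 h.exists_dist)
  kthPower_eq := h.kthPower_eq.symm

variable [Fintype V]

theorem IsInner.eq_of_leafSet_eq (hp : IsInner T p) (hp' : ¬ IsCore T p)
    (h : leafSet T p = leafSet T q) : p = q := by
  obtain ⟨x, hx⟩ := hp.exists_isLeafAt hp'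
  exact (mem_leafSet.1 (h ▸ mem_leafSet.2 hx)).eq hx

theorem SamePlace.symm (h : SamePlace T S u v) : SamePlace S T v u := by
  cases h with
  | core hu hv h => exact .core hv hu h.symm
  | rim hu hu' hv hv' h => exact .rim hv hv' hu hu' h.symm

theorem SamePlace.isInner_right (h : SamePlace T S u v) : IsInner S v := by
  cases h with
  | core _ hv => exact hv.isInner
  | rim _ _ hv => exact hv

theorem SamePlace.right_unique (hS : S.IsTree) (h : SamePlace T S u v)
    (h' : SamePlace T S u v') : v = v' := by
  cases h with
  | core hu hv h =>
    cases h' with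
    | core _ _ h' => exact hv.isInner.eq_of_closedNbhd_eq hS (h.symm.trans h')
    | rim _ hu' => exact absurd hu hu'
  | rim _ hu hv hv' h =>
    cases h' with
    | core hu' => exact absurd hu' hu
    | rim _ _ _ _ h' => exact hv.eq_of_leafSet_eq hv' (h.symm.trans h')

theorem IsCubeRootPair.exists_samePlace (h : IsCubeRootPair T S) (hu : IsInner T u) :
    ∃ v, SamePlace T S u v := by
  by_cases huc : IsCore T u
  · obtain ⟨a, b, hab, hinter⟩ := huc.exists_closedNbhd_inter h.left
    have hcard := hu.three_le_card_closedNbhd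
    rw [← hinter, h.kthPower_eq] at hcard
    rw [h.kthPower_eq] at hab hinter
    obtain ⟨v, hv, hv'⟩ := exists_isCore_of_closedNbhd_inter h.right hab hcard
    exact ⟨v, .core huc hv (hinter.symm.trans hv'.symm)⟩
  · obtain ⟨x, hx⟩ := hu.exists_isLeafAt huc
    have hsimp := (isSimplicialVertex_iff h.left h.exists_dist).2 (isDeepLeaf_iff.2 ⟨u, hx, huc⟩)
    rw [h.kthPower_eq, isSimplicialVertex_iff h.right h.symm.exists_dist, isDeepLeaf_iff] at hsimp
    obtain ⟨v, hv, hvc⟩ := hsimp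
    refine ⟨v, .rim hu huc (hv.isInner h.right h.symm.exists_dist) hvc ?_⟩
    rw [← hx.twinSet_kthPower h.left h.exists_dist huc, h.kthPower_eq,
      hv.twinSet_kthPower h.right h.symm.exists_dist hvc]

theorem IsCubeRootPair.adj_of_isCore_of_not_isCore (h : IsCubeRootPair T S) (hu : IsCore T u)
    (hv : IsCore S v) (huv : closedNbhd T u = closedNbhd S v) (hp : IsInner T p)
    (hp' : ¬ IsCore T p) (hq : ¬ IsCore S q) (hpq : leafSet T p = leafSet S q)
    (hadj : T.Adj u p) : S.Adj v q := by
  obtain ⟨x, hx⟩ := hp.exists_isLeafAt hp'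
  have hx' : IsLeafAt S q x := mem_leafSet.1 (hpq ▸ mem_leafSet.2 hx)
  rw [← hx'.closedNbhd_subset_iff h.right h.symm.exists_dist hq hv, ← huv, ← h.kthPower_eq]
  exact (hx.closedNbhd_subset_iff h.left h.exists_dist hp' hu).2 hadj

theorem IsCubeRootPair.adj_of_samePlace (h : IsCubeRootPair T S) (huv : SamePlace T S u v)
    (huv' : SamePlace T S u' v') (hadj : T.Adj u u') : S.Adj v v' := by
  cases huv with
  | core hu hv he =>
    cases huv' with
    | core hu' hv' he' =>
      have hne : v ≠ v' := by
        rintro rfl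
        exact hadj.ne (hu.isInner.eq_of_closedNbhd_eq h.left (he.trans he'.symm))
      rw [adj_iff_card_closedNbhd_inter h.right hne, ← he, ← he']
      exact (adj_iff_card_closedNbhd_inter h.left hadj.ne).1 hadj
    | rim hu' huc' _ hvc' he' =>
      exact h.adj_of_isCore_of_not_isCore hu hv he hu' huc' hvc' he' hadj
  | rim hu huc _ hvc he =>
    cases huv' with
    | core hu' hv' he' =>
      exact (h.adj_of_isCore_of_not_isCore hu' hv' he' hu huc hvc he hadj.symm).symm
    | rim hu' huc' =>
      exact absurd (isCore_of_adj h.left h.exists_dist hu huc hadj hu') huc'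

theorem card_closedNbhd_eq_add : #(closedNbhd T u) =
    #{a | T.Adj u a ∧ IsInner T a} + #(leafSet T u) + 1 := by
  have hleaf : leafSet T u = ({a | T.Adj u a ∧ ¬ IsInner T a} : Finset V) := by
    ext x
    rw [mem_leafSet, mem_filter_univ]
    exact ⟨fun h => ⟨h.adj.symm, h.not_isInner⟩, fun h => isLeafAt_of_not_isInner h.1.symm h.2⟩
  rw [hleaf, ← filter_filter, ← filter_filter, card_filter_add_card_filter_not,
    ← card_insert_of_notMem (a := u) (by simp)]
  congr 1
  ext y
  rw [mem_closedNbhd_iff, mem_insert, mem_filter_univ]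

theorem IsCubeRootPair.card_adj_isInner_le (h : IsCubeRootPair T S) (huv : SamePlace T S u v) :
    #{a | T.Adj u a ∧ IsInner T a} ≤ #{b | S.Adj v b ∧ IsInner S b} := by
  choose! f hf using fun a => h.exists_samePlace (u := a)
  refine Finset.card_le_card_of_injOn f (fun a ha => ?_) fun a ha b hb hab => ?_
  · rw [mem_coe, mem_filter_univ] at ha ⊢
    exact ⟨h.adj_of_samePlace huv (hf a ha.2) ha.1, (hf a ha.2).isInner_right⟩
  · rw [mem_coe, mem_filter_univ] at ha hb
    exact (hf a ha.2).symm.right_unique h.left (hab ▸ (hf b hb.2).symm)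

theorem IsCubeRootPair.card_leafSet_eq (h : IsCubeRootPair T S) (huv : SamePlace T S u v) :
    #(leafSet T u) = #(leafSet S v) := by
  have hle := h.card_adj_isInner_le huv
  have hge := h.symm.card_adj_isInner_le huv.symm
  cases huv with
  | core _ _ he =>
    have := congrArg Finset.card he
    rw [card_closedNbhd_eq_add, card_closedNbhd_eq_add] at this
    omega
  | rim _ _ _ _ he => rw [he]

end SamePlace

theorem IsCubeRootPair.nonempty_iso {V : Type*} [Finite V] {T S : SimpleGraph V}
    (h : IsCubeRootPair T S) : Nonempty (T ≃g S) := by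
  cases nonempty_fintype V
  choose f hf using fun u : {u // IsInner T u} => h.exists_samePlace u.2
  choose g hg using fun v : {v // IsInner S v} => h.symm.exists_samePlace v.2
  let e : {u // IsInner T u} ≃ {v // IsInner S v} :=
    { toFun := fun u => ⟨f u, (hf u).isInner_right⟩
      invFun := fun v => ⟨g v, (hg v).isInner_right⟩
      left_inv := fun u => Subtype.ext ((hg _).right_unique h.left (hf u).symm)
      right_inv := fun v => Subtype.ext ((hf _).right_unique h.right (hg v).symm) }
  exact nonempty_iso_of_equiv_isInner h.left h.right h.exists_dist h.symm.exists_dist e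
    (fun _ _ => h.adj_of_samePlace (hf _) (hf _)) fun _ => h.card_leafSet_eq (hf _)

/-! ### Reconstruction from the deck -/

/-- The set of cliques with `k` vertices. Unlike `SimpleGraph.cliqueFinset`, it does not depend on
the choice of a decision procedure for equality of vertices. -/
noncomputable def cliques {V : Type*} [Fintype V] (G : SimpleGraph V) (k : ℕ) :
    Finset (Finset V) :=
  {s | G.IsNClique k s}

section Kelly

variable {V W : Type*} [Fintype V] [Fintype W] {G : SimpleGraph V} {H : SimpleGraph W} {k : ℕ}

theorem mem_cliques {s : Finset V} : s ∈ cliques G k ↔ G.IsNClique k s :=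
  mem_filter_univ s

theorem card_cliques_eq_of_iso (e : G ≃g H) : #(cliques G k) = #(cliques H k) := by
  refine Finset.card_equiv e.toEquiv.finsetCongr fun s => ?_
  rw [mem_cliques, mem_cliques, isNClique_iff, isNClique_iff,
    Equiv.finsetCongr_apply, card_map, coe_map, isClique_iff, isClique_iff,
    e.toEquiv.toEmbedding.injective.injOn.pairwise_image]
  refine and_congr_left fun _ => ?_
  exact forall₅_congr fun a _ b _ _ => e.map_adj_iff.symm

theorem card_cliques_induce (v : V) :
    #(cliques (G.induce ({v}ᶜ : Set V)) k) = #{s ∈ cliques G k | v ∉ s} := by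
  refine Finset.card_nbij (Finset.map (.subtype _)) (fun s hs => ?_)
    (Finset.map_injective _).injOn fun s hs => ?_
  · rw [mem_coe, mem_cliques, isNClique_iff, isClique_induce_iff] at hs
    rw [mem_coe, mem_filter, mem_cliques, isNClique_iff, card_map, coe_map]
    exact ⟨hs, by simp⟩
  · rw [mem_coe, mem_filter, mem_cliques, isNClique_iff] at hs
    have hmap : (s.subtype (· ∈ ({v}ᶜ : Set V))).map (.subtype _) = s :=
      subtype_map_of_mem fun a ha => ne_of_mem_of_not_mem ha hs.2
    refine ⟨s.subtype (· ∈ ({v}ᶜ : Set V)), ?_, hmap⟩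
    rw [mem_coe, mem_cliques, isNClique_iff, isClique_induce_iff, ← card_map (.subtype _)]
    have hcoe := congrArg ((↑) : Finset V → Set V) hmap
    rw [coe_map] at hcoe
    rw [hmap]
    exact ⟨hcoe ▸ hs.1.1, hs.1.2⟩

/-- Kelly's counting identity. -/
theorem sum_card_cliques_induce (G : SimpleGraph V) (k : ℕ) :
    ∑ v, #(cliques (G.induce ({v}ᶜ : Set V)) k) =
      #(cliques G k) * (Fintype.card V - k) := by
  have hcompl : ∀ s ∈ cliques G k, #{v | v ∉ s} = Fintype.card V - k := fun s hs => by
    rw [← (mem_cliques.1 hs).card_eq, ← card_compl]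
    congr 1
    ext v
    simp
  calc
    _ = ∑ v, #{s ∈ cliques G k | v ∉ s} := by simp only [card_cliques_induce]
    _ = ∑ s ∈ cliques G k, #{v | v ∉ s} :=
      sum_card_bipartiteAbove_eq_sum_card_bipartiteBelow _
    _ = #(cliques G k) * (Fintype.card V - k) := sum_const_nat hcompl

theorem card_cliques_eq_of_induce_iso (hk : k < Fintype.card V) (φ : V ≃ W)
    (h : ∀ v, Nonempty (G.induce ({v}ᶜ : Set V) ≃g H.induce ({φ v}ᶜ : Set W))) :
    #(cliques G k) = #(cliques H k) := by
  refine Nat.eq_of_mul_eq_mul_right (Nat.sub_pos_of_lt hk) ?_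
  rw [← sum_card_cliques_induce, Fintype.card_congr φ, ← sum_card_cliques_induce]
  exact Fintype.sum_equiv φ _ _ fun v => card_cliques_eq_of_iso (h v).some

theorem card_filter_mem_cliques_eq (hk : k < Fintype.card V) (φ : V ≃ W)
    (h : ∀ v, Nonempty (G.induce ({v}ᶜ : Set V) ≃g H.induce ({φ v}ᶜ : Set W))) (v : V) :
    #{s ∈ cliques G k | v ∈ s} = #{s ∈ cliques H k | φ v ∈ s} := by
  have htotal := card_cliques_eq_of_induce_iso hk φ h
  have hcard := card_cliques_eq_of_iso (k := k) (h v).some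
  rw [card_cliques_induce, card_cliques_induce] at hcard
  rw [← card_filter_add_card_filter_not (v ∈ ·),
    ← card_filter_add_card_filter_not (s := cliques H k) (φ v ∈ ·), hcard] at htotal
  exact Nat.add_right_cancel htotal

theorem card_filter_mem_cliques_succ (G : SimpleGraph V) (v : V) (k : ℕ) :
    #{s ∈ cliques G (k + 1) | v ∈ s} =
      #{s ∈ powersetCard k (G.neighborFinset v) | G.IsClique (s : Finset V)} := by
  symm
  refine Finset.card_nbij (insert v) (fun s hs => ?_) (fun s hs t ht hst => ?_) fun s hs => ?_
  · simp only [mem_coe, mem_filter, mem_powersetCard, subset_iff, mem_neighborFinset] at hs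
    rw [mem_coe, mem_filter, mem_cliques]
    exact ⟨.insert ⟨hs.2, hs.1.2⟩ hs.1.1, mem_insert_self v s⟩
  · simp only [mem_coe, mem_filter, mem_powersetCard, subset_iff, mem_neighborFinset] at hs ht
    rw [← erase_insert fun hv => (hs.1.1 hv).ne rfl, hst,
      erase_insert fun hv => (ht.1.1 hv).ne rfl]
  · rw [mem_coe, mem_filter, mem_cliques] at hs
    refine ⟨s.erase v, ?_, insert_erase hs.2⟩
    simp only [mem_coe, mem_filter, mem_powersetCard, subset_iff, mem_neighborFinset]
    have herase := hs.1.erase_of_mem hs.2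
    refine ⟨⟨fun a ha => ?_, herase.card_eq⟩, herase.isClique⟩
    exact hs.1.isClique hs.2 (mem_of_mem_erase ha) (ne_of_mem_erase ha).symm

theorem card_filter_mem_cliques_two (G : SimpleGraph V) (v : V) :
    #{s ∈ cliques G 2 | v ∈ s} = G.degree v := by
  rw [card_filter_mem_cliques_succ, filter_true_of_mem, card_powersetCard, Nat.choose_one_right,
    card_neighborFinset_eq_degree]
  intro s hs
  obtain ⟨a, rfl⟩ := Finset.card_eq_one.1 (mem_powersetCard.1 hs).2
  simp

theorem isSimplicialVertex_iff_card_filter {v : V} :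
    IsSimplicialVertex G v ↔
      #{s ∈ cliques G 3 | v ∈ s} = #(powersetCard 2 (G.neighborFinset v)) := by
  rw [card_filter_mem_cliques_succ, card_filter_eq_iff]
  constructor
  · intro h s hs a ha b hb
    have hsub := (mem_powersetCard.1 hs).1
    exact h a b ((mem_neighborFinset _ _ _).1 (hsub ha)) ((mem_neighborFinset _ _ _).1 (hsub hb))
  · intro h a b ha hb hab
    refine h {a, b} (mem_powersetCard.2 ⟨?_, card_pair hab⟩) (by simp) (by simp) hab
    simp [insert_subset_iff, ha, hb]

theorem degree_eq_of_induce_iso (hV : 2 < Fintype.card V) (φ : V ≃ W)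
    (h : ∀ v, Nonempty (G.induce ({v}ᶜ : Set V) ≃g H.induce ({φ v}ᶜ : Set W))) (v : V) :
    G.degree v = H.degree (φ v) := by
  rw [← card_filter_mem_cliques_two, ← card_filter_mem_cliques_two,
    card_filter_mem_cliques_eq hV φ h]

theorem card_filter_eq_and_adj (G : SimpleGraph V) (x : V) (i j : Prop) :
    #{a | (a = x) = i ∧ G.Adj x a = j} =
      if i then if j then 0 else 1 else if j then G.degree x else Gᶜ.degree x := by
  split_ifs with hi hj hj
  all_goals simp only [hi, hj, eq_iff_iff, iff_true, iff_false]
  · simp +contextual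
  · refine Finset.card_eq_one.2 ⟨x, ?_⟩
    ext a
    simp +contextual
  · rw [← card_neighborFinset_eq_degree]
    congr 1
    ext a
    simpa using fun h : G.Adj x a => h.ne'
  · rw [← card_neighborFinset_eq_degree]
    congr 1
    ext a
    simp [compl_adj, eq_comm]

theorem nonempty_iso_of_isClique_compl_singleton {x : V} {y : W} (hG : G.IsClique {x}ᶜ)
    (hH : H.IsClique {y}ᶜ) (hcard : Fintype.card V = Fintype.card W)
    (hdeg : G.degree x = H.degree y) : Nonempty (G ≃g H) := by
  obtain ⟨e, he⟩ := exists_equiv_of_card_fiber_eq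
    (f := fun a => (a = x, G.Adj x a)) (g := fun b => (b = y, H.Adj y b)) (by
      rintro ⟨i, j⟩
      simp only [Prod.mk.injEq]
      rw [card_filter_eq_and_adj, card_filter_eq_and_adj, degree_compl, degree_compl, hcard, hdeg])
  simp only [Prod.mk.injEq, eq_iff_iff] at he
  refine ⟨⟨e, fun {a b} => ?_⟩⟩
  rcases eq_or_ne a x with rfl | ha
  · rw [(he a).1.2 rfl]
    exact (he b).2
  rcases eq_or_ne b x with rfl | hb
  · rw [(he b).1.2 rfl, H.adj_comm, G.adj_comm]
    exact (he a).2
  · refine ⟨fun h => hG ha hb (ne_of_apply_ne e h.ne), fun h => ?_⟩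
    exact hH (mt (he a).1.1 ha) (mt (he b).1.1 hb) (e.injective.ne h.ne)

end Kelly

theorem isSimplicialVertex_iff_of_induce_iso {V W : Type*} [Fintype V] [Finite W]
    {G : SimpleGraph V} {H : SimpleGraph W} (hV : 3 < Fintype.card V) (φ : V ≃ W)
    (h : ∀ v, Nonempty (G.induce ({v}ᶜ : Set V) ≃g H.induce ({φ v}ᶜ : Set W))) (v : V) :
    IsSimplicialVertex G v ↔ IsSimplicialVertex H (φ v) := by
  cases nonempty_fintype W
  simp only [isSimplicialVertex_iff_card_filter, card_powersetCard, card_neighborFinset_eq_degree,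
    card_filter_mem_cliques_eq hV φ h, degree_eq_of_induce_iso (by omega) φ h]

section Reconstruction

variable {V W : Type u} {G T : SimpleGraph V} {H S : SimpleGraph W} {k : ℕ}

theorem kthPower_comap (S : SimpleGraph W) (e : V ≃ W) (k : ℕ) :
    (S.comap e).kthPower k = (S.kthPower k).comap e := by
  ext a b
  exact and_congr e.injective.ne_iff.symm (by rw [← edist_map_iso (Iso.comap e S)]; rfl)

theorem nonempty_kthPower_iso (e : T ≃g S) (k : ℕ) : Nonempty (T.kthPower k ≃g S.kthPower k) :=
  ⟨e.toEquiv, fun {a b} => and_congr e.injective.ne_iff (by rw [← edist_map_iso e]; rfl)⟩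

theorem comap_eq_of_iso (e : G ≃g H) : H.comap e.toEquiv = G := by
  ext a b
  exact e.map_adj_iff

theorem eq_top_of_iso (e : G ≃g H) (h : G = ⊤) : H = ⊤ := by
  subst h
  exact (comap_eq_of_iso e.symm).symm.trans (comap_top e.symm.injective)

theorem exists_isTree_eq_kthPower (h : G.IsTreeCube) :
    ∃ T : SimpleGraph V, T.IsTree ∧ G = T.kthPower 3 := by
  obtain ⟨U, T, hT, ⟨e⟩⟩ := h
  refine ⟨T.comap e.toEquiv, (Iso.comap e.toEquiv T).isTree_iff.2 hT, ?_⟩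
  rw [kthPower_comap, comap_eq_of_iso]

theorem nonempty_iso_of_kthPower_iso [Finite V] (hT : T.IsTree) (hS : S.IsTree)
    (h : T.kthPower 3 ≠ ⊤) (e : T.kthPower 3 ≃g S.kthPower 3) : Nonempty (T ≃g S) := by
  let e' : S.comap e.toEquiv ≃g S := Iso.comap e.toEquiv S
  have hpair : IsCubeRootPair T (S.comap e.toEquiv) :=
    ⟨hT, e'.isTree_iff.2 hS, (kthPower_ne_top_iff hT).1 h, by rw [kthPower_comap, comap_eq_of_iso]⟩
  obtain ⟨e₁⟩ := hpair.nonempty_iso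
  exact ⟨e₁.trans e'⟩

theorem exists_equiv_of_deck_eq [Fintype V] [Fintype W] (h : G.deck = H.deck) :
    ∃ φ : V ≃ W, ∀ v, Nonempty (G.induce ({v}ᶜ : Set V) ≃g H.induce ({φ v}ᶜ : Set W)) := by
  obtain ⟨φ, hφ⟩ := exists_equiv_of_card_fiber_eq (f := G.card) (g := H.card) fun κ => by
    have hcount := congrArg (Multiset.count κ) h
    simp only [deck, Multiset.count_map] at hcount
    simp only [eq_comm (b := κ)]
    exact hcount
  exact ⟨φ, fun v => Quotient.exact (hφ v).symm⟩

theorem kthPower_eq_top_of_card_le [Fintype V] (hT : T.IsTree) (h : Fintype.card V ≤ k + 1) :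
    T.kthPower k = ⊤ := by
  by_contra htop
  obtain ⟨a, b, hab⟩ := (kthPower_ne_top_iff hT).1 htop
  obtain ⟨p, hp, hlength⟩ := hT.connected.exists_path_of_dist a b
  have := hp.length_lt
  omega

theorem nonempty_iso_of_induce_kthPower_iso [Finite V] [Finite W] (hT : T.IsTree)
    (hS : S.IsTree) (φ : V ≃ W)
    (hφ : ∀ v, Nonempty ((T.kthPower 3).induce ({v}ᶜ : Set V) ≃g
      (S.kthPower 3).induce ({φ v}ᶜ : Set W)))
    (hcard : ∀ v, (T.kthPower 3).induce ({v}ᶜ : Set V) ≠ ⊤) : Nonempty (T ≃g S) := by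
  cases nonempty_fintype V
  obtain ⟨x₀⟩ := hT.connected.nonempty
  have hTtop : T.kthPower 3 ≠ ⊤ := fun h => hcard x₀ (by rw [h, induce_top])
  have hStop : S.kthPower 3 ≠ ⊤ := fun h =>
    hcard x₀ (eq_top_of_iso (hφ x₀).some.symm (by rw [h, induce_top]))
  have hdT := (kthPower_ne_top_iff hT).1 hTtop
  have hdS := (kthPower_ne_top_iff hS).1 hStop
  have hV : 3 + 1 < Fintype.card V := not_le.1 (mt (kthPower_eq_top_of_card_le hT) hTtop)
  have hdeep : ∀ x, IsDeepLeaf T x ↔ IsDeepLeaf S (φ x) := fun x => by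
    rw [← isSimplicialVertex_iff hT hdT, ← isSimplicialVertex_iff hS hdS,
      isSimplicialVertex_iff_of_induce_iso (by omega) φ hφ]
  refine nonempty_iso_of_induce_iso hT hS hdT hdS φ hdeep fun x hx => ?_
  obtain ⟨q, hq, -⟩ := (hdeep x).1 hx
  obtain ⟨p, hp, -⟩ := hx
  have hx_card := hcard x
  have hiso := hφ x
  rw [← hp.kthPower_induce hT] at hx_card hiso
  rw [← hq.kthPower_induce hS] at hiso
  exact nonempty_iso_of_kthPower_iso (hp.isTree_induce hT) (hq.isTree_induce hS) hx_card hiso.some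

end Reconstruction

end TreeCube

open TreeCube

theorem lemma4p1 :
    SimpleGraph.IsWeaklyReconstructible.{u} (fun _ G => SimpleGraph.IsTreeCube G) := by
  intro V W _ _ G H hG hH hdeck
  obtain ⟨T, hT, rfl⟩ := exists_isTree_eq_kthPower hG
  obtain ⟨S, hS, rfl⟩ := exists_isTree_eq_kthPower hH
  obtain ⟨φ, hφ⟩ := exists_equiv_of_deck_eq hdeck
  have hVW := Fintype.card_congr φ
  rcases le_or_gt (Fintype.card V) 4 with hV | hV
  · rw [kthPower_eq_top_of_card_le hT hV, kthPower_eq_top_of_card_le hS (hVW ▸ hV)]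
    exact ⟨.completeGraph φ⟩
  by_cases hcomplete : ∃ x, (T.kthPower 3).induce ({x}ᶜ : Set V) = ⊤
  · obtain ⟨x, hx⟩ := hcomplete
    have hy := eq_top_of_iso (hφ x).some hx
    rw [SimpleGraph.induce_eq_top] at hx hy
    exact nonempty_iso_of_isClique_compl_singleton hx hy hVW
      (degree_eq_of_induce_iso (by omega) φ hφ x)
  · obtain ⟨e⟩ := nonempty_iso_of_induce_kthPower_iso hT hS φ hφ (not_exists.1 hcomplete)
    exact nonempty_kthPower_iso e 3
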